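/- **Setting.** Let $d\in\{2,3\}$ and let $\Omega\subset\mathbb R^d$ be an open bounded polyhedral domain, i.e. a nonempty bounded connected open set with $\Omega=\operatorname{int}\overline\Omega$ such that $\overline\Omega$ is a finite union of convex polytopes. A mesh $\mathcal E_h$ is a finite set of closed convex polytopes with nonempty, pairwise disjoint interiors (e.g. simplices), with union $\overline\Omega$, such that every facet of an element is either a facet of a second element (interior face, the set of these is $\Gamma_h$) or contained in $\partial\Omega$ (boundary face). It is $\rho$-regular if $h_E/\rho_E\le\rho$ for all $E\in\mathcal E_h$, where $h_E=\operatorname{diam}E$ and $\rho_E$ is the maximal diameter of a ball contained in $E$. For an interior face $e$ shared by $E_e^1,E_e^2$, $\mathbf n_e$ is the unit normal pointing from $E^1_e$ to $E^2_e$, $\{\theta\}=\frac12(\theta|_{E_e^1}+\theta|_{E_e^2})$ and $[\theta]=\theta|_{E_e^1}-\theta|_{E_e^2}$; for a boundary face, $\mathbf n_e$ is the outward normal to $\Omega$ and $\{\theta\}=[\theta]=\theta$. Put $h_e=|e|^{1/(d-1)}$. $(\cdot,\cdot)$ and $\|\cdot\|$ are the inner product and norm of $L^2(\Omega)$, and $\nabla_h\cdot$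 is the elementwise divergence. For integers $k_1\ge1$, $k_2\ge0$ let $\mathbf X_h$ and $M_h$ be the spaces of $\mathbb R^d$-valued, respectively scalar, functions whose restriction to each $E\in\mathcal E_h$ is a polynomial of total degree at most $k_1$, respectively $k_2$, and let $M_{h0}=\{q\in M_h:\int_\Omega q=0\}$. Let $\mu,\delta,\sigma,\tilde\sigma>0$, $\epsilon\in\{-1,0,1\}$. Write $\mathbf n_E$ for the outward normal to $E$, and $\mathbf v^{\rm int}$, $\mathbf v^{\rm ext}$ for the traces on $\partial E$ from inside and outside $E$ ($\mathbf v^{\rm ext}=0$ on $\partial\Omega$). Define $$a_{\mathcal C}(\mathbf z;\mathbf w,\mathbf v,\boldsymbol\theta)=\sum_E\Big(\int_E(\mathbf w\cdot\nabla\mathbf v)\cdot\boldsymbol\theta+\tfrac12\int_E(\nabla\cdot\mathbf w)\,\mathbf v\cdot\boldsymbol\theta\Big)-\tfrac12\sum_{e\in\Gamma_h\cup\partial\Omega}\int_e[\mathbf w]\cdot\mathbf n_e\{\mathbf v\cdot\boldsymbol\theta\}+\sum_E\int_{\{x\in\partial E:\,\{\mathbf z\}\cdot\mathbf n_E<0\}}|\{\mathbf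 w\}\cdot\mathbf n_E|(\mathbf v^{\rm int}-\mathbf v^{\rm ext})\cdot\boldsymbol\theta^{\rm int},$$ $$a_\epsilon(\mathbf v,\boldsymbol\theta)=\sum_E\int_E\nabla\mathbf v:\nabla\boldsymbol\theta-\sum_{e\in\Gamma_h\cup\partial\Omega}\int_e\{\nabla\mathbf v\}\mathbf n_e\cdot[\boldsymbol\theta]+\epsilon\sum_{e\in\Gamma_h\cup\partial\Omega}\int_e\{\nabla\boldsymbol\theta\}\mathbf n_e\cdot[\mathbf v]+\sum_{e\in\Gamma_h\cup\partial\Omega}\frac{\sigma}{h_e}\int_e[\mathbf v]\cdot[\boldsymbol\theta],$$ $$b(\boldsymbol\theta,q)=\sum_E\int_E(\nabla\cdot\boldsymbol\theta)q-\sum_{e\in\Gamma_h\cup\partial\Omega}\int_e\{q\}[\boldsymbol\theta]\cdot\mathbf n_e,$$ $$a_{\rm ellip}(\phi,q)=\sum_E\int_E\nabla\phi\cdot\nabla q-\sum_{e\in\Gamma_h}\int_e\{\nabla\phi\}\cdot\mathbf n_e[q]-\sum_{e\in\Gamma_h}\int_e\{\nabla q\}\cdot\mathbf n_e[\phi]+\sum_{e\in\Gamma_h}\frac{\tilde\sigma}{h_e}\int_e[\phi][q],$$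 $$\|\boldsymbol\theta\|_{\rm DG}^2=\sum_E\|\nabla\boldsymbol\theta\|_{L^2(E)}^2+\sum_{e\in\Gamma_h\cup\partial\Omega}\frac{\sigma}{h_e}\|[\boldsymbol\theta]\|^2_{L^2(e)},\qquad |q|_{\rm DG}^2=\sum_E\|\nabla q\|_{L^2(E)}^2+\sum_{e\in\Gamma_h}\frac{\tilde\sigma}{h_e}\|[q]\|^2_{L^2(e)}.$$ The lifts $R_h([\boldsymbol\theta])=\sum_{e\in\Gamma_h\cup\partial\Omega}r_e([\boldsymbol\theta])\in M_h$ and $\mathbf G_h([q])=\sum_{e\in\Gamma_h}\mathbf g_e([q])\in\mathbf X_h$ are defined by $\int_\Omega r_e(\boldsymbol\zeta)q_h=\int_e\{q_h\}\boldsymbol\zeta\cdot\mathbf n_e$ for all $q_h\in M_h$ and $\int_\Omega\mathbf g_e(\zeta)\cdot\boldsymbol\theta_h=\int_e\{\boldsymbol\theta_h\}\cdot\mathbf n_e\,\zeta$ for all $\boldsymbol\theta_h\in\mathbf X_h$. **Constants.** $M_{k_2},\tilde M_{k_1},C_P>0$ denote constants such that, for all $\boldsymbol\theta\in\mathbf X_h$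 and $q\in M_h$, $$\|R_h([\boldsymbol\theta])\|\le M_{k_2}\Big(\sum_{e\in\Gamma_h\cup\partial\Omega}h_e^{-1}\|[\boldsymbol\theta]\|^2_{L^2(e)}\Big)^{1/2},\quad \|\mathbf G_h([q])\|\le\tilde M_{k_1}\Big(\sum_{e\in\Gamma_h}h_e^{-1}\|[q]\|^2_{L^2(e)}\Big)^{1/2},\quad \|\boldsymbol\theta\|\le C_P\|\boldsymbol\theta\|_{\rm DG}.$$ **Scheme.** Let $\tau>0$, $N_T\in\mathbb N$, $\mathbf u^0\in L^2(\Omega)^d$ and $\mathbf f^n=\mathbf f(n\tau)\in L^2(\Omega)^d$ for $1\le n\le N_T$. Let $p_h^0=\phi_h^0=0$, let $\mathbf u_h^0$ be the elementwise $L^2$ projection of $\mathbf u^0$ onto $\mathbf X_h$, and for $1\le n\le N_T$ let $\mathbf v_h^n,\mathbf u_h^n\in\mathbf X_h$, $\phi_h^n\in M_{h0}$, $p_h^n\in M_h$ satisfy $$(\mathbf v_h^n,\boldsymbol\theta_h)+\tau a_{\mathcal C}(\mathbf u_h^{n-1};\mathbf u_h^{n-1},\mathbf v_h^n,\boldsymbol\theta_h)+\tau\mu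 a_\epsilon(\mathbf v_h^n,\boldsymbol\theta_h)=(\mathbf u_h^{n-1},\boldsymbol\theta_h)+\tau b(\boldsymbol\theta_h,p_h^{n-1})+\tau(\mathbf f^n,\boldsymbol\theta_h)\quad\forall\boldsymbol\theta_h\in\mathbf X_h,$$ $$a_{\rm ellip}(\phi_h^n,q_h)=-\tfrac1\tau b(\mathbf v_h^n,q_h)\quad\forall q_h\in M_{h0},$$ $$(p_h^n,q_h)=(p_h^{n-1},q_h)+(\phi_h^n,q_h)-\delta\mu\,b(\mathbf v_h^n,q_h)\quad\forall q_h\in M_h,$$ $$(\mathbf u_h^n,\boldsymbol\theta_h)=(\mathbf v_h^n,\boldsymbol\theta_h)+\tau b(\boldsymbol\theta_h,\phi_h^n)\quad\forall\boldsymbol\theta_h\in\mathbf X_h.$$ Put $S_h^n=\delta\mu\sum_{i=1}^n(\nabla_h\cdot\mathbf v_h^i-R_h([\mathbf v_h^i]))$ and $\xi_h^n=p_h^n+S_h^n$. **Theorem.** (a) For every $\rho$, the constants can be chosen uniformly for all $\rho$-regular meshes of $\Omega$: $M_{k_2}$ depends, besides $\Omega$ and $\rho$, only on $k_2$, $\tilde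 M_{k_1}$ only on $k_1$, and $C_P$ only on $\sigma>0$. (b) Let $k_1\ge1$ and $k_1-1\le k_2\le k_1+1$. Assume the coercivity properties $a_\epsilon(\boldsymbol\theta_h,\boldsymbol\theta_h)\ge\kappa\|\boldsymbol\theta_h\|^2_{\rm DG}$ on $\mathbf X_h$ with some $\kappa>0$, and $a_{\rm ellip}(q_h,q_h)\ge\frac12|q_h|^2_{\rm DG}$ on $M_h$. Assume $\sigma\ge M_{k_2}^2/d$, $\tilde\sigma\ge\tilde M_{k_1}^2$ and $0<\delta\le\kappa/(2d)$. Then the scheme is unconditionally stable: for all $\tau>0$ and $1\le m\le N_T$, $$\|\mathbf u_h^m\|^2+\frac{\kappa\mu}{2}\tau\sum_{n=1}^m\|\mathbf v_h^n\|_{\rm DG}^2+\frac12\tau^2|\xi_h^m|_{\rm DG}^2+\frac{1}{\delta\mu}\tau\|S_h^m\|^2\le\|\mathbf u^0\|^2+\frac{2C_P^2}{\kappa\mu}\tau\sum_{n=1}^m\|\mathbf f^n\|^2 .$$ This holds with any constants $M_{k_2},\tilde M_{k_1},C_P$ that have the stated property on the mesh in use. -/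

import Mathlib

open MeasureTheory Set
open scoped RealInnerProductSpace

/-- The Euclidean space `ℝ^d`. -/
abbrev Pt (d : ℕ) : Type := EuclideanSpace ℝ (Fin d)

/-! ### Polyhedral domains and meshes -/

/-- A convex polytope with nonempty interior: a bounded intersection of finitely many closed
half-spaces (simplices, parallelepipeds, ...). -/
def IsConvexPolytope {d : ℕ} (K : Set (Pt d)) : Prop :=
  (∃ s : Finset (Pt d × ℝ), K = {x | ∀ a ∈ s, ⟪a.1, x⟫ ≤ a.2}) ∧
    Bornology.IsBounded K ∧ (interior K).Nonempty

/-- `e` is a facet (a `(d-1)`-dimensional face) of `K`, with unit normal `n` exterior to `K`.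
`μHE[d-1]` is the `(d-1)`-dimensional surface measure. -/
def IsFacet {d : ℕ} (K : Set (Pt d)) (n : Pt d) (e : Set (Pt d)) : Prop :=
  ‖n‖ = 1 ∧ (∃ c : ℝ, (∀ x ∈ K, ⟪n, x⟫ ≤ c) ∧ e = {x | x ∈ K ∧ ⟪n, x⟫ = c}) ∧
    0 < (μHE[d - 1] : Measure (Pt d)) e

/-- An open bounded polyhedral domain: a bounded, connected, nonempty open set which is the
interior of a finite union of convex polytopes. -/
structure IsPolyhedralDomain {d : ℕ} (Ω : Set (Pt d)) : Prop where
  isOpen : IsOpen Ω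
  isBounded : Bornology.IsBounded Ω
  isConnected : IsConnected Ω
  interior_closure : interior (closure Ω) = Ω
  polyhedral : ∃ s : Finset (Set (Pt d)), (∀ K ∈ s, IsConvexPolytope K) ∧
    closure Ω = ⋃ K ∈ s, K

/-- A conforming partition of `Ω` into (closed) convex polytopes, with an orientation of the faces.
Every facet `e` of an element is either shared with a second element or lies on `∂Ω`. For an
interior face, `elt₁ e` and `elt₂ e` are the two elements that share it and `normal e` points
from the first to the second. For a boundary face, `elt₂ e = none`, and `normal e` is the
unit normal exterior to `Ω`. -/
structure Mesh {d : ℕ} (Ω : Set (Pt d)) where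
  elements : Finset (Set (Pt d))
  isConvexPolytope : ∀ E ∈ elements, IsConvexPolytope E
  disjoint_interior : ∀ E ∈ elements, ∀ E' ∈ elements, E ≠ E' →
    Disjoint (interior E) (interior E')
  cover : (⋃ E ∈ elements, E) = closure Ω
  faces : Finset (Set (Pt d))
  mem_faces : ∀ e, e ∈ faces ↔ ∃ E ∈ elements, ∃ n, IsFacet E n e
  elt₁ : faces → elements
  elt₂ : faces → Option elements
  normal : faces → Pt d
  facet₁ : ∀ e : faces, IsFacet (elt₁ e : Set (Pt d)) (normal e) e
  facet₂ : ∀ (e : faces) (E : elements), elt₂ e = some E →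
    IsFacet (E : Set (Pt d)) (-normal e) e
  facet_boundary : ∀ e : faces, elt₂ e = none → (e : Set (Pt d)) ⊆ frontier Ω

/-- The maximum diameter of a ball contained in `K`. -/
noncomputable def inscribedDiam {d : ℕ} (K : Set (Pt d)) : ℝ :=
  sSup {t : ℝ | ∃ (x : Pt d) (r : ℝ), 0 ≤ r ∧ Metric.closedBall x r ⊆ K ∧ t = 2 * r}

/-! ### Values of polynomials and of polynomial vector fields -/

/-- Scalar polynomials in `d` variables. -/
abbrev SPoly (d : ℕ) : Type := MvPolynomial (Fin d) ℝ

/-- Polynomial vector fields. -/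
abbrev VPoly (d : ℕ) : Type := Fin d → MvPolynomial (Fin d) ℝ

namespace SPoly

/-- The value `q(x)`. -/
noncomputable def val {d : ℕ} (q : SPoly d) (x : Pt d) : ℝ :=
  MvPolynomial.eval (fun i => x i) q

/-- The value of the gradient, `∇q(x)`. -/
noncomputable def grad {d : ℕ} (q : SPoly d) (x : Pt d) : Pt d :=
  WithLp.toLp 2 fun i => val (MvPolynomial.pderiv i q) x

end SPoly

namespace VPoly

/-- The value `v(x)`. -/
noncomputable def val {d : ℕ} (v : VPoly d) (x : Pt d) : Pt d :=
  WithLp.toLp 2 fun i => SPoly.val (v i) x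

/-- `(∇v)(x) w`, the vector with components `w · ∇vᵢ(x)`, i.e. `(w · ∇v)(x)`. -/
noncomputable def gradMul {d : ℕ} (v : VPoly d) (x w : Pt d) : Pt d :=
  WithLp.toLp 2 fun i => ⟪SPoly.grad (v i) x, w⟫

/-- `∇v(x) : ∇w(x)`. -/
noncomputable def gradDot {d : ℕ} (v w : VPoly d) (x : Pt d) : ℝ :=
  ∑ i, ⟪SPoly.grad (v i) x, SPoly.grad (w i) x⟫

/-- The divergence, as a polynomial. -/
noncomputable def div {d : ℕ} (v : VPoly d) : SPoly d :=
  ∑ i, MvPolynomial.pderiv i (v i)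

end VPoly

namespace Mesh

variable {d : ℕ} {Ω : Set (Pt d)}

/-- The mesh belongs to the regular family with constant `ρ`: `h_E / ρ_E ≤ ρ` for all `E`. -/
def IsRegular (T : Mesh Ω) (ρ : ℝ) : Prop :=
  ∀ E ∈ T.elements, Metric.diam E / inscribedDiam E ≤ ρ

/-- Scalar piecewise polynomials: one polynomial on each element, no continuity. -/
abbrev BScal (T : Mesh Ω) : Type := T.elements → SPoly d

/-- Vector valued piecewise polynomials. -/
abbrev BVec (T : Mesh Ω) : Type := T.elements → VPoly d

/-- `X_h`: vector valued piecewise polynomials of total degree at most `k`. -/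
def Xh (T : Mesh Ω) (k : ℕ) : Set T.BVec :=
  {v | ∀ E i, (v E i).totalDegree ≤ k}

/-- `M_h`: scalar piecewise polynomials of total degree at most `k`. -/
def Mh (T : Mesh Ω) (k : ℕ) : Set T.BScal :=
  {q | ∀ E, (q E).totalDegree ≤ k}

/-- `M_{h0}`: the functions of `M_h` with zero integral over `Ω`. -/
def Mh0 (T : Mesh Ω) (k : ℕ) : Set T.BScal :=
  {q | q ∈ T.Mh k ∧ (∑ E : T.elements, ∫ x in (E : Set (Pt d)), (q E).val x) = 0}

/-! ### `L²` products and norms -/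

/-- `(q, r)` for scalar piecewise polynomials. -/
noncomputable def innerS (T : Mesh Ω) (q r : T.BScal) : ℝ :=
  ∑ E : T.elements, ∫ x in (E : Set (Pt d)), (q E).val x * (r E).val x

/-- `(v, w)` for vector valued piecewise polynomials. -/
noncomputable def innerV (T : Mesh Ω) (v w : T.BVec) : ℝ :=
  ∑ E : T.elements, ∫ x in (E : Set (Pt d)), ⟪(v E).val x, (w E).val x⟫

/-- `(g, w)` for a function `g` and a piecewise polynomial `w`. -/
noncomputable def innerF (T : Mesh Ω) (g : Pt d → Pt d) (w : T.BVec) : ℝ :=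
  ∑ E : T.elements, ∫ x in (E : Set (Pt d)), ⟪g x, (w E).val x⟫

/-- `‖q‖` in `L²(Ω)`. -/
noncomputable def normS (T : Mesh Ω) (q : T.BScal) : ℝ := √(T.innerS q q)

/-- `‖v‖` in `L²(Ω)^d`. -/
noncomputable def normV (T : Mesh Ω) (v : T.BVec) : ℝ := √(T.innerV v v)

/-! ### Faces, averages and jumps -/

/-- The interior faces `Γ_h`. -/
noncomputable def interiorFaces (T : Mesh Ω) : Finset T.faces := {e | (T.elt₂ e).isSome}

/-- The integral over the face `e` with respect to the surface measure. -/
noncomputable def faceInt (T : Mesh Ω) (e : T.faces) (g : Pt d → ℝ) : ℝ :=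
  ∫ x in (e : Set (Pt d)), g x ∂(μHE[d - 1] : Measure (Pt d))

/-- `h_e = |e|^{1/(d-1)}`. -/
noncomputable def faceSize (T : Mesh Ω) (e : T.faces) : ℝ :=
  ((μHE[d - 1] : Measure (Pt d)).real (e : Set (Pt d))) ^ (1 / ((d : ℝ) - 1))

/-- The average `{g}` on `e` of a quantity `g` given by one value for each element; on a boundary
face it is the value from the only adjacent element. -/
noncomputable def avg {W : Type} [AddCommGroup W] [Module ℝ W] (T : Mesh Ω) (e : T.faces)
    (g : T.elements → W) : W :=
  match T.elt₂ e with
  | some E => (1 / 2 : ℝ) • (g (T.elt₁ e) + g E)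
  | none => g (T.elt₁ e)

/-- The jump `[g]` on `e`; on a boundary face it is the value from the only adjacent element. -/
def jump {W : Type} [AddCommGroup W] (T : Mesh Ω) (e : T.faces) (g : T.elements → W) : W :=
  match T.elt₂ e with
  | some E => g (T.elt₁ e) - g E
  | none => g (T.elt₁ e)

/-- `{q}(x)` for `x ∈ e`. -/
noncomputable def avgS (T : Mesh Ω) (e : T.faces) (q : T.BScal) (x : Pt d) : ℝ :=
  T.avg e fun E => (q E).val x

/-- `[q](x)` for `x ∈ e`. -/
noncomputable def jumpS (T : Mesh Ω) (e : T.faces) (q : T.BScal) (x : Pt d) : ℝ :=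
  T.jump e fun E => (q E).val x

/-- `{v}(x)` for `x ∈ e`. -/
noncomputable def avgV (T : Mesh Ω) (e : T.faces) (v : T.BVec) (x : Pt d) : Pt d :=
  T.avg e fun E => (v E).val x

/-- `[v](x)` for `x ∈ e`. -/
noncomputable def jumpV (T : Mesh Ω) (e : T.faces) (v : T.BVec) (x : Pt d) : Pt d :=
  T.jump e fun E => (v E).val x

/-- `{∇q}(x) · n_e`. -/
noncomputable def avgGradS (T : Mesh Ω) (e : T.faces) (q : T.BScal) (x : Pt d) : ℝ :=
  ⟪T.avg e fun E => (q E).grad x, T.normal e⟫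

/-- `{∇v}(x) n_e`. -/
noncomputable def avgGradV (T : Mesh Ω) (e : T.faces) (v : T.BVec) (x : Pt d) : Pt d :=
  T.avg e fun E => (v E).gradMul x (T.normal e)

open Classical in
/-- The faces of the element `E`. -/
noncomputable def facesOf (T : Mesh Ω) (E : T.elements) : Finset T.faces :=
  {e | T.elt₁ e = E ∨ T.elt₂ e = some E}

open Classical in
/-- The outward normal `n_E` to the element `E` on its face `e`. -/
noncomputable def outNormal (T : Mesh Ω) (E : T.elements) (e : T.faces) : Pt d :=
  if T.elt₁ e = E then T.normal e else -T.normal e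

open Classical in
/-- The trace `v^ext` on the face `e` of `E` of the values of `v` outside `E`; it is zero on a
boundary face. -/
noncomputable def extV (T : Mesh Ω) (E : T.elements) (e : T.faces) (v : T.BVec) (x : Pt d) :
    Pt d :=
  if T.elt₁ e = E then
    match T.elt₂ e with
    | some E' => (v E').val x
    | none => 0
  else (v (T.elt₁ e)).val x

/-! ### The discontinuous Galerkin forms -/

/-- The convection form `a_C(z; w, v, θ)`, with upwinding with respect to `z`. -/
noncomputable def aConv (T : Mesh Ω) (z w v θ : T.BVec) : ℝ :=
  (∑ E : T.elements,
    ((∫ x in (E : Set (Pt d)), ⟪(v E).gradMul x ((w E).val x), (θ E).val x⟫)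
      + 1 / 2 * ∫ x in (E : Set (Pt d)), (w E).div.val x * ⟪(v E).val x, (θ E).val x⟫))
  - 1 / 2 * (∑ e : T.faces, T.faceInt e fun x =>
      ⟪T.jumpV e w x, T.normal e⟫ * T.avg e fun E => ⟪(v E).val x, (θ E).val x⟫)
  + ∑ E : T.elements, ∑ e ∈ T.facesOf E,
      ∫ x in {x ∈ (e : Set (Pt d)) | ⟪T.avgV e z x, T.outNormal E e⟫ < 0},
        |⟪T.avgV e w x, T.outNormal E e⟫| * ⟪(v E).val x - T.extV E e v x, (θ E).val x⟫
        ∂(μHE[d - 1] : Measure (Pt d))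

/-- The interior penalty form `a_ε(v, θ)`, with penalty parameter `σ`. -/
noncomputable def aEps (T : Mesh Ω) (ε σ : ℝ) (v θ : T.BVec) : ℝ :=
  (∑ E : T.elements, ∫ x in (E : Set (Pt d)), (v E).gradDot (θ E) x)
  - (∑ e : T.faces, T.faceInt e fun x => ⟪T.avgGradV e v x, T.jumpV e θ x⟫)
  + ε * (∑ e : T.faces, T.faceInt e fun x => ⟪T.avgGradV e θ x, T.jumpV e v x⟫)
  + ∑ e : T.faces, σ / T.faceSize e * T.faceInt e fun x => ⟪T.jumpV e v x, T.jumpV e θ x⟫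

/-- The form `b(θ, q)`. -/
noncomputable def bForm (T : Mesh Ω) (θ : T.BVec) (q : T.BScal) : ℝ :=
  (∑ E : T.elements, ∫ x in (E : Set (Pt d)), (θ E).div.val x * (q E).val x)
  - ∑ e : T.faces, T.faceInt e fun x => T.avgS e q x * ⟪T.jumpV e θ x, T.normal e⟫

/-- The form `a_ellip(φ, q)`, with penalty parameter `σt`. -/
noncomputable def aEllip (T : Mesh Ω) (σt : ℝ) (φ q : T.BScal) : ℝ :=
  (∑ E : T.elements, ∫ x in (E : Set (Pt d)), ⟪(φ E).grad x, (q E).grad x⟫)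
  - (∑ e ∈ T.interiorFaces, T.faceInt e fun x => T.avgGradS e φ x * T.jumpS e q x)
  - (∑ e ∈ T.interiorFaces, T.faceInt e fun x => T.avgGradS e q x * T.jumpS e φ x)
  + ∑ e ∈ T.interiorFaces,
      σt / T.faceSize e * T.faceInt e fun x => T.jumpS e φ x * T.jumpS e q x

/-- The energy norm `‖θ‖_DG`. -/
noncomputable def dgNormV (T : Mesh Ω) (σ : ℝ) (θ : T.BVec) : ℝ :=
  √((∑ E : T.elements, ∫ x in (E : Set (Pt d)), (θ E).gradDot (θ E) x)
    + ∑ e : T.faces, σ / T.faceSize e * T.faceInt e fun x => ‖T.jumpV e θ x‖ ^ 2)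

/-- The energy semi-norm `|q|_DG`. -/
noncomputable def dgNormS (T : Mesh Ω) (σt : ℝ) (q : T.BScal) : ℝ :=
  √((∑ E : T.elements, ∫ x in (E : Set (Pt d)), ‖(q E).grad x‖ ^ 2)
    + ∑ e ∈ T.interiorFaces, σt / T.faceSize e * T.faceInt e fun x => (T.jumpS e q x) ^ 2)

/-! ### Lift operators -/

open Classical in
/-- The lift `r_e(ζ)`: the element of `M_h` with `∫_Ω r_e(ζ) q = ∫_e {q} ζ·n_e` for all `q ∈ M_h`
(it exists and is unique for the traces of discrete functions). -/
noncomputable def liftR (T : Mesh Ω) (k : ℕ) (e : T.faces) (ζ : Pt d → Pt d) : T.BScal :=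
  if h : ∃ r ∈ T.Mh k, ∀ q ∈ T.Mh k,
      T.innerS r q = T.faceInt e fun x => T.avgS e q x * ⟪ζ x, T.normal e⟫
  then h.choose else 0

open Classical in
/-- The lift `g_e(ζ)`: the element of `X_h` with `∫_Ω g_e(ζ)·θ = ∫_e {θ}·n_e ζ` for all
`θ ∈ X_h` (it exists and is unique for the traces of discrete functions). -/
noncomputable def liftG (T : Mesh Ω) (k : ℕ) (e : T.faces) (ζ : Pt d → ℝ) : T.BVec :=
  if h : ∃ g ∈ T.Xh k, ∀ θ ∈ T.Xh k,
      T.innerV g θ = T.faceInt e fun x => ⟪T.avgV e θ x, T.normal e⟫ * ζ x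
  then h.choose else 0

/-- `R_h([θ])`, with values in the piecewise polynomials of degree at most `k`. -/
noncomputable def Rh (T : Mesh Ω) (k : ℕ) (θ : T.BVec) : T.BScal :=
  ∑ e : T.faces, T.liftR k e (T.jumpV e θ)

/-- `G_h([q])`, with values in the piecewise polynomials of degree at most `k`. -/
noncomputable def Gh (T : Mesh Ω) (k : ℕ) (q : T.BScal) : T.BVec :=
  ∑ e ∈ T.interiorFaces, T.liftG k e (T.jumpS e q)

/-! ### The constants and the coercivity properties -/

/-- `M` is a constant of the bound `‖R_h([θ])‖ ≤ M (∑_e h_e⁻¹ ‖[θ]‖²_{L²(e)})^{1/2}`. -/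
def IsLiftConstR (T : Mesh Ω) (k₁ k₂ : ℕ) (M : ℝ) : Prop :=
  0 < M ∧ ∀ θ ∈ T.Xh k₁, T.normS (T.Rh k₂ θ) ≤
    M * √(∑ e : T.faces, (T.faceSize e)⁻¹ * T.faceInt e fun x => ‖T.jumpV e θ x‖ ^ 2)

/-- `M` is a constant of the bound `‖G_h([q])‖ ≤ M (∑_e h_e⁻¹ ‖[q]‖²_{L²(e)})^{1/2}`, where the sum
is over the interior faces. -/
def IsLiftConstG (T : Mesh Ω) (k₁ k₂ : ℕ) (M : ℝ) : Prop :=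
  0 < M ∧ ∀ q ∈ T.Mh k₂, T.normV (T.Gh k₁ q) ≤
    M * √(∑ e ∈ T.interiorFaces, (T.faceSize e)⁻¹ * T.faceInt e fun x => (T.jumpS e q x) ^ 2)

/-- `C` is a constant of the discrete Poincaré inequality `‖θ‖ ≤ C ‖θ‖_DG` on `X_h`. -/
def IsPoincareConst (T : Mesh Ω) (k : ℕ) (σ C : ℝ) : Prop :=
  0 < C ∧ ∀ θ ∈ T.Xh k, T.normV θ ≤ C * T.dgNormV σ θ

/-- Coercivity of `a_ε` on `X_h` with constant `κ > 0`. -/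
def IsCoerciveEps (T : Mesh Ω) (k : ℕ) (ε σ κ : ℝ) : Prop :=
  0 < κ ∧ ∀ θ ∈ T.Xh k, κ * T.dgNormV σ θ ^ 2 ≤ T.aEps ε σ θ θ

/-- Coercivity of `a_ellip` on `M_h` with constant `1/2`. -/
def IsCoerciveEllip (T : Mesh Ω) (k : ℕ) (σt : ℝ) : Prop :=
  ∀ q ∈ T.Mh k, 1 / 2 * T.dgNormS σt q ^ 2 ≤ T.aEllip σt q q

/-! ### The pressure correction scheme -/

/-- The sequences `u`, `v`, `φ`, `p` solve the pressure correction scheme with `N` time steps of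
size `τ`, initial velocity `u0` and force `f`, where `f^n = f(nτ)`. -/
structure IsPressureCorrection (T : Mesh Ω) (k₁ k₂ : ℕ) (ε σ σt μ δ τ : ℝ) (N : ℕ)
    (u0 : Pt d → Pt d) (f : ℝ → Pt d → Pt d) (u v : ℕ → T.BVec) (φ p : ℕ → T.BScal) : Prop where
  p_zero : p 0 = 0
  φ_zero : φ 0 = 0
  u_zero_mem : u 0 ∈ T.Xh k₁
  u_zero_proj : ∀ (E : T.elements) (θ : VPoly d), (∀ i, (θ i).totalDegree ≤ k₁) →
    ∫ x in (E : Set (Pt d)), ⟪(u 0 E).val x - u0 x, θ.val x⟫ = 0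
  v_mem : ∀ n < N, v (n + 1) ∈ T.Xh k₁
  v_eq : ∀ n < N, ∀ θ ∈ T.Xh k₁,
    T.innerV (v (n + 1)) θ + τ * T.aConv (u n) (u n) (v (n + 1)) θ
        + τ * μ * T.aEps ε σ (v (n + 1)) θ
      = T.innerV (u n) θ + τ * T.bForm θ (p n) + τ * T.innerF (f (((n + 1 : ℕ) : ℝ) * τ)) θ
  φ_mem : ∀ n < N, φ (n + 1) ∈ T.Mh0 k₂
  φ_eq : ∀ n < N, ∀ q ∈ T.Mh0 k₂,
    T.aEllip σt (φ (n + 1)) q = -(1 / τ) * T.bForm (v (n + 1)) q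
  p_mem : ∀ n < N, p (n + 1) ∈ T.Mh k₂
  p_eq : ∀ n < N, ∀ q ∈ T.Mh k₂,
    T.innerS (p (n + 1)) q
      = T.innerS (p n) q + T.innerS (φ (n + 1)) q - δ * μ * T.bForm (v (n + 1)) q
  u_mem : ∀ n < N, u (n + 1) ∈ T.Xh k₁
  u_eq : ∀ n < N, ∀ θ ∈ T.Xh k₁,
    T.innerV (u (n + 1)) θ = T.innerV (v (n + 1)) θ + τ * T.bForm θ (φ (n + 1))

/-- `S_h^n = δ μ ∑_{i=1}^n (∇_h·v^i - R_h([v^i]))`. -/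
noncomputable def auxS (T : Mesh Ω) (k₂ : ℕ) (μ δ : ℝ) (v : ℕ → T.BVec) (n : ℕ) : T.BScal :=
  (δ * μ) • ∑ i ∈ Finset.Icc 1 n, ((fun E => (v i E).div) - T.Rh k₂ (v i))

/-- `ξ_h^n = p^n + S_h^n`. -/
noncomputable def auxXi (T : Mesh Ω) (k₂ : ℕ) (μ δ : ℝ) (v : ℕ → T.BVec) (p : ℕ → T.BScal)
    (n : ℕ) : T.BScal :=
  p n + T.auxS k₂ μ δ v n

end Mesh

/-! ### Calculus of polynomial functions -/

namespace SPoly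

variable {d : ℕ}

/-! Stability is an energy estimate. The discrete gradient D(q) = ∇_h q - G_h([q]) and the discrete
divergence B(v) = ∇_h·v - R_h([v]) represent b in two ways: b(θ,q) = -(θ, D(q)) for θ in X_h
(`innerV_discGrad`), and b(v,q) = (B(v), q) for q in M_h (`innerS_discDiv`). The bounds relating k₁
and k₂ put D(q) in X_h and B(v) in M_h, so both may serve as test functions. The scheme then amounts
to u^n = v^n - τ D(φ^n), S^n = S^{n-1} + δμ B(v^n) and ξ^n = ξ^{n-1} + φ^n (`auxXi_succ`).

Test the momentum equation with v^n. Convection is nonnegative (`aConv_nonneg`) and a_ε is coercive.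
Since p = ξ - S, the pressure term splits in two: b(v^n, ξ^{n-1}) is the mixed term of a_ellip(ξ^n,
ξ^n), and b(v^n, S^{n-1}) is the mixed term of ‖S^n‖², so both telescope. Two squares are left over.
The term τ² a_ellip(φ^n, φ^n) is paid for by the velocity update, because ‖D(φ)‖² ≤ a_ellip(φ,φ)
when σ̃ ≥ M̃² (`innerV_discGrad_self_le`). The term δμτ‖B(v^n)‖² is paid for by viscosity, because
‖B(v)‖² ≤ 2d‖v‖²_DG when σ ≥ M²/d (`innerS_discDiv_self_le`) and δ ≤ κ/(2d). This is `energy_step`;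
summing over n and using the coercivity of a_ellip once, at time m, gives the bound.

All of this needs integration by parts on polytopes, which is proved from scratch. For a direction w
and almost every x, the exits minus the entries that the ray x + tw, t > 0, makes through the faces
of K equal the indicator of K at x (`sum_sign_crossing`). Multiplying by the derivative of g along w
and integrating, each face contributes its own integral of g, by Fubini and the fundamental theorem
of calculus along rays (`integral_shadow`).

The uniform constants come from the divergence theorem for radial fields g(x)(x - x₀). If x₀ is the
centre of a ball of radius r inside E, then (x - x₀)·n_E ≥ r on every face, which gives areas, face
sizes and trace inequalities. Norm equivalence on polynomials of bounded degree, scaled from the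
unit ball, gives the discrete trace inequality; testing a lift with itself then bounds it. The
Poincaré inequality follows from the divergence theorem for |θ|² x. -/

@[simp] theorem val_add (p q : SPoly d) (x : Pt d) : (p + q).val x = p.val x + q.val x := by
  simp [val]

@[simp] theorem val_sub (p q : SPoly d) (x : Pt d) : (p - q).val x = p.val x - q.val x := by
  simp [val]

@[simp] theorem val_smul (a : ℝ) (q : SPoly d) (x : Pt d) : (a • q).val x = a * q.val x := by
  simp [val, MvPolynomial.smul_eval]

@[simp] theorem val_zero (x : Pt d) : (0 : SPoly d).val x = 0 := by simp [val]

@[simp] theorem val_mul (p q : SPoly d) (x : Pt d) : (p * q).val x = p.val x * q.val x := by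
  simp [val]

@[simp] theorem val_one (x : Pt d) : (1 : SPoly d).val x = 1 := by simp [val]

@[simp] theorem val_X (i : Fin d) (x : Pt d) : val (MvPolynomial.X i) x = x i := by simp [val]

@[simp] theorem val_C (a : ℝ) (x : Pt d) : val (MvPolynomial.C a) x = a := by simp [val]

theorem val_sum {ι : Type*} (s : Finset ι) (q : ι → SPoly d) (x : Pt d) :
    (∑ i ∈ s, q i).val x = ∑ i ∈ s, (q i).val x := by
  simp [val]

@[fun_prop]
theorem contDiff_val (q : SPoly d) {n : WithTop ℕ∞} : ContDiff ℝ n q.val := by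
  induction q using MvPolynomial.induction_on with
  | C a =>
    rw [show val (MvPolynomial.C a) = fun _ : Pt d => a from funext fun x => val_C a x]
    exact contDiff_const
  | add p q hp hq =>
    rw [show val (p + q) = fun x => val p x + val q x from funext fun x => val_add p q x]
    exact hp.add hq
  | mul_X p i hp =>
    rw [show val (p * MvPolynomial.X i) = fun x => val p x * x i from funext fun x => by simp]
    exact hp.mul (by fun_prop)

@[fun_prop]
theorem continuous_val (q : SPoly d) : Continuous q.val := (q.contDiff_val (n := 0)).continuous

@[simp] theorem grad_add (p q : SPoly d) (x : Pt d) : (p + q).grad x = p.grad x + q.grad x := by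
  ext i; simp [grad]

@[simp] theorem grad_smul (a : ℝ) (q : SPoly d) (x : Pt d) : (a • q).grad x = a • q.grad x := by
  ext i; simp [grad]

theorem grad_mul (p q : SPoly d) (x : Pt d) :
    (p * q).grad x = p.val x • q.grad x + q.val x • p.grad x := by
  ext i; simp [grad, add_comm]

@[fun_prop]
theorem continuous_grad (q : SPoly d) : Continuous q.grad := by
  unfold grad
  fun_prop

/-- Connects the formal gradient, built from `MvPolynomial.pderiv`, with the analytic derivative, so
that a divergence theorem for C¹ functions applies to polynomials. -/
theorem hasFDerivAt_val (q : SPoly d) (x : Pt d) :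
    HasFDerivAt q.val (innerSL ℝ (q.grad x)) x := by
  induction q using MvPolynomial.induction_on with
  | C a =>
    have h : HasFDerivAt (fun _ : Pt d => a) (0 : Pt d →L[ℝ] ℝ) x := hasFDerivAt_const a x
    convert! h.congr_of_eventuallyEq (f₁ := val (MvPolynomial.C a)) (.of_forall fun y => val_C a y)
      using 1
    ext w; simp [grad, PiLp.inner_apply]
  | add p q hp hq =>
    convert! (hp.add hq).congr_of_eventuallyEq (f₁ := val (p + q)) (.of_forall fun y => val_add p q y)
      using 1
    simp
  | mul_X p i hp =>
    have hi : HasFDerivAt (fun x : Pt d => x i) (EuclideanSpace.proj (𝕜 := ℝ) i) x :=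
      (EuclideanSpace.proj (𝕜 := ℝ) i).hasFDerivAt
    convert! (hp.mul hi).congr_of_eventuallyEq (f₁ := val (p * MvPolynomial.X i))
      (.of_forall fun y => by simp) using 1
    ext w
    simp only [grad_mul, val_X, map_add, map_smul, innerSL_apply_apply, add_apply,
      smul_apply, PiLp.proj_apply, smul_eq_mul]
    congr 2
    simp only [grad, MvPolynomial.pderiv_X, PiLp.inner_apply, Pi.single_apply]
    rw [Finset.sum_eq_single i] <;> simp +contextual [eq_comm]

theorem fderiv_val (q : SPoly d) (x w : Pt d) : fderiv ℝ q.val x w = ⟪q.grad x, w⟫ := by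
  rw [(q.hasFDerivAt_val x).fderiv]; rfl

end SPoly

namespace VPoly

variable {d : ℕ}

@[simp] theorem val_add (v w : VPoly d) (x : Pt d) : (v + w).val x = v.val x + w.val x := by
  ext i; simp [val]

@[simp] theorem val_smul (a : ℝ) (v : VPoly d) (x : Pt d) : (a • v).val x = a • v.val x := by
  ext i; simp [val]

@[fun_prop]
theorem continuous_val (v : VPoly d) : Continuous v.val := by unfold val; fun_prop

@[fun_prop]
theorem continuous_gradMul (v : VPoly d) {w : Pt d → Pt d} (hw : Continuous w) :
    Continuous fun x => v.gradMul x (w x) := by unfold gradMul; fun_prop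

@[fun_prop]
theorem continuous_gradDot (v w : VPoly d) : Continuous (v.gradDot w) := by
  unfold gradDot; fun_prop

@[simp] theorem div_add (v w : VPoly d) : (v + w).div = v.div + w.div := by
  simp [div, Finset.sum_add_distrib]

@[simp] theorem div_smul (a : ℝ) (v : VPoly d) : (a • v).div = a • v.div := by
  simp [div, Finset.smul_sum]

end VPoly

/-! ### Surface measure on hyperplanes -/

/-- The hyperplane `{x | ⟪n, x⟫ = c}`. -/
def plane {d : ℕ} (n : Pt d) (c : ℝ) : Set (Pt d) := {x | ⟪n, x⟫ = c}

section Plane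

variable {d : ℕ} {n : Pt d} {c : ℝ}

theorem isClosed_plane (n : Pt d) (c : ℝ) : IsClosed (plane n c) :=
  isClosed_eq (by fun_prop) continuous_const

theorem measurableSet_plane (n : Pt d) (c : ℝ) : MeasurableSet (plane n c) :=
  (isClosed_plane n c).measurableSet

theorem finrank_orthogonal_span (hn : ‖n‖ = 1) : Module.finrank ℝ (ℝ ∙ n)ᗮ = d - 1 := by
  have h := Submodule.finrank_add_finrank_orthogonal (ℝ ∙ n)
  have h0 : n ≠ 0 := by rintro rfl; simp at hn
  rw [finrank_span_singleton h0] at h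
  simp at h
  omega

/-- The surface measure on a hyperplane. -/
noncomputable def surf (n : Pt d) (c : ℝ) : Measure (Pt d) := (μHE[d - 1]).restrict (plane n c)

/-- The map y ↦ cn + y from the orthogonal complement of n is an isometry onto the hyperplane, and
`μHE` in the full dimension of a Euclidean space is its volume. Surface integrals thus become
ordinary integrals, to which Fubini applies. -/
theorem map_orthogonal_eq_surf (hn : ‖n‖ = 1) (c : ℝ) :
    Measure.map (fun y : (ℝ ∙ n)ᗮ => c • n + (y : Pt d)) volume = surf n c := by
  have hi : Isometry fun y : (ℝ ∙ n)ᗮ => c • n + (y : Pt d) :=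
    (IsometryEquiv.addLeft (c • n)).isometry.comp isometry_subtype_coe
  rw [← InnerProductSpace.euclideanHausdorffMeasure_eq_volume, finrank_orthogonal_span hn,
    hi.map_euclideanHausdorffMeasure, surf]
  congr 1
  ext x
  simp only [Set.mem_range, plane, mem_ofPred_eq]
  constructor
  · rintro ⟨y, rfl⟩
    have := Submodule.mem_orthogonal_singleton_iff_inner_right.1 y.2
    simp [inner_add_right, inner_smul_right, hn, this]
  · intro h
    refine ⟨⟨x - c • n, Submodule.mem_orthogonal_singleton_iff_inner_right.2 ?_⟩, by simp⟩
    simp [inner_sub_right, inner_smul_right, hn, h]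

theorem sfinite_surf (hn : ‖n‖ = 1) (c : ℝ) : SFinite (surf n c) := by
  rw [← map_orthogonal_eq_surf hn]; infer_instance

/-- The space is the orthogonal sum of the line of n, parametrised by arc length, and its
complement; the shift by cn changes no volume. -/
theorem measurePreserving_orthogonal (hn : ‖n‖ = 1) (c : ℝ) :
    MeasurePreserving (fun p : ℝ × (ℝ ∙ n)ᗮ => c • n + (p.2 : Pt d) + p.1 • n)
      (volume.prod volume) volume := by
  have h1 := ((ℝ ∙ n).measurePreserving_measurableEquivProd (c • n)).symm
  rw [InnerProductSpace.euclideanHausdorffMeasure_eq_volume] at h1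
  have h2 := (LinearIsometryEquiv.toSpanUnitSingleton (𝕜 := ℝ) n hn).measurePreserving
  have h3 := h1.comp (h2.prod (MeasurePreserving.id (volume : Measure (ℝ ∙ n)ᗮ)))
  convert! h3 using 1
  ext p : 1
  simp
  abel

/-- Integration over the space by slicing parallel to a hyperplane. -/
theorem measurePreserving_cylinder (hn : ‖n‖ = 1) (c : ℝ) {w : Pt d} (hw : ⟪n, w⟫ ≠ 0) :
    MeasurePreserving (fun p : ℝ × Pt d => p.2 - p.1 • w)
      ((ENNReal.ofReal |⟪n, w⟫| • volume).prod (surf n c)) volume := by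
  set a : ℝ := ⟪n, w⟫ with ha
  -- With w = a n + w' and w' orthogonal to n, the map (t, y) ↦ y - tw scales t by -a in the normal
  -- direction and shears along the hyperplane by -t w'. The scaling accounts for the density |a|,
  -- and the shear preserves volume.
  let w' : (ℝ ∙ n)ᗮ := ⟨w - a • n, Submodule.mem_orthogonal_singleton_iff_inner_right.2 (by
    simp [inner_sub_right, inner_smul_right, hn, ha])⟩
  have h1 : MeasurePreserving (fun t : ℝ => (-a) * t) (ENNReal.ofReal |a| • volume) volume := by
    refine ⟨by fun_prop, ?_⟩
    rw [Measure.map_smul, ← abs_neg a]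
    exact Real.smul_map_volume_mul_left (neg_ne_zero.2 hw)
  have h2 : MeasurePreserving (fun p : ℝ × (ℝ ∙ n)ᗮ => ((-a) * p.1, p.2 - p.1 • w'))
      ((ENNReal.ofReal |a| • volume).prod volume) (volume.prod volume) := by
    refine h1.skew_product (g := fun t y => y - t • w') ?_ ?_
    · unfold Function.uncurry; fun_prop
    · exact .of_forall fun t => (measurePreserving_sub_right volume (t • w')).map_eq
  have h3 := (measurePreserving_orthogonal hn c).comp h2
  have h4 : MeasurePreserving (Prod.map id fun y : (ℝ ∙ n)ᗮ => c • n + (y : Pt d))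
      ((ENNReal.ofReal |a| • volume : Measure ℝ).prod volume)
      ((ENNReal.ofReal |a| • volume).prod (surf n c)) := by
    have := sfinite_surf hn c
    exact (MeasurePreserving.id _).prod ⟨by fun_prop, map_orthogonal_eq_surf hn c⟩
  refine ⟨by fun_prop, ?_⟩
  rw [← h4.map_eq, Measure.map_map (by fun_prop) h4.measurable, ← h3.map_eq]
  congr 1
  ext p : 1
  simp only [Function.comp_apply, Prod.map, id, w']
  simp
  module

end Plane

/-! ### Null sets -/

section Null

variable {d : ℕ}

theorem volume_plane {n : Pt d} (hn : n ≠ 0) (c : ℝ) : volume (plane n c) = 0 := by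
  rcases (plane n c).eq_empty_or_nonempty with h | ⟨p, hp⟩
  · simp [h]
  refine measure_mono_null (t := (AffineSubspace.mk' p (ℝ ∙ n)ᗮ : Set (Pt d))) ?_
    (Measure.addHaar_affineSubspace _ _ ?_)
  · intro x hx
    rw [SetLike.mem_coe, AffineSubspace.mem_mk', Submodule.mem_orthogonal_singleton_iff_inner_right]
    have h1 : ⟪n, x⟫ = c := hx
    have h2 : ⟪n, p⟫ = c := hp
    simp [inner_sub_right, h1, h2]
  · intro h
    have h1 : p + n ∈ AffineSubspace.mk' p (ℝ ∙ n)ᗮ := by rw [h]; trivial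
    rw [AffineSubspace.mem_mk', Submodule.mem_orthogonal_singleton_iff_inner_right] at h1
    simp [hn] at h1

/-- Two different hyperplanes meet in a null set for the surface measure. -/
theorem surf_plane_inter {n m : Pt d} {c b : ℝ} (hn : ‖n‖ = 1) (hm : ‖m‖ = 1)
    (h₁ : ¬ (m = n ∧ b = c)) (h₂ : ¬ (m = -n ∧ b = -c)) :
    (μHE[d - 1] : Measure (Pt d)) (plane n c ∩ plane m b) = 0 := by
  have hnn : ⟪n, n⟫ = 1 := by simp [hn]
  by_cases h0 : m - ⟪m, n⟫ • n = 0
  · have h1 : m = ⟪m, n⟫ • n := sub_eq_zero.1 h0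
    have h2 : |⟪m, n⟫| = 1 := by
      have := congrArg norm h1
      rw [norm_smul, hm, hn] at this
      simpa using this.symm
    have : plane n c ∩ plane m b = ∅ := by
      rw [eq_empty_iff_forall_notMem]
      rintro x ⟨hx1, hx2⟩
      have hx1 : ⟪n, x⟫ = c := hx1
      have hx2 : ⟪m, x⟫ = b := hx2
      rw [h1, inner_smul_left, hx1] at hx2
      rcases (abs_eq zero_le_one).1 h2 with h | h
      · exact h₁ ⟨by rw [h1, h, one_smul], by simp [h] at hx2; exact hx2.symm⟩
      · exact h₂ ⟨by rw [h1, h]; simp, by simp [h] at hx2; exact hx2.symm⟩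
    simp [this]
  · have := sfinite_surf hn c
    have hmp := measurePreserving_cylinder hn c (w := n) (by simp [hn])
    -- The intersection swept along n stays in a hyperplane with normal m - ⟪m, n⟫ n, which has
    -- volume zero. The swept volume is an infinite length times the surface measure, so the latter
    -- vanishes.
    have hB := volume_plane h0 (b - ⟪m, n⟫ * c)
    rw [← hmp.measure_preimage (measurableSet_plane _ _).nullMeasurableSet] at hB
    have hsub : (univ : Set ℝ) ×ˢ (plane n c ∩ plane m b) ⊆
        (fun p : ℝ × Pt d => p.2 - p.1 • n) ⁻¹' plane (m - ⟪m, n⟫ • n) (b - ⟪m, n⟫ * c) := by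
      rintro ⟨t, y⟩ ⟨-, hy1, hy2⟩
      have hy1 : ⟪n, y⟫ = c := hy1
      have hy2 : ⟪m, y⟫ = b := hy2
      change ⟪m - ⟪m, n⟫ • n, y - t • n⟫ = _
      simp only [inner_sub_left, inner_sub_right, inner_smul_left, inner_smul_right, hy1, hy2,
        hnn, RCLike.conj_to_real]
      ring
    have h3 := measure_mono_null hsub hB
    rw [Measure.prod_prod] at h3
    have h4 : surf n c (plane n c ∩ plane m b) = 0 := by
      rcases mul_eq_zero.1 h3 with h | h
      · simp [hn] at h
      · exact h
    rwa [surf, Measure.restrict_eq_self _ inter_subset_left] at h4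

end Null

/-! ### Convex polytopes -/

/-- The polyhedron cut out by finitely many closed half-spaces. -/
def polyhedron {d : ℕ} (S : Finset (Pt d × ℝ)) : Set (Pt d) := {x | ∀ a ∈ S, ⟪a.1, x⟫ ≤ a.2}

namespace IsConvexPolytope

variable {d : ℕ} {K : Set (Pt d)}

theorem isClosed (hK : IsConvexPolytope K) : IsClosed K := by
  obtain ⟨⟨s, rfl⟩, -, -⟩ := hK
  have : {x : Pt d | ∀ a ∈ s, ⟪a.1, x⟫ ≤ a.2} = ⋂ a ∈ s, {x | ⟪a.1, x⟫ ≤ a.2} := by ext; simp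
  rw [this]
  exact isClosed_biInter fun a _ => isClosed_le (by fun_prop) continuous_const

theorem isCompact (hK : IsConvexPolytope K) : IsCompact K :=
  Metric.isCompact_of_isClosed_isBounded hK.isClosed hK.2.1

theorem measurableSet (hK : IsConvexPolytope K) : MeasurableSet K := hK.isClosed.measurableSet

theorem convex (hK : IsConvexPolytope K) : Convex ℝ K := by
  obtain ⟨⟨s, rfl⟩, -, -⟩ := hK
  have : {x : Pt d | ∀ a ∈ s, ⟪a.1, x⟫ ≤ a.2} = ⋂ a ∈ s, {x | ⟪a.1, x⟫ ≤ a.2} := by ext; simp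
  rw [this]
  exact convex_iInter₂ fun a _ => convex_halfSpace_le (innerSL ℝ a.1).isLinear a.2

/-- Constraints with zero normal are vacuous because the polytope is nonempty; the others are
divided by the norm of their normal. -/
theorem exists_polyhedron (hK : IsConvexPolytope K) :
    ∃ S : Finset (Pt d × ℝ), (∀ a ∈ S, ‖a.1‖ = 1) ∧ K = polyhedron S := by
  classical
  obtain ⟨⟨s, rfl⟩, -, z, hz⟩ := hK
  have hz : ∀ a ∈ s, ⟪a.1, z⟫ ≤ a.2 := interior_subset hz
  refine ⟨(s.filter fun a => a.1 ≠ 0).image fun a => (‖a.1‖⁻¹ • a.1, ‖a.1‖⁻¹ * a.2), ?_, ?_⟩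
  · intro a ha
    obtain ⟨b, hb, rfl⟩ := Finset.mem_image.1 ha
    have := norm_ne_zero_iff.2 (Finset.mem_filter.1 hb).2
    simp [norm_smul, this]
  · ext x
    change (∀ a ∈ s, ⟪a.1, x⟫ ≤ a.2) ↔ ∀ a : Pt d × ℝ, a ∈ Finset.image _ _ → ⟪a.1, x⟫ ≤ a.2
    simp only [Finset.forall_mem_image, Finset.mem_filter, inner_smul_left, RCLike.conj_to_real]
    constructor
    · intro h a ha
      exact mul_le_mul_of_nonneg_left (h a ha.1) (by positivity)
    · intro h a ha
      by_cases h0 : a.1 = 0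
      · have := hz a ha
        simpa [h0] using this
      · exact le_of_mul_le_mul_left (h ⟨ha, h0⟩) (by positivity)

theorem not_subset_plane (hK : IsConvexPolytope K) {n : Pt d} (hn : n ≠ 0) (c : ℝ) :
    ¬ K ⊆ plane n c := fun h => by
  have h1 := measure_mono_null h (volume_plane hn c)
  exact (isOpen_interior.measure_pos volume hK.2.2).ne' (measure_mono_null interior_subset h1)

theorem volume_frontier (hK : IsConvexPolytope K) : volume (frontier K) = 0 :=
  hK.convex.addHaar_frontier _

end IsConvexPolytope

/-! ### The divergence theorem on a polytope -/

section Crossing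

variable {ι : Type*} (S : Finset ι) (p q : ι → ℝ)

/-- The last crossing time of a ray with finitely many half-lines bounded above. -/
theorem exists_last_crossing (hne : ∃ t, ∀ a ∈ S, t * p a ≤ q a)
    (hbd : BddAbove {t | ∀ a ∈ S, t * p a ≤ q a})
    (hdist : ∀ a ∈ S, ∀ b ∈ S, a ≠ b → p a ≠ 0 → p b ≠ 0 → q a / p a ≠ q b / p b) :
    ∃ a ∈ S, 0 < p a ∧ (∀ t, (∀ b ∈ S, t * p b ≤ q b) → t ≤ q a / p a) ∧
      (∀ b ∈ S, q a / p a * p b ≤ q b) ∧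
      ∀ b ∈ S, 0 < p b → (∀ b' ∈ S, q b / p b * p b' ≤ q b') → b = a := by
  classical
  obtain ⟨t₀, ht₀⟩ := hne
  have hP : (S.filter fun a => 0 < p a).Nonempty := by
    by_contra hP
    obtain ⟨B, hB⟩ := hbd
    -- Without a positive slope no constraint would ever stop the ray, contradicting the upper
    -- bound.
    have : t₀ + (|B - t₀| + 1) ∈ {t | ∀ a ∈ S, t * p a ≤ q a} := fun a ha => by
      have h1 : p a ≤ 0 := by
        by_contra h
        exact hP ⟨a, Finset.mem_filter.2 ⟨ha, not_le.1 h⟩⟩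
      nlinarith [ht₀ a ha, abs_nonneg (B - t₀)]
    have := hB this
    linarith [le_abs_self (B - t₀)]
  obtain ⟨a, ha, hmin⟩ := Finset.exists_min_image _ (fun a => q a / p a) hP
  obtain ⟨haS, hpa⟩ := Finset.mem_filter.1 ha
  have hle : ∀ t, (∀ b ∈ S, t * p b ≤ q b) → t ≤ q a / p a := fun t ht =>
    (le_div_iff₀ hpa).2 (ht a haS)
  have hmem : ∀ b ∈ S, q a / p a * p b ≤ q b := fun b hb => by
    rcases lt_or_ge 0 (p b) with h | h
    · exact (le_div_iff₀ h).1 (hmin b (Finset.mem_filter.2 ⟨hb, h⟩))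
    · exact (mul_le_mul_of_nonpos_right (hle t₀ ht₀) h).trans (ht₀ b hb)
  refine ⟨a, haS, hpa, hle, hmem, fun b hb hpb hbL => ?_⟩
  by_contra hne
  exact hdist b hb a haS hne hpb.ne' hpa.ne'
    (le_antisymm (hle _ hbL) (hmin b (Finset.mem_filter.2 ⟨hb, hpb⟩)))

open Classical in
/-- The signed number of boundary crossings of a ray that starts at `0` tells whether `0` belongs
to the interval. -/
theorem sum_sign_crossing
    (hbd : BddAbove {t | ∀ a ∈ S, t * p a ≤ q a}) (hbd' : BddBelow {t | ∀ a ∈ S, t * p a ≤ q a})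
    (hdist : ∀ a ∈ S, ∀ b ∈ S, a ≠ b → p a ≠ 0 → p b ≠ 0 → q a / p a ≠ q b / p b)
    (h0 : ∀ a ∈ S, q a ≠ 0) :
    ∑ a ∈ S, (SignType.sign (p a) : ℝ) *
      (if 0 < q a / p a ∧ ∀ b ∈ S, q a / p a * p b ≤ q b then 1 else 0)
      = if ∀ a ∈ S, 0 ≤ q a then 1 else 0 := by
  by_cases hne : ∃ t, ∀ a ∈ S, t * p a ≤ q a
  swap
  · rw [if_neg fun h => hne ⟨0, by simpa using h⟩]
    refine Finset.sum_eq_zero fun a ha => ?_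
    rw [if_neg fun h => hne ⟨_, h.2⟩, mul_zero]
  obtain ⟨a, haS, hpa, hle, hmem, huniq⟩ := exists_last_crossing S p q hne hbd hdist
  -- The first crossing is the last crossing of the reversed line.
  obtain ⟨a', haS', hpa', hle', hmem', huniq'⟩ := exists_last_crossing S (fun a => -p a) q
    (by obtain ⟨t, ht⟩ := hne; exact ⟨-t, by simpa using ht⟩)
    (by
      obtain ⟨B, hB⟩ := hbd'
      refine ⟨-B, fun t ht => ?_⟩
      have : -t ∈ {t | ∀ a ∈ S, t * p a ≤ q a} := fun a ha => by
        have := ht a ha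
        simp only [mul_neg] at this
        linarith
      linarith [hB this])
    (fun a ha b hb hab h1 h2 => by
      simp only [div_neg, ne_eq, neg_inj]
      exact hdist a ha b hb hab (by simpa using h1) (by simpa using h2))
  simp only [Left.neg_pos_iff] at hpa' huniq'
  simp only [div_neg, mul_neg, neg_mul, neg_neg] at hle' hmem' huniq'
  set β := q a / p a
  set α := q a' / p a'
  have hαβ : α ≤ β := hle α hmem'
  have hL : ∀ t, (∀ b ∈ S, t * p b ≤ q b) → α ≤ t := fun t ht => by
    have := hle' (-t) (by simpa using ht)
    linarith
  -- The only crossing times that belong to the interval are its endpoints α and β. The exit at β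
  -- counts +1 and the entry at α counts -1, each only if it lies at a positive time.
  have hterm : ∀ b ∈ S, (SignType.sign (p b) : ℝ) *
      (if 0 < q b / p b ∧ ∀ b' ∈ S, q b / p b * p b' ≤ q b' then 1 else 0)
      = (if b = a then (if 0 < β then 1 else 0) else 0)
        - (if b = a' then (if 0 < α then 1 else 0) else 0) := by
    intro b hb
    rcases lt_trichotomy (p b) 0 with h | h | h
    · rw [sign_neg h, if_neg (show ¬ b = a by rintro rfl; exact lt_asymm h hpa)]
      by_cases hba : b = a'
      · subst hba
        rw [if_pos rfl]
        by_cases hα : 0 < α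
        · rw [if_pos ⟨hα, hmem'⟩, if_pos hα]; simp
        · rw [if_neg fun h => hα h.1, if_neg hα]; simp
      · rw [if_neg hba, if_neg fun hh => hba (huniq' b hb h hh.2)]; simp
    · rw [if_neg (show ¬ b = a by rintro rfl; exact hpa.ne' h),
        if_neg (show ¬ b = a' by rintro rfl; exact hpa'.ne h), h]
      simp
    · rw [sign_pos h, if_neg (show ¬ b = a' by rintro rfl; exact lt_asymm h hpa')]
      by_cases hba : b = a
      · subst hba
        rw [if_pos rfl]
        by_cases hβ : 0 < β
        · rw [if_pos ⟨hβ, hmem⟩, if_pos hβ]; simp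
        · rw [if_neg fun h => hβ h.1, if_neg hβ]; simp
      · rw [if_neg hba, if_neg fun hh => hba (huniq b hb h hh.2)]; simp
  rw [Finset.sum_congr rfl hterm, Finset.sum_sub_distrib, Finset.sum_ite_eq', Finset.sum_ite_eq',
    if_pos haS, if_pos haS']
  -- If 0 is in the interval, then α ≤ 0 < β, the second inequality being strict since no `q a`
  -- vanishes; only the exit counts. Otherwise both endpoints lie on the same side of 0 and nothing
  -- remains.
  by_cases hin : ∀ a ∈ S, 0 ≤ q a
  · have h1 : 0 < β := div_pos (lt_of_le_of_ne (hin a haS) (h0 a haS).symm) hpa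
    have h2 : ¬ 0 < α := not_lt.2 (hL 0 (by simpa using hin))
    rw [if_pos h1, if_neg h2, if_pos hin, sub_zero]
  · rw [if_neg hin]
    push Not at hin
    obtain ⟨b, hb, hqb⟩ := hin
    rcases lt_trichotomy (p b) 0 with h | h | h
    · have h1 : 0 < α := by
        have := hmem' b hb
        by_contra hα
        nlinarith
      rw [if_pos h1, if_pos (h1.trans_le hαβ), sub_self]
    · obtain ⟨t, ht⟩ := hne
      have := ht b hb
      rw [h, mul_zero] at this
      linarith
    · have h1 : ¬ 0 < β := by
        intro hβ
        have := hmem b hb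
        nlinarith
      rw [if_neg h1, if_neg fun h => h1 (h.trans_le hαβ), sub_self]

end Crossing

section Divergence

variable {d : ℕ}

/-- Integration over a hyperplane and along rays that leave it. -/
theorem integral_shadow {n : Pt d} (hn : ‖n‖ = 1) (c : ℝ) {w : Pt d} (hw : ⟪n, w⟫ ≠ 0)
    {g : Pt d → ℝ} (hg : ContDiff ℝ 1 g) (hgc : HasCompactSupport g)
    {K : Set (Pt d)} (hK : MeasurableSet K) :
    ∫ x, {x | 0 < (c - ⟪n, x⟫) / ⟪n, w⟫ ∧ x + ((c - ⟪n, x⟫) / ⟪n, w⟫) • w ∈ K}.indicator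
        (fun x => fderiv ℝ g x w) x
      = |⟪n, w⟫| * ∫ x in K ∩ plane n c, g x ∂μHE[d - 1] := by
  have := sfinite_surf hn c
  have hw0 : w ≠ 0 := by rintro rfl; simp at hw
  set a : ℝ := ⟪n, w⟫ with ha
  set ψ : Pt d → ℝ := fun x => fderiv ℝ g x w with hψ
  have hψc : Continuous ψ := (hg.continuous_fderiv (by norm_num)).clm_apply continuous_const
  have hψs : HasCompactSupport ψ := (hgc.fderiv (𝕜 := ℝ)).comp_left (g := fun L : Pt d →L[ℝ] ℝ => L w) (by simp)
  set A : Set (Pt d) := {x | 0 < (c - ⟪n, x⟫) / a ∧ x + ((c - ⟪n, x⟫) / a) • w ∈ K} with hA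
  have hAm : MeasurableSet A := by
    have h1 : Measurable fun x : Pt d => (c - ⟪n, x⟫) / a := by fun_prop
    exact (measurableSet_lt measurable_const h1).inter ((measurable_id.add (h1.smul_const w)) hK)
  have hint : Integrable (A.indicator ψ) volume :=
    (hψc.integrable_of_hasCompactSupport hψs).indicator hAm
  have hmp := measurePreserving_cylinder hn c hw
  rw [← hmp.map_eq, integral_map hmp.measurable.aemeasurable
    (by rw [hmp.map_eq]; exact hint.aestronglyMeasurable)]
  have hint2 : Integrable (fun p : ℝ × Pt d => A.indicator ψ (p.2 - p.1 • w))
      ((ENNReal.ofReal |a| • volume).prod (surf n c)) := hmp.integrable_comp hint.aestronglyMeasurable |>.2 hint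
  rw [integral_prod_symm _ hint2]
  -- Fundamental theorem of calculus along the ray y - tw, on which g vanishes at infinity.
  have hline : ∀ y, ∫ t in Ioi (0 : ℝ), ψ (y - t • w) = g y := by
    intro y
    have hemb : Topology.IsClosedEmbedding fun t : ℝ => y - t • w :=
      (Homeomorph.subLeft y).isClosedEmbedding.comp (isClosedEmbedding_smul_left hw0)
    have hd : ∀ t : ℝ, HasDerivAt (fun t : ℝ => - g (y - t • w)) (ψ (y - t • w)) t := by
      intro t
      have h1 := (hg.differentiable (by norm_num) (y - t • w)).hasFDerivAt
      have h2 : HasDerivAt (fun t : ℝ => y - t • w) (-w) t := by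
        simpa using ((hasDerivAt_id t).smul_const w).const_sub y
      have := (h1.comp_hasDerivAt t h2).neg
      convert! this using 1
      simp [ψ]
    have h0 : Filter.Tendsto (fun t : ℝ => - g (y - t • w)) Filter.atTop (nhds 0) := by
      have h1 : HasCompactSupport fun t : ℝ => g (y - t • w) := hgc.comp_isClosedEmbedding hemb
      have h2 := (h1.is_zero_at_infty).mono_left atTop_le_cocompact
      simpa using h2.neg
    have h1 : HasCompactSupport fun t : ℝ => ψ (y - t • w) := hψs.comp_isClosedEmbedding hemb
    rw [integral_Ioi_of_hasDerivAt_of_tendsto' (fun t _ => hd t)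
      ((hψc.comp hemb.continuous).integrable_of_hasCompactSupport h1).integrableOn h0]
    simp
  -- The point y - tw reaches the hyperplane after time t, at y. Membership in the shadow therefore
  -- means t > 0 and y in K.
  have hin : ∀ y ∈ plane n c, ∫ t, A.indicator ψ (y - t • w) ∂(ENNReal.ofReal |a| • (volume : Measure ℝ))
      = K.indicator (fun y => |a| * g y) y := by
    intro y hy
    have hy : ⟪n, y⟫ = c := hy
    have hA' : ∀ t : ℝ, y - t • w ∈ A ↔ 0 < t ∧ y ∈ K := by
      intro t
      have : (c - ⟪n, y - t • w⟫) / a = t := by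
        rw [inner_sub_right, inner_smul_right, hy, ← ha]; field_simp; ring
      change 0 < (c - ⟪n, y - t • w⟫) / a ∧ y - t • w + ((c - ⟪n, y - t • w⟫) / a) • w ∈ K ↔ _
      rw [this, sub_add_cancel]
    rw [integral_smul_measure, ENNReal.toReal_ofReal (abs_nonneg a), smul_eq_mul]
    by_cases hyK : y ∈ K
    · rw [indicator_of_mem hyK, ← hline y, ← integral_indicator measurableSet_Ioi]
      congr 1
      refine integral_congr_ae (.of_forall fun t => ?_)
      simp only [indicator, hA', hyK, and_true, mem_Ioi]
    · rw [indicator_of_notMem hyK]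
      have : ∀ t : ℝ, A.indicator ψ (y - t • w) = 0 := fun t =>
        indicator_of_notMem (fun h => hyK ((hA' t).1 h).2) _
      simp [this]
  have : ∫ y, ∫ t, A.indicator ψ (y - t • w) ∂(ENNReal.ofReal |a| • (volume : Measure ℝ)) ∂surf n c
      = ∫ y, K.indicator (fun y => |a| * g y) y ∂surf n c := by
    refine integral_congr_ae ?_
    rw [surf]
    filter_upwards [ae_restrict_mem (measurableSet_plane n c)] with y hy using hin y hy
  refine this.trans ?_
  rw [integral_indicator hK, integral_const_mul, surf, Measure.restrict_restrict hK]

/-- The exceptional x lie in finitely many hyperplanes. Two constraints whose crossing times agree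
on more than a hyperplane have equal or opposite normals and offsets: equal ones are the same
constraint, and opposite ones would squeeze the polytope into a plane. -/
theorem ae_crossing_ne {S : Finset (Pt d × ℝ)} (hS : ∀ a ∈ S, ‖a.1‖ = 1)
    (hK : IsConvexPolytope (polyhedron S)) (w : Pt d) :
    ∀ᵐ x : Pt d, (∀ a ∈ S, a.2 - ⟪a.1, x⟫ ≠ 0) ∧
      ∀ a ∈ S, ∀ b ∈ S, a ≠ b → ⟪a.1, w⟫ ≠ 0 → ⟪b.1, w⟫ ≠ 0 →
        (a.2 - ⟪a.1, x⟫) / ⟪a.1, w⟫ ≠ (b.2 - ⟪b.1, x⟫) / ⟪b.1, w⟫ := by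
  have hS0 : ∀ a ∈ S, a.1 ≠ 0 := fun a ha h => by simpa [h] using hS a ha
  refine Filter.Eventually.and ?_ ?_
  · refine (S.eventually_all).2 fun a ha => ?_
    refine measure_mono_null (t := plane a.1 a.2) ?_ (volume_plane (hS0 a ha) _)
    intro x hx
    have : ¬ (a.2 - ⟪a.1, x⟫ ≠ 0) := hx
    change ⟪a.1, x⟫ = a.2
    push Not at this
    linarith
  · refine (S.eventually_all).2 fun a ha => (S.eventually_all).2 fun b hb => ?_
    by_cases hab : a = b
    · simp [hab]
    by_cases hpa : ⟪a.1, w⟫ = 0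
    · simp [hpa]
    by_cases hpb : ⟪b.1, w⟫ = 0
    · simp [hpb]
    have key : ∀ x : Pt d, (a.2 - ⟪a.1, x⟫) / ⟪a.1, w⟫ = (b.2 - ⟪b.1, x⟫) / ⟪b.1, w⟫ →
        x ∈ plane (⟪b.1, w⟫ • a.1 - ⟪a.1, w⟫ • b.1) (⟪b.1, w⟫ * a.2 - ⟪a.1, w⟫ * b.2) := by
      intro x hx
      rw [div_eq_div_iff hpa hpb] at hx
      change ⟪_, x⟫ = _
      rw [inner_sub_left, inner_smul_left, inner_smul_left]
      simp only [RCLike.conj_to_real]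
      linarith
    by_cases hl : ⟪b.1, w⟫ • a.1 - ⟪a.1, w⟫ • b.1 = 0
    · refine .of_forall fun x _ _ _ hx => ?_
      have hx := key x hx
      rw [hl] at hx
      have hx : ⟪b.1, w⟫ * a.2 - ⟪a.1, w⟫ * b.2 = 0 := by
        have : ⟪(0 : Pt d), x⟫ = _ := hx
        rw [inner_zero_left] at this
        exact this.symm
      have h1 : ⟪b.1, w⟫ • a.1 = ⟪a.1, w⟫ • b.1 := sub_eq_zero.1 hl
      have h2 : |⟪b.1, w⟫| = |⟪a.1, w⟫| := by
        have := congrArg norm h1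
        rwa [norm_smul, norm_smul, hS a ha, hS b hb, mul_one, mul_one, Real.norm_eq_abs,
          Real.norm_eq_abs] at this
      rcases abs_eq_abs.1 h2 with h | h
      · rw [h] at h1 hx
        exact hab (Prod.ext (smul_right_injective _ hpa h1)
          (mul_left_cancel₀ hpa (sub_eq_zero.1 hx)))
      · rw [h, neg_smul, ← smul_neg] at h1
        have h1 : -a.1 = b.1 := smul_right_injective _ hpa h1
        have h3 : b.2 = -a.2 := by
          rw [h] at hx
          have : ⟪a.1, w⟫ * (a.2 + b.2) = 0 := by linarith
          rcases mul_eq_zero.1 this with h | h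
          · exact absurd h hpa
          · linarith
        refine hK.not_subset_plane (hS0 a ha) a.2 fun y hy => le_antisymm (hy a ha) ?_
        have := hy b hb
        rw [← h1, inner_neg_left, h3] at this
        linarith
    · refine measure_mono_null ?_ (volume_plane hl (⟪b.1, w⟫ * a.2 - ⟪a.1, w⟫ * b.2))
      intro x hx
      by_contra h
      exact hx fun _ _ _ he => h (key x he)

/-- The indicator of the polytope is, almost everywhere, the sum over the constraints of sign ⟪a, w⟫
times the indicator of the shadow `A a`, the set of points whose ray in direction w later meets the
polytope on that plane. By `integral_shadow`, integrating the derivative of g over a shadow yields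
|⟪a, w⟫| times the surface integral. -/
theorem integral_fderiv_polyhedron_of_hasCompactSupport {S : Finset (Pt d × ℝ)}
    (hS : ∀ a ∈ S, ‖a.1‖ = 1) (hK : IsConvexPolytope (polyhedron S)) {g : Pt d → ℝ}
    (hg : ContDiff ℝ 1 g) (hgc : HasCompactSupport g) (w : Pt d) :
    ∫ x in polyhedron S, fderiv ℝ g x w
      = ∑ a ∈ S, ⟪a.1, w⟫ * ∫ x in polyhedron S ∩ plane a.1 a.2, g x ∂μHE[d - 1] := by
  classical
  rcases eq_or_ne w 0 with rfl | hw
  · simp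
  set K := polyhedron S with hKS
  set ψ : Pt d → ℝ := fun x => fderiv ℝ g x w with hψ
  have hψc : Continuous ψ := (hg.continuous_fderiv (by norm_num)).clm_apply continuous_const
  have hψs : HasCompactSupport ψ := (hgc.fderiv (𝕜 := ℝ)).comp_left (g := fun L : Pt d →L[ℝ] ℝ => L w) (by simp)
  have hψi := hψc.integrable_of_hasCompactSupport (μ := volume) hψs
  let A : Pt d × ℝ → Set (Pt d) := fun a =>
    {x | 0 < (a.2 - ⟪a.1, x⟫) / ⟪a.1, w⟫ ∧ x + ((a.2 - ⟪a.1, x⟫) / ⟪a.1, w⟫) • w ∈ K}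
  have hAm : ∀ a, MeasurableSet (A a) := fun a => by
    have h1 : Measurable fun x : Pt d => (a.2 - ⟪a.1, x⟫) / ⟪a.1, w⟫ := by fun_prop
    exact (measurableSet_lt measurable_const h1).inter
      ((measurable_id.add (h1.smul_const w)) hK.measurableSet)
  have hterm : ∀ a ∈ S, ⟪a.1, w⟫ * ∫ x in K ∩ plane a.1 a.2, g x ∂μHE[d - 1]
      = ∫ x, (SignType.sign ⟪a.1, w⟫ : ℝ) * (A a).indicator ψ x := by
    intro a ha
    by_cases h : ⟪a.1, w⟫ = 0
    · simp [h]
    · rw [integral_const_mul, integral_shadow (hS a ha) a.2 h hg hgc hK.measurableSet, ← mul_assoc,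
        sign_mul_abs]
  rw [Finset.sum_congr rfl hterm, ← integral_finsetSum _ fun a _ =>
    ((hψi.indicator (hAm a)).const_mul _), ← integral_indicator hK.measurableSet]
  refine integral_congr_ae ?_
  filter_upwards [ae_crossing_ne hS hK w] with x hx
  have hline : ∀ t : ℝ, x + t • w ∈ K ↔ ∀ a ∈ S, t * ⟪a.1, w⟫ ≤ a.2 - ⟪a.1, x⟫ := by
    intro t
    refine forall₂_congr fun a _ => ?_
    rw [inner_add_right, inner_smul_right]
    constructor <;> intro h <;> linarith
  have hbdd : Bornology.IsBounded {t : ℝ | ∀ a ∈ S, t * ⟪a.1, w⟫ ≤ a.2 - ⟪a.1, x⟫} := by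
    have hemb : Topology.IsClosedEmbedding fun t : ℝ => x + t • w :=
      (Homeomorph.addLeft x).isClosedEmbedding.comp (isClosedEmbedding_smul_left hw)
    have := (hemb.isCompact_preimage hK.isCompact).isBounded
    convert this using 1
    ext t
    exact (hline t).symm
  have hsum := sum_sign_crossing S (fun a => ⟪a.1, w⟫) (fun a => a.2 - ⟪a.1, x⟫)
    hbdd.bddAbove hbdd.bddBelow hx.2 hx.1
  have h1 : K.indicator ψ x = (if ∀ a ∈ S, 0 ≤ a.2 - ⟪a.1, x⟫ then 1 else 0) * ψ x := by
    have : x ∈ K ↔ ∀ a ∈ S, 0 ≤ a.2 - ⟪a.1, x⟫ := by simpa using hline 0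
    by_cases h : x ∈ K
    · rw [indicator_of_mem h, if_pos (this.1 h), one_mul]
    · rw [indicator_of_notMem h, if_neg (mt this.2 h), zero_mul]
  rw [h1, ← hsum, Finset.sum_mul]
  refine Finset.sum_congr rfl fun a _ => ?_
  rw [mul_assoc]
  congr 1
  have hA : x ∈ A a ↔ 0 < (a.2 - ⟪a.1, x⟫) / ⟪a.1, w⟫ ∧
      ∀ b ∈ S, (a.2 - ⟪a.1, x⟫) / ⟪a.1, w⟫ * ⟪b.1, w⟫ ≤ b.2 - ⟪b.1, x⟫ := by
    rw [← hline]; rfl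
  by_cases h : x ∈ A a
  · rw [indicator_of_mem h, if_pos (hA.1 h), one_mul]
  · rw [indicator_of_notMem h, if_neg (mt hA.2 h), zero_mul]

/-- The divergence theorem on a convex polytope. -/
theorem integral_fderiv_polyhedron {S : Finset (Pt d × ℝ)}
    (hS : ∀ a ∈ S, ‖a.1‖ = 1) (hK : IsConvexPolytope (polyhedron S)) {g : Pt d → ℝ}
    (hg : ContDiff ℝ 1 g) (w : Pt d) :
    ∫ x in polyhedron S, fderiv ℝ g x w
      = ∑ a ∈ S, ⟪a.1, w⟫ * ∫ x in polyhedron S ∩ plane a.1 a.2, g x ∂μHE[d - 1] := by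
  obtain ⟨R, hR, hKR⟩ := hK.2.1.subset_ball_lt 0 (0 : Pt d)
  -- A cutoff equal to 1 on a ball containing the polytope changes neither side of the identity.
  let χ : ContDiffBump (0 : Pt d) := ⟨R, R + 1, hR, by linarith⟩
  have hχ : ∀ x ∈ Metric.ball (0 : Pt d) R, (fun x => χ x * g x) =ᶠ[nhds x] g := by
    intro x hx
    filter_upwards [Metric.isOpen_ball.mem_nhds hx] with y hy
    rw [χ.one_of_mem_closedBall (Metric.ball_subset_closedBall hy), one_mul]
  have h := integral_fderiv_polyhedron_of_hasCompactSupport hS hK (g := fun x => χ x * g x)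
    (χ.contDiff.mul hg) χ.hasCompactSupport.mul_right w
  have hm := hK.measurableSet
  rw [setIntegral_congr_fun hm (g := fun x => fderiv ℝ g x w)
    fun x hx => by rw [(hχ x (hKR hx)).fderiv_eq]] at h
  rw [h]
  refine Finset.sum_congr rfl fun a _ => ?_
  rw [setIntegral_congr_fun (hm.inter (measurableSet_plane _ _))
    fun x hx => (hχ x (hKR hx.1)).eq_of_nhds]

end Divergence

/-! ### Facets -/

section Facet

variable {d : ℕ}

theorem surf_lt_top {n : Pt d} (hn : ‖n‖ = 1) (c : ℝ) {e : Set (Pt d)} (he : IsCompact e) :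
    surf n c e < ⊤ := by
  have hemb : Topology.IsClosedEmbedding fun y : (ℝ ∙ n)ᗮ => c • n + (y : Pt d) :=
    (Homeomorph.addLeft (c • n)).isClosedEmbedding.comp
      (Submodule.closed_of_finiteDimensional _).isClosedEmbedding_subtypeVal
  rw [← map_orthogonal_eq_surf hn, Measure.map_apply (by fun_prop) he.measurableSet]
  exact (hemb.isCompact_preimage he).measure_lt_top

variable {K K' e : Set (Pt d)} {n m : Pt d}

theorem IsFacet.exists_eq (h : IsFacet K n e) :
    ∃ c, (∀ x ∈ K, ⟪n, x⟫ ≤ c) ∧ e = K ∩ plane n c := h.2.1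

theorem IsFacet.isCompact (h : IsFacet K n e) (hK : IsConvexPolytope K) : IsCompact e := by
  obtain ⟨c, -, rfl⟩ := h.exists_eq
  exact hK.isCompact.inter_right (isClosed_plane n c)

theorem IsFacet.measure_lt_top (h : IsFacet K n e) (hK : IsConvexPolytope K) :
    (μHE[d - 1] : Measure (Pt d)) e < ⊤ := by
  obtain ⟨c, -, he⟩ := h.exists_eq
  have := surf_lt_top h.1 c (h.isCompact hK)
  rwa [surf, Measure.restrict_eq_self _ (he ▸ inter_subset_right)] at this

/-- A facet determines its hyperplane. -/
theorem IsFacet.plane_eq (h : 0 < (μHE[d - 1] : Measure (Pt d)) e) (hn : ‖n‖ = 1) (hm : ‖m‖ = 1)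
    {c b : ℝ} (h₁ : e ⊆ plane n c) (h₂ : e ⊆ plane m b) :
    (m = n ∧ b = c) ∨ (m = -n ∧ b = -c) := by
  by_contra hh
  rw [not_or] at hh
  exact h.ne' (measure_mono_null (subset_inter h₁ h₂) (surf_plane_inter hn hm hh.1 hh.2))

/-- The two normals are equal or opposite, and opposite ones would confine K to a hyperplane. -/
theorem IsFacet.eq_of_facet (hK : IsConvexPolytope K) (h : IsFacet K n e) (h' : IsFacet K m e) :
    m = n := by
  obtain ⟨c, hc, he⟩ := h.exists_eq
  obtain ⟨b, hb, he'⟩ := h'.exists_eq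
  rcases IsFacet.plane_eq h.2.2 h.1 h'.1 (he ▸ inter_subset_right) (he' ▸ inter_subset_right)
    with ⟨h1, -⟩ | ⟨h1, h2⟩
  · exact h1
  · refine absurd (fun x hx => le_antisymm (hc x hx) ?_)
      (hK.not_subset_plane (n := n) (by rintro rfl; simpa using h.1) c)
    have := hb x hx
    rw [h1, h2, inner_neg_left] at this
    linarith

/-- Every facet of a polyhedron comes from one of its constraints. -/
theorem IsFacet.exists_constraint {S : Finset (Pt d × ℝ)} (hS : ∀ a ∈ S, ‖a.1‖ = 1)
    (hK : IsConvexPolytope (polyhedron S)) (h : IsFacet (polyhedron S) n e) :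
    ∃ c, (n, c) ∈ S ∧ e = polyhedron S ∩ plane n c := by
  obtain ⟨c, hc, he⟩ := h.exists_eq
  -- At a facet point where every constraint is strict one could move a little along n and stay in
  -- the polyhedron, violating the bound c. So finitely many constraint planes cover the facet, and
  -- one of them meets its plane in positive measure.
  have hcov : e ⊆ ⋃ a ∈ S, plane n c ∩ plane a.1 a.2 := by
    intro x hx
    rw [he] at hx
    by_contra hcon
    have hlt : ∀ a ∈ S, ⟪a.1, x⟫ < a.2 := fun a ha => lt_of_le_of_ne (hx.1 a ha) fun hh =>
      hcon (mem_biUnion (x := a) ha ⟨hx.2, hh⟩)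
    have hev : ∀ᶠ t : ℝ in nhds 0, ∀ a ∈ S, ⟪a.1, x + t • n⟫ < a.2 := by
      refine (S.eventually_all).2 fun a ha => ?_
      have : Continuous fun t : ℝ => ⟪a.1, x + t • n⟫ := by fun_prop
      exact this.continuousAt.eventually_lt_const (by simpa using hlt a ha)
    obtain ⟨δ, hδ, hball⟩ := Metric.eventually_nhds_iff.1 hev
    have h1 := hball (y := δ / 2) (by simp [abs_of_pos hδ, hδ])
    have h2 := hc (x + (δ / 2) • n) fun a ha => (h1 a ha).le
    have h3 : ⟪n, x⟫ = c := hx.2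
    simp [inner_add_right, inner_smul_right, h.1, h3] at h2
    linarith
  obtain ⟨a, ha, hpos⟩ : ∃ a ∈ S, (μHE[d - 1] : Measure (Pt d)) (plane n c ∩ plane a.1 a.2) ≠ 0 := by
    by_contra hcon
    push Not at hcon
    exact h.2.2.ne' (measure_mono_null hcov ((measure_biUnion_null_iff S.countable_toSet).2 hcon))
  rcases IsFacet.plane_eq (pos_iff_ne_zero.2 hpos) h.1 (hS a ha) inter_subset_left
    inter_subset_right with ⟨h1, h2⟩ | ⟨h1, h2⟩
  · have : a = (n, c) := Prod.ext h1 h2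
    exact ⟨c, this ▸ ha, he⟩
  · refine absurd (fun x hx => le_antisymm (hc x hx) ?_)
      (hK.not_subset_plane (n := n) (by rintro rfl; simpa using h.1) c)
    have := hx a ha
    rw [h1, h2, inner_neg_left] at this
    linarith

/-- Near almost every point of a facet, a polytope is a half-space. -/
theorem IsFacet.ae_halfSpace (hK : IsConvexPolytope K) (h : IsFacet K n e) {c : ℝ}
    (hc : e ⊆ plane n c) :
    ∀ᵐ y ∂(μHE[d - 1] : Measure (Pt d)), y ∈ e → ∀ᶠ x in nhds y, (x ∈ K ↔ ⟪n, x⟫ ≤ c) := by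
  obtain ⟨S, hS, rfl⟩ := hK.exists_polyhedron
  obtain ⟨b, hb, he⟩ := h.exists_constraint hS hK
  obtain rfl : b = c := by
    obtain ⟨y, hy⟩ := nonempty_of_measure_ne_zero h.2.2.ne'
    have h1 : ⟪n, y⟫ = c := hc hy
    rw [he] at hy
    have h2 : ⟪n, y⟫ = b := hy.2
    rw [← h1, h2]
  have hn0 : n ≠ 0 := by rintro rfl; simpa using h.1
  -- Almost every facet point avoids all other constraint planes. There the other constraints are
  -- strict, and they remain so nearby.
  have hgen : ∀ᵐ y ∂(μHE[d - 1] : Measure (Pt d)),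
      ∀ a ∈ S, a ≠ (n, b) → y ∉ plane n b ∩ plane a.1 a.2 := by
    refine (S.eventually_all).2 fun a ha => ?_
    by_cases hab : a = (n, b)
    · simp [hab]
    have h0 := surf_plane_inter h.1 (hS a ha) (c := b) (b := a.2)
      (fun hh => hab (Prod.ext hh.1 hh.2)) (fun hh => by
        refine hK.not_subset_plane hn0 b fun x hx => le_antisymm (hx _ hb) ?_
        have := hx a ha
        rw [hh.1, hh.2, inner_neg_left] at this
        linarith)
    filter_upwards [measure_eq_zero_iff_ae_notMem.1 h0] with y hy _ using hy
  filter_upwards [hgen] with y hy hye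
  rw [he] at hye
  have : ∀ᶠ x in nhds y, ∀ a ∈ S, a ≠ (n, b) → ⟪a.1, x⟫ < a.2 := by
    refine (S.eventually_all).2 fun a ha => ?_
    by_cases hab : a = (n, b)
    · simp [hab]
    have hlt : ⟪a.1, y⟫ < a.2 := lt_of_le_of_ne (hye.1 a ha) fun hh => hy a ha hab ⟨hye.2, hh⟩
    have hcont : Continuous fun x : Pt d => ⟪a.1, x⟫ := by fun_prop
    filter_upwards [hcont.continuousAt.eventually_lt_const hlt] with x hx _ using hx
  filter_upwards [this] with x hx
  refine ⟨fun hxK => hxK _ hb, fun hle a ha => ?_⟩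
  by_cases hab : a = (n, b)
  · rw [hab]; exact hle
  · exact (hx a ha hab).le

theorem exists_mem_of_ae {s : Set (Pt d)} {μ : Measure (Pt d)} (hs : μ s ≠ 0) {P : Pt d → Prop}
    (h : ∀ᵐ y ∂μ, y ∈ s → P y) : ∃ y ∈ s, P y := by
  by_contra hcon
  push Not at hcon
  refine hs (measure_mono_null (fun y hy => ?_) h)
  exact fun hh => hcon y hy (hh hy)

/-- Two polytopes on the same side of a common facet overlap. -/
theorem IsFacet.not_disjoint_interior (hK : IsConvexPolytope K) (hK' : IsConvexPolytope K')
    (h : IsFacet K n e) (h' : IsFacet K' n e) : ¬ Disjoint (interior K) (interior K') := by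
  obtain ⟨c, -, he⟩ := h.exists_eq
  have hc : e ⊆ plane n c := he ▸ inter_subset_right
  obtain ⟨y, hye, hy1, hy2⟩ := exists_mem_of_ae h.2.2.ne'
    (P := fun y => (∀ᶠ x in nhds y, (x ∈ K ↔ ⟪n, x⟫ ≤ c)) ∧ ∀ᶠ x in nhds y, (x ∈ K' ↔ ⟪n, x⟫ ≤ c))
    (by filter_upwards [h.ae_halfSpace hK hc, h'.ae_halfSpace hK' hc] with y h1 h2 hy
        exact ⟨h1 hy, h2 hy⟩)
  have hev := eventually_eventually_nhds.2 (hy1.and hy2)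
  -- A small step from y against the normal lands in the interior of both polytopes.
  have hcont : Filter.Tendsto (fun t : ℝ => y - t • n) (nhds 0) (nhds y) := by
    have : Continuous fun t : ℝ => y - t • n := by fun_prop
    simpa using this.tendsto 0
  obtain ⟨δ, hδ, hball⟩ := Metric.eventually_nhds_iff.1 (hcont.eventually hev)
  have h1 := hball (y := δ / 2) (by simp [abs_of_pos hδ, hδ])
  have hlt : ⟪n, y - (δ / 2) • n⟫ < c := by
    have h3 : ⟪n, y⟫ = c := hc hye
    simp [inner_sub_right, inner_smul_right, h.1, h3, hδ]
  have hin : ∀ᶠ x in nhds (y - (δ / 2) • n), ⟪n, x⟫ < c := by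
    have hcont : Continuous fun x : Pt d => ⟪n, x⟫ := by fun_prop
    exact hcont.continuousAt.eventually_lt_const hlt
  rw [Set.not_disjoint_iff]
  refine ⟨y - (δ / 2) • n, mem_interior_iff_mem_nhds.2 ?_, mem_interior_iff_mem_nhds.2 ?_⟩
  · filter_upwards [h1, hin] with x hx hx' using hx.1.2 hx'.le
  · filter_upwards [h1, hin] with x hx hx' using hx.2.2 hx'.le

/-- Two polytopes on opposite sides of a common facet cover a neighbourhood of some point of the
facet. -/
theorem IsFacet.exists_union_mem_nhds (hK : IsConvexPolytope K) (hK' : IsConvexPolytope K')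
    (h : IsFacet K n e) (h' : IsFacet K' (-n) e) : ∃ y ∈ e, K ∪ K' ∈ nhds y := by
  obtain ⟨c, -, he⟩ := h.exists_eq
  have hc : e ⊆ plane n c := he ▸ inter_subset_right
  have hc' : e ⊆ plane (-n) (-c) := fun y hy => by
    have : ⟪n, y⟫ = c := hc hy
    change ⟪-n, y⟫ = -c
    rw [inner_neg_left, this]
  obtain ⟨y, hye, hy1, hy2⟩ := exists_mem_of_ae h.2.2.ne'
    (P := fun y => (∀ᶠ x in nhds y, (x ∈ K ↔ ⟪n, x⟫ ≤ c)) ∧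
      ∀ᶠ x in nhds y, (x ∈ K' ↔ ⟪-n, x⟫ ≤ -c))
    (by filter_upwards [h.ae_halfSpace hK hc, h'.ae_halfSpace hK' hc'] with y h1 h2 hy
        exact ⟨h1 hy, h2 hy⟩)
  refine ⟨y, hye, ?_⟩
  filter_upwards [hy1, hy2] with x h1 h2
  rcases le_total ⟪n, x⟫ c with h | h
  · exact .inl (h1.2 h)
  · exact .inr (h2.2 (by rw [inner_neg_left]; linarith))

end Facet

/-! ### Faces of a mesh -/

namespace Mesh

variable {d : ℕ} {Ω : Set (Pt d)} (T : Mesh Ω)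

theorem polytope (E : T.elements) : IsConvexPolytope (E : Set (Pt d)) := T.isConvexPolytope E E.2

theorem eq_of_common_facet {E E' : T.elements} {n : Pt d} {e : Set (Pt d)}
    (h : IsFacet (E : Set (Pt d)) n e) (h' : IsFacet (E' : Set (Pt d)) n e) : E = E' := by
  by_contra hne
  exact IsFacet.not_disjoint_interior (T.polytope E) (T.polytope E') h h'
    (T.disjoint_interior E E.2 E' E'.2 fun hh => hne (Subtype.ext hh))

theorem elt₁_ne {e : T.faces} {E : T.elements} (h : T.elt₂ e = some E) : T.elt₁ e ≠ E := by
  rintro rfl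
  have h1 := T.facet₁ e
  have h2 := IsFacet.eq_of_facet (T.polytope _) h1 (T.facet₂ e _ h)
  have h3 : T.normal e = 0 := by
    have := eq_neg_iff_add_eq_zero.1 h2.symm
    rw [← two_smul ℝ] at this
    simpa using this
  simpa [h3] using h1.1

theorem isFacet_outNormal {E : T.elements} {e : T.faces} (h : e ∈ T.facesOf E) :
    IsFacet (E : Set (Pt d)) (T.outNormal E e) e := by
  classical
  unfold outNormal
  simp only [facesOf, Finset.mem_filter, Finset.mem_univ, true_and] at h
  split_ifs with h1
  · rw [← h1]; exact T.facet₁ e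
  · exact T.facet₂ e E (h.resolve_left h1)

/-- The normal of E on e is plus or minus `normal e`. With the plus sign E overlaps the first
element and hence equals it. With the minus sign it overlaps, hence equals, the second element,
provided there is one. If there were none, e would lie on ∂Ω, yet E and the first element would
cover a neighbourhood of some point of e, which then belongs to int(closure Ω) = Ω. -/
theorem mem_facesOf_of_isFacet (hΩ : IsPolyhedralDomain Ω) {E : T.elements} {e : T.faces}
    {n : Pt d} (h : IsFacet (E : Set (Pt d)) n e) : e ∈ T.facesOf E := by
  classical
  simp only [facesOf, Finset.mem_filter, Finset.mem_univ, true_and]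
  have h1 := T.facet₁ e
  obtain ⟨c, -, he⟩ := h.exists_eq
  obtain ⟨b, -, he'⟩ := h1.exists_eq
  rcases IsFacet.plane_eq h.2.2 h1.1 h.1 (he' ▸ inter_subset_right) (he ▸ inter_subset_right)
    with ⟨h2, -⟩ | ⟨h2, -⟩
  · rw [h2] at h
    exact .inl (T.eq_of_common_facet h1 h)
  · rw [h2] at h
    rcases hE : T.elt₂ e with _ | E'
    · exfalso
      obtain ⟨y, hy, hnhds⟩ := IsFacet.exists_union_mem_nhds (T.polytope _) (T.polytope _) h1 h
      have hsub : ((T.elt₁ e : Set (Pt d)) ∪ E) ⊆ closure Ω := by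
        rw [← T.cover]
        exact union_subset (subset_biUnion_of_mem (u := id) (T.elt₁ e).2)
          (subset_biUnion_of_mem (u := id) E.2)
      have hyΩ : y ∈ Ω := by
        rw [← hΩ.interior_closure]
        exact mem_interior_iff_mem_nhds.2 (Filter.mem_of_superset hnhds hsub)
      have hyf := T.facet_boundary e hE hy
      rw [hΩ.isOpen.frontier_eq] at hyf
      exact hyf.2 hyΩ
    · exact .inr (congrArg some (T.eq_of_common_facet (T.facet₂ e E' hE) h))

/-- Each face is visited once from each adjacent element; the two visits are distinct because `elt₁`
and `elt₂` differ. -/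
theorem sum_facesOf {M : Type*} [AddCommMonoid M] (F : T.elements → T.faces → M) :
    ∑ E : T.elements, ∑ e ∈ T.facesOf E, F E e
      = ∑ e : T.faces, (F (T.elt₁ e) e + (T.elt₂ e).elim 0 fun E => F E e) := by
  classical
  unfold facesOf
  simp only [Finset.sum_filter]
  rw [Finset.sum_comm]
  refine Finset.sum_congr rfl fun e _ => ?_
  rcases hE : T.elt₂ e with _ | E'
  · simp
  · have hne := T.elt₁_ne hE
    have : ∀ E : T.elements, (if T.elt₁ e = E ∨ some E' = some E then F E e else 0)
        = (if T.elt₁ e = E then F E e else 0) + (if E' = E then F E e else 0) := by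
      intro E
      by_cases h1 : T.elt₁ e = E
      · subst h1
        simp [hne.symm]
      · simp [h1]
    rw [Finset.sum_congr rfl fun E _ => this E, Finset.sum_add_distrib]
    simp

/-- Integration by parts for polynomials on an element. -/
theorem integral_grad (hΩ : IsPolyhedralDomain Ω) (E : T.elements) (q : SPoly d) (w : Pt d) :
    ∫ x in (E : Set (Pt d)), ⟪q.grad x, w⟫
      = ∑ e ∈ T.facesOf E, ⟪T.outNormal E e, w⟫ * T.faceInt e q.val := by
  have hK := T.polytope E
  obtain ⟨S, hS, hES⟩ := hK.exists_polyhedron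
  rw [hES] at hK
  have h := integral_fderiv_polyhedron hS hK (q.contDiff_val (n := 1)) w
  simp only [SPoly.fderiv_val, ← hES] at h
  rw [h]
  symm
  have hex : ∀ e ∈ T.facesOf E, ∃ c, (T.outNormal E e, c) ∈ S ∧
      (e : Set (Pt d)) = (E : Set (Pt d)) ∩ plane (T.outNormal E e) c := fun e he => by
    have := T.isFacet_outNormal he
    rw [hES] at this ⊢
    exact this.exists_constraint hS hK
  choose! c hc using hex
  -- Faces of E correspond to constraints with a nonzero term. Redundant constraints may touch E in
  -- a surface-null set; they contribute zero and have no face.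
  refine Finset.sum_bij_ne_zero (fun e _ _ => (T.outNormal E e, c e)) (fun e he _ => (hc e he).1)
    (fun e he _ e' he' _ heq => ?_) (fun a ha hne => ?_) (fun e he _ => ?_)
  · have h1 := congrArg Prod.fst heq
    have h2 := congrArg Prod.snd heq
    dsimp only at h1 h2
    ext1
    rw [(hc e he).2, (hc e' he').2, h1, h2]
  · have hpos : (μHE[d - 1] : Measure (Pt d)) ((E : Set (Pt d)) ∩ plane a.1 a.2) ≠ 0 := by
      intro h0
      refine hne ?_
      rw [Measure.restrict_eq_zero.2 h0, integral_zero_measure, mul_zero]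
    have hfac : IsFacet (E : Set (Pt d)) a.1 ((E : Set (Pt d)) ∩ plane a.1 a.2) :=
      ⟨hS a ha, ⟨a.2, fun x hx => by rw [hES] at hx; exact hx a ha, rfl⟩, pos_iff_ne_zero.2 hpos⟩
    let e : T.faces := ⟨_, (T.mem_faces _).2 ⟨E, E.2, _, hfac⟩⟩
    have he : e ∈ T.facesOf E := T.mem_facesOf_of_isFacet hΩ hfac
    have hn := IsFacet.eq_of_facet (T.polytope E) hfac (T.isFacet_outNormal he)
    have hceq : c e = a.2 := by
      obtain ⟨y, hy⟩ := nonempty_of_measure_ne_zero hpos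
      have h1 : ⟪a.1, y⟫ = a.2 := hy.2
      have h2 : y ∈ (e : Set (Pt d)) := hy
      rw [(hc e he).2, hn] at h2
      have h3 : ⟪a.1, y⟫ = c e := h2.2
      rw [← h1, h3]
    refine ⟨e, he, ?_, Prod.ext hn hceq⟩
    rw [hn]
    exact hne
  · dsimp only
    rw [faceInt, (hc e he).2]

end Mesh

namespace Mesh

variable {d : ℕ} {Ω : Set (Pt d)} (T : Mesh Ω)

/-! ### Integrals over elements and faces -/

theorem integrableOn_elem (E : T.elements) {f : Pt d → ℝ} (hf : Continuous f) :
    IntegrableOn f (E : Set (Pt d)) :=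
  hf.continuousOn.integrableOn_compact (T.polytope E).isCompact

theorem isCompact_face (e : T.faces) : IsCompact (e : Set (Pt d)) :=
  (T.facet₁ e).isCompact (T.polytope _)

theorem face_measure_lt_top (e : T.faces) :
    (μHE[d - 1] : Measure (Pt d)) (e : Set (Pt d)) < ⊤ :=
  (T.facet₁ e).measure_lt_top (T.polytope _)

theorem integrableOn_face (e : T.faces) {f : Pt d → ℝ} (hf : Continuous f) :
    IntegrableOn f (e : Set (Pt d)) (μHE[d - 1] : Measure (Pt d)) :=
  hf.continuousOn.integrableOn_of_subset_isCompact (T.isCompact_face e)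
    (T.isCompact_face e).measurableSet subset_rfl (T.face_measure_lt_top e).ne

theorem faceSize_pos (e : T.faces) : 0 < T.faceSize e :=
  Real.rpow_pos_of_pos (ENNReal.toReal_pos (T.facet₁ e).2.2.ne' (T.face_measure_lt_top e).ne) _

theorem faceInt_add (e : T.faces) {f g : Pt d → ℝ} (hf : Continuous f) (hg : Continuous g) :
    T.faceInt e (fun x => f x + g x) = T.faceInt e f + T.faceInt e g :=
  integral_add (T.integrableOn_face e hf) (T.integrableOn_face e hg)

theorem faceInt_sub (e : T.faces) {f g : Pt d → ℝ} (hf : Continuous f) (hg : Continuous g) :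
    T.faceInt e (fun x => f x - g x) = T.faceInt e f - T.faceInt e g :=
  integral_sub (T.integrableOn_face e hf) (T.integrableOn_face e hg)

theorem faceInt_mul (e : T.faces) (a : ℝ) (f : Pt d → ℝ) :
    T.faceInt e (fun x => a * f x) = a * T.faceInt e f :=
  integral_const_mul _ _

theorem faceInt_nonneg (e : T.faces) {f : Pt d → ℝ} (hf : ∀ x, 0 ≤ f x) : 0 ≤ T.faceInt e f :=
  integral_nonneg hf

theorem faceInt_mono (e : T.faces) {f g : Pt d → ℝ} (hf : Continuous f) (hg : Continuous g)
    (h : ∀ x ∈ (e : Set (Pt d)), f x ≤ g x) : T.faceInt e f ≤ T.faceInt e g :=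
  setIntegral_mono_on (T.integrableOn_face e hf) (T.integrableOn_face e hg)
    (T.isCompact_face e).measurableSet h

/-! ### Averages and jumps -/

section AvgJump

variable {W : Type} [AddCommGroup W] [Module ℝ W] (e : T.faces) (g h : T.elements → W)

theorem avg_of_none (he : T.elt₂ e = none) : T.avg e g = g (T.elt₁ e) := by simp only [avg, he]

theorem avg_of_some {E : T.elements} (he : T.elt₂ e = some E) :
    T.avg e g = (1 / 2 : ℝ) • (g (T.elt₁ e) + g E) := by simp only [avg, he]

omit [Module ℝ W] in
theorem jump_of_none (he : T.elt₂ e = none) : T.jump e g = g (T.elt₁ e) := by simp only [jump, he]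

omit [Module ℝ W] in
theorem jump_of_some {E : T.elements} (he : T.elt₂ e = some E) :
    T.jump e g = g (T.elt₁ e) - g E := by simp only [jump, he]

theorem avg_add : T.avg e (fun E => g E + h E) = T.avg e g + T.avg e h := by
  rcases he : T.elt₂ e with _ | E
  · simp only [T.avg_of_none e _ he]
  · simp only [T.avg_of_some e _ he]; module

theorem avg_smul (a : ℝ) : T.avg e (fun E => a • g E) = a • T.avg e g := by
  rcases he : T.elt₂ e with _ | E
  · simp only [T.avg_of_none e _ he]
  · simp only [T.avg_of_some e _ he]; module

omit [Module ℝ W] in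
theorem jump_add : T.jump e (fun E => g E + h E) = T.jump e g + T.jump e h := by
  rcases he : T.elt₂ e with _ | E
  · simp only [T.jump_of_none e _ he]
  · simp only [T.jump_of_some e _ he]; abel

theorem jump_smul (a : ℝ) : T.jump e (fun E => a • g E) = a • T.jump e g := by
  rcases he : T.elt₂ e with _ | E
  · simp only [T.jump_of_none e _ he]
  · simp only [T.jump_of_some e _ he]; module

variable [TopologicalSpace W] [IsTopologicalAddGroup W] [ContinuousConstSMul ℝ W]

theorem continuous_avg {g : T.elements → Pt d → W} (hg : ∀ E, Continuous (g E)) :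
    Continuous fun x => T.avg e fun E => g E x := by
  rcases he : T.elt₂ e with _ | E
  · simpa only [T.avg_of_none e _ he] using hg _
  · simp only [T.avg_of_some e _ he]; exact ((hg _).add (hg _)).const_smul _

omit [Module ℝ W] [ContinuousConstSMul ℝ W] in
theorem continuous_jump {g : T.elements → Pt d → W} (hg : ∀ E, Continuous (g E)) :
    Continuous fun x => T.jump e fun E => g E x := by
  rcases he : T.elt₂ e with _ | E
  · simpa only [T.jump_of_none e _ he] using hg _
  · simp only [T.jump_of_some e _ he]; exact (hg _).sub (hg _)

end AvgJump

variable (e : T.faces)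

@[fun_prop]
theorem continuous_avgS (q : T.BScal) : Continuous (T.avgS e q) :=
  T.continuous_avg e fun E => (q E).continuous_val

@[fun_prop]
theorem continuous_jumpS (q : T.BScal) : Continuous (T.jumpS e q) :=
  T.continuous_jump e fun E => (q E).continuous_val

@[fun_prop]
theorem continuous_avgV (v : T.BVec) : Continuous (T.avgV e v) :=
  T.continuous_avg e fun E => (v E).continuous_val

@[fun_prop]
theorem continuous_jumpV (v : T.BVec) : Continuous (T.jumpV e v) :=
  T.continuous_jump e fun E => (v E).continuous_val

@[fun_prop]
theorem continuous_avgGradS (q : T.BScal) : Continuous (T.avgGradS e q) :=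
  (T.continuous_avg e fun E => (q E).continuous_grad).inner continuous_const

@[simp] theorem avgS_add (p q : T.BScal) (x : Pt d) :
    T.avgS e (p + q) x = T.avgS e p x + T.avgS e q x := by
  simp [avgS, avg_add]

@[simp] theorem avgS_smul (a : ℝ) (q : T.BScal) (x : Pt d) :
    T.avgS e (a • q) x = a * T.avgS e q x := by
  have := T.avg_smul e (fun E => (q E).val x) a
  simpa [avgS] using this

@[simp] theorem jumpS_add (p q : T.BScal) (x : Pt d) :
    T.jumpS e (p + q) x = T.jumpS e p x + T.jumpS e q x := by
  simp [jumpS, jump_add]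

@[simp] theorem jumpS_smul (a : ℝ) (q : T.BScal) (x : Pt d) :
    T.jumpS e (a • q) x = a * T.jumpS e q x := by
  have := T.jump_smul e (fun E => (q E).val x) a
  simpa [jumpS] using this

@[simp] theorem avgV_add (v w : T.BVec) (x : Pt d) :
    T.avgV e (v + w) x = T.avgV e v x + T.avgV e w x := by
  simp [avgV, avg_add]

@[simp] theorem avgV_smul (a : ℝ) (v : T.BVec) (x : Pt d) :
    T.avgV e (a • v) x = a • T.avgV e v x := by
  simp [avgV, avg_smul]

@[simp] theorem jumpV_add (v w : T.BVec) (x : Pt d) :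
    T.jumpV e (v + w) x = T.jumpV e v x + T.jumpV e w x := by
  simp [jumpV, jump_add]

@[simp] theorem jumpV_smul (a : ℝ) (v : T.BVec) (x : Pt d) :
    T.jumpV e (a • v) x = a • T.jumpV e v x := by
  simp [jumpV, jump_smul]

@[simp] theorem avgGradS_add (p q : T.BScal) (x : Pt d) :
    T.avgGradS e (p + q) x = T.avgGradS e p x + T.avgGradS e q x := by
  simp [avgGradS, avg_add, inner_add_left]

@[simp] theorem avgGradS_smul (a : ℝ) (q : T.BScal) (x : Pt d) :
    T.avgGradS e (a • q) x = a * T.avgGradS e q x := by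
  simp [avgGradS, avg_smul, inner_smul_left]

/-! ### Bilinearity of the forms -/

theorem elemInt_add (E : T.elements) {f g : Pt d → ℝ} (hf : Continuous f) (hg : Continuous g) :
    ∫ x in (E : Set (Pt d)), (f x + g x)
      = (∫ x in (E : Set (Pt d)), f x) + ∫ x in (E : Set (Pt d)), g x :=
  integral_add (T.integrableOn_elem E hf) (T.integrableOn_elem E hg)

theorem innerS_comm (p q : T.BScal) : T.innerS p q = T.innerS q p := by
  simp only [innerS, mul_comm]

theorem innerS_add_left (p p' q : T.BScal) :
    T.innerS (p + p') q = T.innerS p q + T.innerS p' q := by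
  simp only [innerS, Pi.add_apply, SPoly.val_add, add_mul, ← Finset.sum_add_distrib]
  exact Finset.sum_congr rfl fun E _ => T.elemInt_add E (by fun_prop) (by fun_prop)

theorem innerS_smul_left (a : ℝ) (p q : T.BScal) : T.innerS (a • p) q = a * T.innerS p q := by
  simp only [innerS, Pi.smul_apply, SPoly.val_smul, mul_assoc, integral_const_mul, Finset.mul_sum]

theorem innerS_self_nonneg (q : T.BScal) : 0 ≤ T.innerS q q :=
  Finset.sum_nonneg fun _ _ => integral_nonneg fun _ => mul_self_nonneg _

/-- The `L²` product of scalar piecewise polynomials as a bilinear form. -/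
noncomputable def innerSForm : T.BScal →ₗ[ℝ] T.BScal →ₗ[ℝ] ℝ :=
  LinearMap.mk₂ ℝ T.innerS T.innerS_add_left T.innerS_smul_left
    (fun p q q' => by rw [innerS_comm, innerS_add_left, T.innerS_comm q, T.innerS_comm q'])
    (fun a p q => by rw [innerS_comm, innerS_smul_left, T.innerS_comm q]; rfl)

theorem innerS_eq (p q : T.BScal) : T.innerS p q = T.innerSForm p q := rfl

theorem innerV_eq_sum (v w : T.BVec) :
    T.innerV v w = ∑ i, T.innerS (fun E => v E i) (fun E => w E i) := by
  simp only [innerV, innerS]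
  rw [Finset.sum_comm]
  refine Finset.sum_congr rfl fun E _ => ?_
  rw [← integral_finsetSum _ fun i _ => T.integrableOn_elem E (by fun_prop)]
  simp only [PiLp.inner_apply, VPoly.val, Real.inner_apply]

theorem innerV_comm (v w : T.BVec) : T.innerV v w = T.innerV w v := by
  simp only [innerV, real_inner_comm]

theorem innerV_add_left (v v' w : T.BVec) :
    T.innerV (v + v') w = T.innerV v w + T.innerV v' w := by
  simp only [innerV, Pi.add_apply, VPoly.val_add, inner_add_left, ← Finset.sum_add_distrib]
  exact Finset.sum_congr rfl fun E _ => T.elemInt_add E (by fun_prop) (by fun_prop)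

theorem innerV_smul_left (a : ℝ) (v w : T.BVec) : T.innerV (a • v) w = a * T.innerV v w := by
  simp only [innerV, Pi.smul_apply, VPoly.val_smul, real_inner_smul_left, integral_const_mul,
    Finset.mul_sum]

theorem innerV_self_nonneg (v : T.BVec) : 0 ≤ T.innerV v v :=
  Finset.sum_nonneg fun _ _ => integral_nonneg fun _ => real_inner_self_nonneg

/-- The `L²` product of piecewise polynomial vector fields as a bilinear form. -/
noncomputable def innerVForm : T.BVec →ₗ[ℝ] T.BVec →ₗ[ℝ] ℝ :=
  LinearMap.mk₂ ℝ T.innerV T.innerV_add_left T.innerV_smul_left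
    (fun p q q' => by rw [innerV_comm, innerV_add_left, T.innerV_comm q, T.innerV_comm q'])
    (fun a p q => by rw [innerV_comm, innerV_smul_left, T.innerV_comm q]; rfl)

theorem innerV_eq (v w : T.BVec) : T.innerV v w = T.innerVForm v w := rfl

/-- `b` as a bilinear form. -/
noncomputable def bLin : T.BVec →ₗ[ℝ] T.BScal →ₗ[ℝ] ℝ :=
  LinearMap.mk₂ ℝ T.bForm
    (fun v v' q => by
      have h1 : ∀ E : T.elements, ∫ x in (E : Set (Pt d)), ((v + v') E).div.val x * (q E).val x
          = (∫ x in (E : Set (Pt d)), (v E).div.val x * (q E).val x)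
            + ∫ x in (E : Set (Pt d)), (v' E).div.val x * (q E).val x := fun E => by
        rw [← T.elemInt_add E (by fun_prop) (by fun_prop)]
        simp [add_mul]
      have h2 : ∀ e, (T.faceInt e fun x => T.avgS e q x * ⟪T.jumpV e (v + v') x, T.normal e⟫)
          = (T.faceInt e fun x => T.avgS e q x * ⟪T.jumpV e v x, T.normal e⟫)
            + T.faceInt e fun x => T.avgS e q x * ⟪T.jumpV e v' x, T.normal e⟫ := fun e => by
        rw [← T.faceInt_add e (by fun_prop) (by fun_prop)]
        simp [inner_add_left, mul_add]
      simp only [bForm, h1, h2, Finset.sum_add_distrib]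
      ring)
    (fun a v q => by
      have h1 : ∀ E : T.elements, ∫ x in (E : Set (Pt d)), ((a • v) E).div.val x * (q E).val x
          = a * ∫ x in (E : Set (Pt d)), (v E).div.val x * (q E).val x := fun E => by
        rw [← integral_const_mul]
        simp [mul_assoc]
      have h2 : ∀ e, (T.faceInt e fun x => T.avgS e q x * ⟪T.jumpV e (a • v) x, T.normal e⟫)
          = a * (T.faceInt e fun x => T.avgS e q x * ⟪T.jumpV e v x, T.normal e⟫) := fun e => by
        rw [← T.faceInt_mul e]
        simp [inner_smul_left, mul_left_comm]
      simp only [bForm, h1, h2, ← Finset.mul_sum, smul_eq_mul]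
      ring)
    (fun v q q' => by
      have h1 : ∀ E : T.elements, ∫ x in (E : Set (Pt d)), (v E).div.val x * ((q + q') E).val x
          = (∫ x in (E : Set (Pt d)), (v E).div.val x * (q E).val x)
            + ∫ x in (E : Set (Pt d)), (v E).div.val x * (q' E).val x := fun E => by
        rw [← T.elemInt_add E (by fun_prop) (by fun_prop)]
        simp [mul_add]
      have h2 : ∀ e, (T.faceInt e fun x => T.avgS e (q + q') x * ⟪T.jumpV e v x, T.normal e⟫)
          = (T.faceInt e fun x => T.avgS e q x * ⟪T.jumpV e v x, T.normal e⟫)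
            + T.faceInt e fun x => T.avgS e q' x * ⟪T.jumpV e v x, T.normal e⟫ := fun e => by
        rw [← T.faceInt_add e (by fun_prop) (by fun_prop)]
        simp [add_mul]
      simp only [bForm, h1, h2, Finset.sum_add_distrib]
      ring)
    (fun a v q => by
      have h1 : ∀ E : T.elements, ∫ x in (E : Set (Pt d)), (v E).div.val x * ((a • q) E).val x
          = a * ∫ x in (E : Set (Pt d)), (v E).div.val x * (q E).val x := fun E => by
        rw [← integral_const_mul]
        simp [mul_left_comm]
      have h2 : ∀ e, (T.faceInt e fun x => T.avgS e (a • q) x * ⟪T.jumpV e v x, T.normal e⟫)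
          = a * (T.faceInt e fun x => T.avgS e q x * ⟪T.jumpV e v x, T.normal e⟫) := fun e => by
        rw [← T.faceInt_mul e]
        simp [mul_assoc]
      simp only [bForm, h1, h2, ← Finset.mul_sum, smul_eq_mul]
      ring)

theorem bForm_eq (v : T.BVec) (q : T.BScal) : T.bForm v q = T.bLin v q := rfl

theorem aEllip_comm (σt : ℝ) (p q : T.BScal) : T.aEllip σt p q = T.aEllip σt q p := by
  simp only [aEllip, real_inner_comm, mul_comm (T.jumpS _ p _)]
  ring

theorem aEllip_add_left (σt : ℝ) (p p' q : T.BScal) :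
    T.aEllip σt (p + p') q = T.aEllip σt p q + T.aEllip σt p' q := by
  have h1 : ∀ E : T.elements, ∫ x in (E : Set (Pt d)), ⟪((p + p') E).grad x, (q E).grad x⟫
      = (∫ x in (E : Set (Pt d)), ⟪(p E).grad x, (q E).grad x⟫)
        + ∫ x in (E : Set (Pt d)), ⟪(p' E).grad x, (q E).grad x⟫ := fun E => by
    rw [← T.elemInt_add E (by fun_prop) (by fun_prop)]
    simp [inner_add_left]
  have h2 : ∀ e, (T.faceInt e fun x => T.avgGradS e (p + p') x * T.jumpS e q x)
      = (T.faceInt e fun x => T.avgGradS e p x * T.jumpS e q x)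
        + T.faceInt e fun x => T.avgGradS e p' x * T.jumpS e q x := fun e => by
    rw [← T.faceInt_add e (by fun_prop) (by fun_prop)]
    simp [add_mul]
  have h3 : ∀ e, (T.faceInt e fun x => T.avgGradS e q x * T.jumpS e (p + p') x)
      = (T.faceInt e fun x => T.avgGradS e q x * T.jumpS e p x)
        + T.faceInt e fun x => T.avgGradS e q x * T.jumpS e p' x := fun e => by
    rw [← T.faceInt_add e (by fun_prop) (by fun_prop)]
    simp [mul_add]
  have h4 : ∀ e, (T.faceInt e fun x => T.jumpS e (p + p') x * T.jumpS e q x)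
      = (T.faceInt e fun x => T.jumpS e p x * T.jumpS e q x)
        + T.faceInt e fun x => T.jumpS e p' x * T.jumpS e q x := fun e => by
    rw [← T.faceInt_add e (by fun_prop) (by fun_prop)]
    simp [add_mul]
  simp only [aEllip, h1, h2, h3, h4, Finset.sum_add_distrib, mul_add]
  ring

theorem aEllip_smul_left (σt a : ℝ) (p q : T.BScal) :
    T.aEllip σt (a • p) q = a * T.aEllip σt p q := by
  simp only [aEllip, Pi.smul_apply, SPoly.grad_smul, avgGradS_smul, jumpS_smul, mul_assoc,
    mul_left_comm _ a, real_inner_smul_left, integral_const_mul, faceInt_mul, ← Finset.mul_sum]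
  ring

end Mesh

/-! ### Polynomials of bounded degree -/

section Poly

variable {d : ℕ}

/-- An open set contains a product of intervals, and a polynomial vanishing on a product of infinite
sets is zero. -/
theorem SPoly.eq_zero_of_eqOn_open {U : Set (Pt d)} (hU : IsOpen U) (hne : U.Nonempty)
    {q : SPoly d} (h : ∀ x ∈ U, q.val x = 0) : q = 0 := by
  obtain ⟨z, hz⟩ := hne
  have hU' : IsOpen {y : Fin d → ℝ | WithLp.toLp 2 y ∈ U} :=
    hU.preimage (PiLp.continuous_toLp 2 fun _ : Fin d => ℝ)
  obtain ⟨ε, hε, hball⟩ := Metric.isOpen_iff.1 hU' z.ofLp hz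
  refine MvPolynomial.funext_set (fun i => Ioo (z i - ε) (z i + ε))
    (fun i => Ioo_infinite (by linarith)) fun y hy => ?_
  rw [map_zero]
  refine h (WithLp.toLp 2 y) (hball ?_)
  rw [Metric.mem_ball, dist_pi_lt_iff hε]
  intro i
  have := hy i (mem_univ i)
  rw [Real.dist_eq, abs_lt]
  constructor <;> linarith [this.1, this.2]

theorem SPoly.eq_zero_of_setIntegral_sq {K : Set (Pt d)} (hK : IsCompact K)
    (hne : (interior K).Nonempty) {q : SPoly d} (h : ∫ x in K, q.val x * q.val x = 0) : q = 0 := by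
  have hint : IntegrableOn (fun x => q.val x * q.val x) K :=
    (by fun_prop : Continuous fun x => q.val x * q.val x).continuousOn.integrableOn_compact hK
  have h1 := (setIntegral_eq_zero_iff_of_nonneg_ae
    (.of_forall fun x => mul_self_nonneg (q.val x)) hint).1 h
  have h2 := Measure.eqOn_open_of_ae_eq (ae_restrict_of_ae_restrict_of_subset interior_subset h1)
    isOpen_interior (by fun_prop) continuousOn_const
  exact SPoly.eq_zero_of_eqOn_open isOpen_interior hne fun x hx => mul_self_eq_zero.1 (h2 hx)

theorem totalDegree_pderiv_add_one_le {q : SPoly d} (i : Fin d) {k : ℕ} (h : q.totalDegree ≤ k + 1) :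
    (MvPolynomial.pderiv i q).totalDegree ≤ k := by
  refine Finset.sup_le fun m hm => ?_
  rw [MvPolynomial.mem_support_iff, MvPolynomial.coeff_pderiv] at hm
  have h1 := (MvPolynomial.le_totalDegree
    (MvPolynomial.mem_support_iff.2 (left_ne_zero_of_mul hm))).trans h
  rw [Finsupp.sum_add_index' (fun _ => rfl) fun _ _ _ => rfl, Finsupp.sum_single_index rfl] at h1
  omega

theorem VPoly.totalDegree_div_le {v : VPoly d} {k : ℕ} (h : ∀ i, (v i).totalDegree ≤ k + 1) :
    v.div.totalDegree ≤ k :=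
  MvPolynomial.totalDegree_finsetSum_le fun i _ => totalDegree_pderiv_add_one_le i (h i)

/-- A definite bilinear form on a finite-dimensional space represents every linear functional. -/
theorem exists_represents {V : Type*} [AddCommGroup V] [Module ℝ V] [FiniteDimensional ℝ V]
    (B : V →ₗ[ℝ] V →ₗ[ℝ] ℝ) (hB : ∀ v, B v v = 0 → v = 0) (L : V →ₗ[ℝ] ℝ) :
    ∃ r, ∀ q, B r q = L q := by
  have hinj : Function.Injective B := by
    rw [← LinearMap.ker_eq_bot, LinearMap.ker_eq_bot']
    exact fun v hv => hB v (by rw [hv]; rfl)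
  have hsurj := (LinearMap.injective_iff_surjective_of_finrank_eq_finrank
    (Subspace.dual_finrank_eq (K := ℝ) (V := V)).symm).1 hinj
  obtain ⟨r, hr⟩ := hsurj L
  exact ⟨r, fun q => by rw [hr]⟩

end Poly

namespace Mesh

variable {d : ℕ} {Ω : Set (Pt d)} (T : Mesh Ω)

theorem innerS_self_eq_zero {q : T.BScal} (h : T.innerS q q = 0) : q = 0 := by
  have h1 := (Finset.sum_eq_zero_iff_of_nonneg fun (E : T.elements) _ =>
    integral_nonneg (μ := volume.restrict (E : Set (Pt d)))
      fun x => mul_self_nonneg ((q E).val x)).1 h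
  funext E
  exact SPoly.eq_zero_of_setIntegral_sq (T.polytope E).isCompact (T.polytope E).2.2
    (h1 E (Finset.mem_univ E))

theorem innerV_self_eq_zero {v : T.BVec} (h : T.innerV v v = 0) : v = 0 := by
  rw [innerV_eq_sum] at h
  have h1 := (Finset.sum_eq_zero_iff_of_nonneg fun i _ => T.innerS_self_nonneg _).1 h
  funext E i
  exact congrFun (T.innerS_self_eq_zero (h1 i (Finset.mem_univ i))) E

theorem Mh_add {k : ℕ} {p q : T.BScal} (hp : p ∈ T.Mh k) (hq : q ∈ T.Mh k) : p + q ∈ T.Mh k :=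
  fun E => (MvPolynomial.totalDegree_add _ _).trans (max_le (hp E) (hq E))

theorem Mh_smul {k : ℕ} {q : T.BScal} (a : ℝ) (hq : q ∈ T.Mh k) : a • q ∈ T.Mh k :=
  fun E => (MvPolynomial.totalDegree_smul_le _ _).trans (hq E)

theorem Mh_zero (k : ℕ) : (0 : T.BScal) ∈ T.Mh k := fun _ => by simp

/-- `M_h` as a subspace. -/
def MhSub (k : ℕ) : Submodule ℝ T.BScal where
  carrier := T.Mh k
  add_mem' := T.Mh_add
  zero_mem' := T.Mh_zero k
  smul_mem' a _ := T.Mh_smul a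

/-- `X_h` as a subspace. -/
def XhSub (k : ℕ) : Submodule ℝ T.BVec where
  carrier := T.Xh k
  add_mem' hv hw E i := (MvPolynomial.totalDegree_add _ _).trans (max_le (hv E i) (hw E i))
  zero_mem' E i := by simp
  smul_mem' a _ hv E i := (MvPolynomial.totalDegree_smul_le _ _).trans (hv E i)

instance (k : ℕ) : FiniteDimensional ℝ (T.MhSub k) := by
  let f : T.MhSub k →ₗ[ℝ] (T.elements → MvPolynomial.restrictTotalDegree (Fin d) ℝ k) :=
    { toFun := fun q E => ⟨q.1 E, (MvPolynomial.mem_restrictTotalDegree _ _ _).2 (q.2 E)⟩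
      map_add' := fun _ _ => rfl
      map_smul' := fun _ _ => rfl }
  refine FiniteDimensional.of_injective f fun p q h => Subtype.ext (funext fun E => ?_)
  exact congrArg Subtype.val (congrFun h E)

instance (k : ℕ) : FiniteDimensional ℝ (T.XhSub k) := by
  let f : T.XhSub k →ₗ[ℝ] (T.elements → Fin d → MvPolynomial.restrictTotalDegree (Fin d) ℝ k) :=
    { toFun := fun q E i => ⟨q.1 E i, (MvPolynomial.mem_restrictTotalDegree _ _ _).2 (q.2 E i)⟩
      map_add' := fun _ _ => rfl
      map_smul' := fun _ _ => rfl }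
  refine FiniteDimensional.of_injective f fun p q h => Subtype.ext (funext fun E => funext fun i => ?_)
  exact congrArg Subtype.val (congrFun (congrFun h E) i)

/-! ### The lift operators -/

/-- The L² product is definite on the finite-dimensional space M_h, so it represents the functional
on the right. For continuous ζ the default value 0 in `liftR` is therefore never taken. -/
theorem liftR_spec (k : ℕ) (e : T.faces) {ζ : Pt d → Pt d} (hζ : Continuous ζ) :
    T.liftR k e ζ ∈ T.Mh k ∧ ∀ q ∈ T.Mh k,
      T.innerS (T.liftR k e ζ) q = T.faceInt e fun x => T.avgS e q x * ⟪ζ x, T.normal e⟫ := by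
  have h : ∃ r ∈ T.Mh k, ∀ q ∈ T.Mh k,
      T.innerS r q = T.faceInt e fun x => T.avgS e q x * ⟪ζ x, T.normal e⟫ := by
    let L : T.MhSub k →ₗ[ℝ] ℝ :=
      { toFun := fun q => T.faceInt e fun x => T.avgS e q.1 x * ⟪ζ x, T.normal e⟫
        map_add' := fun p q => by
          rw [← T.faceInt_add e (by fun_prop) (by fun_prop)]
          simp [add_mul]
        map_smul' := fun a q => by
          rw [RingHom.id_apply, smul_eq_mul, ← T.faceInt_mul e]
          simp [mul_assoc] }
    obtain ⟨r, hr⟩ := exists_represents (T.innerSForm.domRestrict₁₂ (T.MhSub k) (T.MhSub k))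
      (fun v hv => Subtype.ext (T.innerS_self_eq_zero hv)) L
    exact ⟨r.1, r.2, fun q hq => hr ⟨q, hq⟩⟩
  rw [liftR, dif_pos h]
  exact h.choose_spec

theorem liftG_spec (k : ℕ) (e : T.faces) {ζ : Pt d → ℝ} (hζ : Continuous ζ) :
    T.liftG k e ζ ∈ T.Xh k ∧ ∀ θ ∈ T.Xh k,
      T.innerV (T.liftG k e ζ) θ = T.faceInt e fun x => ⟪T.avgV e θ x, T.normal e⟫ * ζ x := by
  have h : ∃ g ∈ T.Xh k, ∀ θ ∈ T.Xh k,
      T.innerV g θ = T.faceInt e fun x => ⟪T.avgV e θ x, T.normal e⟫ * ζ x := by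
    let L : T.XhSub k →ₗ[ℝ] ℝ :=
      { toFun := fun θ => T.faceInt e fun x => ⟪T.avgV e θ.1 x, T.normal e⟫ * ζ x
        map_add' := fun p q => by
          rw [← T.faceInt_add e (by fun_prop) (by fun_prop)]
          simp [add_mul, inner_add_left]
        map_smul' := fun a q => by
          rw [RingHom.id_apply, smul_eq_mul, ← T.faceInt_mul e]
          simp [mul_assoc, inner_smul_left] }
    obtain ⟨r, hr⟩ := exists_represents (T.innerVForm.domRestrict₁₂ (T.XhSub k) (T.XhSub k))
      (fun v hv => Subtype.ext (T.innerV_self_eq_zero hv)) L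
    exact ⟨r.1, r.2, fun q hq => hr ⟨q, hq⟩⟩
  rw [liftG, dif_pos h]
  exact h.choose_spec

theorem Rh_mem (k : ℕ) (θ : T.BVec) : T.Rh k θ ∈ T.Mh k :=
  (T.MhSub k).sum_mem fun e _ => (T.liftR_spec k e (T.continuous_jumpV e θ)).1

theorem innerS_Rh (k : ℕ) (θ : T.BVec) {q : T.BScal} (hq : q ∈ T.Mh k) :
    T.innerS (T.Rh k θ) q
      = ∑ e : T.faces, T.faceInt e fun x => T.avgS e q x * ⟪T.jumpV e θ x, T.normal e⟫ := by
  rw [innerS_eq, Rh, map_sum, LinearMap.sum_apply]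
  exact Finset.sum_congr rfl fun e _ => (T.liftR_spec k e (T.continuous_jumpV e θ)).2 q hq

theorem Gh_mem (k : ℕ) (q : T.BScal) : T.Gh k q ∈ T.Xh k :=
  (T.XhSub k).sum_mem fun e _ => (T.liftG_spec k e (T.continuous_jumpS e q)).1

theorem innerV_Gh (k : ℕ) (q : T.BScal) {θ : T.BVec} (hθ : θ ∈ T.Xh k) :
    T.innerV (T.Gh k q) θ
      = ∑ e ∈ T.interiorFaces,
          T.faceInt e fun x => ⟪T.avgV e θ x, T.normal e⟫ * T.jumpS e q x := by
  rw [innerV_eq, Gh, map_sum, LinearMap.sum_apply]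
  exact Finset.sum_congr rfl fun e _ => (T.liftG_spec k e (T.continuous_jumpS e q)).2 θ hθ

/-! ### Integration by parts -/

theorem outNormal_elt₁ (e : T.faces) : T.outNormal (T.elt₁ e) e = T.normal e := by
  simp [outNormal]

theorem outNormal_elt₂ {e : T.faces} {E : T.elements} (h : T.elt₂ e = some E) :
    T.outNormal E e = - T.normal e := by
  simp [outNormal, T.elt₁_ne h]

theorem integral_div (hΩ : IsPolyhedralDomain Ω) (E : T.elements) (F : VPoly d) :
    ∫ x in (E : Set (Pt d)), F.div.val x
      = ∑ e ∈ T.facesOf E, T.faceInt e fun x => ⟪F.val x, T.outNormal E e⟫ := by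
  have h1 : ∀ x, F.div.val x = ∑ i, ⟪SPoly.grad (F i) x, EuclideanSpace.single i (1 : ℝ)⟫ := fun x => by
    simp [VPoly.div, SPoly.val_sum, SPoly.grad, PiLp.inner_apply]
  have h2 : ∀ (e : T.faces) x, ⟪F.val x, T.outNormal E e⟫
      = ∑ i, ⟪T.outNormal E e, EuclideanSpace.single i (1 : ℝ)⟫ * SPoly.val (F i) x := fun e x => by
    simp [PiLp.inner_apply, VPoly.val]
  have h3 : ∀ e : T.faces, (T.faceInt e fun x => ⟪F.val x, T.outNormal E e⟫)
      = ∑ i, ⟪T.outNormal E e, EuclideanSpace.single i (1 : ℝ)⟫ * T.faceInt e (SPoly.val (F i)) := by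
    intro e
    simp only [h2]
    rw [faceInt, integral_finsetSum _ fun i _ => T.integrableOn_face e (by fun_prop)]
    exact Finset.sum_congr rfl fun i _ => T.faceInt_mul e _ _
  simp only [h1, h3]
  rw [integral_finsetSum _ fun i _ => T.integrableOn_elem E (by fun_prop), Finset.sum_comm]
  exact Finset.sum_congr rfl fun i _ => T.integral_grad hΩ E (F i) _

theorem sum_interiorFaces (F : T.faces → ℝ) :
    ∑ e ∈ T.interiorFaces, F e = ∑ e, (T.elt₂ e).elim 0 fun _ => F e := by
  rw [interiorFaces, Finset.sum_filter]
  refine Finset.sum_congr rfl fun e _ => ?_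
  rcases T.elt₂ e with _ | E <;> simp

/-- The sum of the fluxes through the boundaries of all elements, in terms of jumps. -/
theorem sum_flux (F : T.BVec) :
    ∑ E : T.elements, ∑ e ∈ T.facesOf E, (T.faceInt e fun x => ⟪(F E).val x, T.outNormal E e⟫)
      = ∑ e : T.faces, T.faceInt e fun x => ⟪T.jumpV e F x, T.normal e⟫ := by
  rw [T.sum_facesOf fun E e => T.faceInt e fun x => ⟪(F E).val x, T.outNormal E e⟫]
  refine Finset.sum_congr rfl fun e _ => ?_
  rw [outNormal_elt₁]
  rcases hE : T.elt₂ e with _ | E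
  · simp [jumpV, T.jump_of_none e _ hE]
  · simp only [Option.elim, T.outNormal_elt₂ hE, jumpV, T.jump_of_some e _ hE]
    rw [← T.faceInt_add e (by fun_prop) (by fun_prop)]
    simp only [sub_eq_add_neg, inner_add_left, inner_neg_left, inner_neg_right]

theorem sum_integral_div (hΩ : IsPolyhedralDomain Ω) (F : T.BVec) :
    ∑ E : T.elements, ∫ x in (E : Set (Pt d)), (F E).div.val x
      = ∑ e : T.faces, T.faceInt e fun x => ⟪T.jumpV e F x, T.normal e⟫ := by
  rw [← sum_flux]
  exact Finset.sum_congr rfl fun E _ => T.integral_div hΩ E (F E)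

/-- Elementwise divergence theorem for qθ, with the jump rule [qθ] = {q}[θ] + [q]{θ} on interior
faces. On a boundary face [qθ] is already {q}[θ], so only interior faces remain. -/
theorem bForm_eq_grad (hΩ : IsPolyhedralDomain Ω) (θ : T.BVec) (q : T.BScal) :
    T.bForm θ q = -(∑ E : T.elements, ∫ x in (E : Set (Pt d)), ⟪(θ E).val x, (q E).grad x⟫)
      + ∑ e ∈ T.interiorFaces,
          T.faceInt e fun x => ⟪T.avgV e θ x, T.normal e⟫ * T.jumpS e q x := by
  have h := T.sum_integral_div hΩ fun E i => q E * θ E i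
  have h1 : ∀ E : T.elements, ∫ x in (E : Set (Pt d)), (VPoly.div fun i => q E * θ E i).val x
      = (∫ x in (E : Set (Pt d)), (θ E).div.val x * (q E).val x)
        + ∫ x in (E : Set (Pt d)), ⟪(θ E).val x, (q E).grad x⟫ := fun E => by
    rw [← T.elemInt_add E (by fun_prop) (by fun_prop)]
    congr 1
    ext x
    simp [VPoly.div, SPoly.val_sum, Finset.sum_add_distrib, Finset.mul_sum, PiLp.inner_apply,
      SPoly.grad, VPoly.val, mul_comm, add_comm]
  have hval : ∀ (E : T.elements) x, (VPoly.val (fun i => q E * θ E i) x : Pt d)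
      = (q E).val x • (θ E).val x := fun E x => by ext i; simp [VPoly.val]
  have h2 : ∀ e : T.faces,
      (T.faceInt e fun x => ⟪T.jumpV e (fun E i => q E * θ E i) x, T.normal e⟫)
      = (T.faceInt e fun x => T.avgS e q x * ⟪T.jumpV e θ x, T.normal e⟫)
        + (T.elt₂ e).elim 0 fun _ =>
            T.faceInt e fun x => ⟪T.avgV e θ x, T.normal e⟫ * T.jumpS e q x := fun e => by
    rcases hE : T.elt₂ e with _ | E
    · simp [jumpV, avgS, T.jump_of_none e _ hE, T.avg_of_none e _ hE, hval, inner_smul_left]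
    · simp only [Option.elim]
      rw [← T.faceInt_add e (by fun_prop) (by fun_prop)]
      congr 1
      ext x
      simp only [jumpV, jumpS, avgS, avgV, T.jump_of_some e _ hE, T.avg_of_some e _ hE, hval,
        inner_sub_left, inner_add_left, real_inner_smul_left, smul_eq_mul]
      ring
  rw [Finset.sum_congr rfl fun E _ => h1 E, Finset.sum_congr rfl fun e _ => h2 e,
    Finset.sum_add_distrib, Finset.sum_add_distrib] at h
  rw [bForm, sum_interiorFaces]
  linarith

end Mesh

/-! ### Gradients and squared lengths as polynomials -/

namespace SPoly

variable {d : ℕ}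

/-- The gradient, as a polynomial vector field. -/
noncomputable def gradPoly (q : SPoly d) : VPoly d := fun i => MvPolynomial.pderiv i q

theorem val_gradPoly (q : SPoly d) (x : Pt d) : q.gradPoly.val x = q.grad x := rfl

end SPoly

namespace VPoly

variable {d : ℕ}

/-- `|v|²` as a polynomial. -/
noncomputable def sq (v : VPoly d) : SPoly d := ∑ j, v j * v j

theorem val_sq (v : VPoly d) (x : Pt d) : v.sq.val x = ⟪v.val x, v.val x⟫ := by
  simp only [sq, SPoly.val_sum, SPoly.val_mul, PiLp.inner_apply, val, Real.inner_apply]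

theorem inner_grad_sq (v : VPoly d) (x w : Pt d) :
    ⟪v.sq.grad x, w⟫ = 2 * ⟪v.gradMul x w, v.val x⟫ := by
  have h : v.sq.grad x = ∑ j, (2 * SPoly.val (v j) x) • SPoly.grad (v j) x := by
    ext i
    simp [sq, SPoly.grad, SPoly.val_sum, two_mul, add_mul]
  rw [h, sum_inner, PiLp.inner_apply, Finset.mul_sum]
  refine Finset.sum_congr rfl fun j _ => ?_
  simp [gradMul, val, real_inner_smul_left]
  ring

end VPoly

namespace Mesh

variable {d : ℕ} {Ω : Set (Pt d)} (T : Mesh Ω)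

/-! ### Nonnegativity of the convection form -/

/-- Replaces the inflow part of the face by a continuous weight on the whole face, so that the
upwind terms seen from the two neighbours can be added under one integral. -/
theorem upwind_integral (e : T.faces) {g : Pt d → ℝ} (hg : Continuous g) (h : Pt d → ℝ) :
    ∫ x in {x ∈ (e : Set (Pt d)) | g x < 0}, |g x| * h x ∂(μHE[d - 1] : Measure (Pt d))
      = T.faceInt e fun x => max (-g x) 0 * h x := by
  have hm : MeasurableSet {x | g x < 0} := measurableSet_lt hg.measurable measurable_const
  have hset : {x ∈ (e : Set (Pt d)) | g x < 0} = (e : Set (Pt d)) ∩ {x | g x < 0} := rfl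
  rw [hset, ← setIntegral_indicator hm, faceInt]
  congr 1
  ext x
  by_cases hx : g x < 0
  · rw [indicator_of_mem (by exact hx), abs_of_neg hx, max_eq_left (by linarith)]
  · rw [indicator_of_notMem (by exact hx), max_eq_right (by linarith), zero_mul]

/-- The volume terms are half the divergence of |v|² z, hence half the jump of its flux. The
correction with [z]·n cancels part of this flux on interior faces and leaves ½{z}·n [|v|²], which
the upwind terms complete to ½|{z}·n| |[v]|². -/
theorem aConv_nonneg (hΩ : IsPolyhedralDomain Ω) (z v : T.BVec) : 0 ≤ T.aConv z z v v := by
  set F : T.BVec := fun E i => (v E).sq * z E i with hF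
  have hval : ∀ (E : T.elements) x, (F E).val x = ⟪(v E).val x, (v E).val x⟫ • (z E).val x :=
    fun E x => by
      rw [← VPoly.val_sq]
      ext i
      simp [hF, VPoly.val]
  have hdiv : ∀ (E : T.elements) x, (F E).div.val x
      = 2 * ⟪(v E).gradMul x ((z E).val x), (v E).val x⟫
        + (z E).div.val x * ⟪(v E).val x, (v E).val x⟫ := fun E x => by
    rw [← VPoly.inner_grad_sq, ← VPoly.val_sq]
    simp [hF, VPoly.div, SPoly.val_sum, Finset.sum_add_distrib, Finset.mul_sum, PiLp.inner_apply,
      SPoly.grad, VPoly.val, mul_comm, add_comm]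
  have h1 : ∑ E : T.elements,
      ((∫ x in (E : Set (Pt d)), ⟪(v E).gradMul x ((z E).val x), (v E).val x⟫)
        + 1 / 2 * ∫ x in (E : Set (Pt d)), (z E).div.val x * ⟪(v E).val x, (v E).val x⟫)
      = 1 / 2 * ∑ e : T.faces, T.faceInt e fun x => ⟪T.jumpV e F x, T.normal e⟫ := by
    rw [← T.sum_integral_div hΩ, Finset.mul_sum]
    refine Finset.sum_congr rfl fun E _ => ?_
    simp only [hdiv]
    rw [T.elemInt_add E (by fun_prop) (by fun_prop), integral_const_mul]
    ring
  rw [aConv, h1, T.sum_facesOf fun E e =>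
    ∫ x in {x ∈ (e : Set (Pt d)) | ⟪T.avgV e z x, T.outNormal E e⟫ < 0},
        |⟪T.avgV e z x, T.outNormal E e⟫| * ⟪(v E).val x - T.extV E e v x, (v E).val x⟫
        ∂(μHE[d - 1] : Measure (Pt d)), Finset.mul_sum, Finset.mul_sum, ← Finset.sum_sub_distrib,
    ← Finset.sum_add_distrib]
  refine Finset.sum_nonneg fun e _ => ?_
  rw [outNormal_elt₁]
  rcases hE : T.elt₂ e with _ | E
  -- On a boundary face the flux and the correction cancel exactly, leaving the inflow integral of
  -- |z·n| |v|².
  · have h2 : ∀ x, T.extV (T.elt₁ e) e v x = 0 := fun x => by simp [extV, hE]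
    simp only [jumpV, T.jump_of_none e _ hE, T.avg_of_none e _ hE, hval, real_inner_smul_left, h2,
      Option.elim, mul_comm ⟪(z _).val _, T.normal e⟫, sub_self, zero_add, add_zero, sub_zero]
    refine integral_nonneg fun x => ?_
    exact mul_nonneg (abs_nonneg _) real_inner_self_nonneg
  · have h2 : ∀ x, T.extV (T.elt₁ e) e v x = (v E).val x := fun x => by simp [extV, hE]
    have h3 : ∀ x, T.extV E e v x = (v (T.elt₁ e)).val x := fun x => by
      simp [extV, T.elt₁_ne hE]
    simp only [Option.elim]
    rw [T.upwind_integral e (by fun_prop), T.upwind_integral e (by fun_prop)]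
    have hcont : Continuous fun x => T.avg e fun E => ⟪(v E).val x, (v E).val x⟫ :=
      T.continuous_avg e fun E => by fun_prop
    simp only [h2, h3, T.outNormal_elt₂ hE]
    rw [← T.faceInt_mul, ← T.faceInt_mul, ← T.faceInt_sub e (by fun_prop) (by fun_prop),
      ← T.faceInt_add e (by fun_prop) (by fun_prop), ← T.faceInt_add e (by fun_prop) (by fun_prop)]
    refine T.faceInt_nonneg e fun x => ?_
    simp only [jumpV, avgV, T.jump_of_some e _ hE, T.avg_of_some e _ hE, hval, inner_sub_left,
      inner_add_left, real_inner_smul_left, inner_neg_right, smul_eq_mul, neg_neg]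
    have h4 : 0 ≤ ⟪(v (T.elt₁ e)).val x - (v E).val x, (v (T.elt₁ e)).val x - (v E).val x⟫ :=
      real_inner_self_nonneg
    simp only [inner_sub_left, inner_sub_right] at h4
    rw [real_inner_comm ((v (T.elt₁ e)).val x) ((v E).val x)] at h4 ⊢
    generalize ⟪(v (T.elt₁ e)).val x, (v (T.elt₁ e)).val x⟫ = a at *
    generalize ⟪(v E).val x, (v E).val x⟫ = b at *
    generalize ⟪(v (T.elt₁ e)).val x, (v E).val x⟫ = m at *
    generalize ⟪(z (T.elt₁ e)).val x, T.normal e⟫ = s at *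
    generalize ⟪(z E).val x, T.normal e⟫ = t at *
    -- Only the downwind neighbour contributes an upwind term; in both cases the integrand is half
    -- the absolute normal velocity times a + b - 2m, the squared jump.
    rcases le_total 0 (1 / 2 * (s + t)) with hst | hst
    · rw [max_eq_right (by linarith), max_eq_left hst]
      nlinarith
    · rw [max_eq_left (by linarith), max_eq_right hst]
      nlinarith

/-! ### Discrete gradient and divergence -/

/-- The discrete gradient `∇_h q - G_h([q])`. -/
noncomputable def discGrad (k : ℕ) (q : T.BScal) : T.BVec :=
  (fun E => (q E).gradPoly) - T.Gh k q

/-- The discrete divergence `∇_h·v - R_h([v])`. -/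
noncomputable def discDiv (k : ℕ) (v : T.BVec) : T.BScal :=
  (fun E => (v E).div) - T.Rh k v

theorem gradPoly_mem {k₁ k₂ : ℕ} (hk : k₂ ≤ k₁ + 1) {q : T.BScal} (hq : q ∈ T.Mh k₂) :
    (fun E => (q E).gradPoly : T.BVec) ∈ T.Xh k₁ :=
  fun E i => totalDegree_pderiv_add_one_le i ((hq E).trans hk)

theorem discGrad_mem {k₁ k₂ : ℕ} (hk : k₂ ≤ k₁ + 1) {q : T.BScal} (hq : q ∈ T.Mh k₂) :
    T.discGrad k₁ q ∈ T.Xh k₁ :=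
  (T.XhSub k₁).sub_mem (T.gradPoly_mem hk hq) (T.Gh_mem k₁ q)

theorem discDiv_mem {k₁ k₂ : ℕ} (hk : k₁ ≤ k₂ + 1) {v : T.BVec} (hv : v ∈ T.Xh k₁) :
    T.discDiv k₂ v ∈ T.Mh k₂ :=
  (T.MhSub k₂).sub_mem (fun E => VPoly.totalDegree_div_le fun i => (hv E i).trans hk)
    (T.Rh_mem k₂ v)

/-- After integration by parts, the face terms of b are those defining the lift G_h([q]).
Discretely, the gradient is minus the adjoint of the divergence. -/
theorem innerV_discGrad (hΩ : IsPolyhedralDomain Ω) {k : ℕ} (q : T.BScal) {θ : T.BVec}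
    (hθ : θ ∈ T.Xh k) : T.innerV θ (T.discGrad k q) = - T.bForm θ q := by
  rw [T.bForm_eq_grad hΩ, ← T.innerV_Gh k q hθ, T.innerV_comm _ θ, innerV_eq, discGrad, map_sub,
    ← innerV_eq, ← innerV_eq]
  simp only [innerV, SPoly.val_gradPoly]
  ring

theorem innerS_discDiv {k : ℕ} (v : T.BVec) {q : T.BScal} (hq : q ∈ T.Mh k) :
    T.innerS (T.discDiv k v) q = T.bForm v q := by
  rw [innerS_eq, discDiv, map_sub, LinearMap.sub_apply, ← innerS_eq, ← innerS_eq,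
    T.innerS_Rh k v hq]
  rfl

theorem normV_sq (v : T.BVec) : T.normV v ^ 2 = T.innerV v v :=
  Real.sq_sqrt (T.innerV_self_nonneg v)

theorem normS_sq (q : T.BScal) : T.normS q ^ 2 = T.innerS q q :=
  Real.sq_sqrt (T.innerS_self_nonneg q)

/-- Expand the square. Since ∇_h q lies in X_h, it may be tested in the definition of G_h, and the
mixed terms become the two consistency terms of a_ellip. The penalty dominates ‖G_h([q])‖² because
σ̃ ≥ M̃². -/
theorem innerV_discGrad_self_le {k₁ k₂ : ℕ} (hk : k₂ ≤ k₁ + 1) {σt Mt : ℝ}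
    (hG : T.IsLiftConstG k₁ k₂ Mt) (hσ : Mt ^ 2 ≤ σt) {q : T.BScal} (hq : q ∈ T.Mh k₂) :
    T.innerV (T.discGrad k₁ q) (T.discGrad k₁ q) ≤ T.aEllip σt q q := by
  have h1 : T.innerV (T.Gh k₁ q) (T.Gh k₁ q)
      ≤ ∑ e ∈ T.interiorFaces, σt / T.faceSize e
        * T.faceInt e fun x => T.jumpS e q x * T.jumpS e q x := by
    have h2 := hG.2 q hq
    have h3 : 0 ≤ ∑ e ∈ T.interiorFaces,
        (T.faceSize e)⁻¹ * T.faceInt e fun x => (T.jumpS e q x) ^ 2 :=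
      Finset.sum_nonneg fun e _ => mul_nonneg (inv_nonneg.2 (T.faceSize_pos e).le)
        (T.faceInt_nonneg e fun x => sq_nonneg _)
    have h4 := pow_le_pow_left₀ (Real.sqrt_nonneg _) h2 2
    rw [mul_pow, Real.sq_sqrt h3, Real.sq_sqrt (T.innerV_self_nonneg _)] at h4
    refine (h4.trans (mul_le_mul_of_nonneg_right hσ h3)).trans_eq ?_
    simp only [Finset.mul_sum, sq, ← mul_assoc, div_eq_mul_inv]
  have h2 := T.innerV_Gh k₁ q (T.gradPoly_mem hk hq)
  have h3 : T.innerV (T.discGrad k₁ q) (T.discGrad k₁ q)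
      = T.innerV (fun E => (q E).gradPoly) (fun E => (q E).gradPoly)
        - 2 * T.innerV (T.Gh k₁ q) (fun E => (q E).gradPoly)
        + T.innerV (T.Gh k₁ q) (T.Gh k₁ q) := by
    have := T.innerV_comm (T.Gh k₁ q) (fun E => (q E).gradPoly)
    simp only [innerV_eq, discGrad, map_sub, LinearMap.sub_apply] at this ⊢
    rw [this]
    ring
  have h4 : T.innerV (fun E => (q E).gradPoly) (fun E => (q E).gradPoly)
      = ∑ E : T.elements, ∫ x in (E : Set (Pt d)), ⟪(q E).grad x, (q E).grad x⟫ := rfl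
  have h5 : ∀ e, (T.faceInt e fun x =>
      ⟪T.avgV e (fun E => (q E).gradPoly) x, T.normal e⟫ * T.jumpS e q x)
      = T.faceInt e fun x => T.avgGradS e q x * T.jumpS e q x := fun e => rfl
  simp only [h5] at h2
  rw [h3, h2, h4, aEllip]
  linarith

theorem sq_dgNormV {σ : ℝ} (hσ : 0 ≤ σ) (v : T.BVec) : T.dgNormV σ v ^ 2
    = (∑ E : T.elements, ∫ x in (E : Set (Pt d)), (v E).gradDot (v E) x)
      + ∑ e : T.faces, σ / T.faceSize e * T.faceInt e fun x => ‖T.jumpV e v x‖ ^ 2 := by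
  refine Real.sq_sqrt (add_nonneg ?_ ?_)
  · exact Finset.sum_nonneg fun E _ => integral_nonneg fun x =>
      Finset.sum_nonneg fun i _ => real_inner_self_nonneg
  · exact Finset.sum_nonneg fun e _ => mul_nonneg (div_nonneg hσ (T.faceSize_pos e).le)
      (T.faceInt_nonneg e fun x => sq_nonneg _)

/-- Cauchy–Schwarz for the trace of a d × d matrix; this is the source of the factor d in the
conditions on σ and δ. -/
theorem sq_div_le (v : VPoly d) (x : Pt d) : v.div.val x * v.div.val x ≤ d * v.gradDot v x := by
  rw [VPoly.div, SPoly.val_sum, ← sq]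
  refine (sq_sum_le_card_mul_sum_sq).trans ?_
  rw [Finset.card_univ, Fintype.card_fin]
  refine mul_le_mul_of_nonneg_left (Finset.sum_le_sum fun i _ => ?_) (by positivity)
  rw [PiLp.inner_apply]
  have h : ∀ j, 0 ≤ inner ℝ (SPoly.grad (v i) x j) (SPoly.grad (v i) x j) := fun j => by
    rw [Real.inner_apply]; exact mul_self_nonneg _
  refine le_trans ?_ (Finset.single_le_sum (fun j _ => h j) (Finset.mem_univ i))
  rw [Real.inner_apply, sq]
  exact le_rfl

/-- ‖a - b‖² ≤ 2‖a‖² + 2‖b‖² with a = ∇_h·v and b = R_h([v]). The first square is at most d times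
the gradient part of the DG norm and, as M² ≤ dσ, the second is at most d times its jump part. -/
theorem innerS_discDiv_self_le (hd : 0 < d) {k₁ k₂ : ℕ} {σ M : ℝ} (hR : T.IsLiftConstR k₁ k₂ M)
    (hσ : M ^ 2 / d ≤ σ) {v : T.BVec} (hv : v ∈ T.Xh k₁) :
    T.innerS (T.discDiv k₂ v) (T.discDiv k₂ v) ≤ 2 * d * T.dgNormV σ v ^ 2 := by
  have hd' : (0 : ℝ) < d := by exact_mod_cast hd
  have hσ0 : 0 ≤ σ := le_trans (by positivity) hσ
  set J := ∑ e : T.faces, (T.faceSize e)⁻¹ * T.faceInt e fun x => ‖T.jumpV e v x‖ ^ 2 with hJ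
  have hJ0 : 0 ≤ J := Finset.sum_nonneg fun e _ =>
    mul_nonneg (inv_nonneg.2 (T.faceSize_pos e).le) (T.faceInt_nonneg e fun x => sq_nonneg _)
  have h1 : T.innerS (T.Rh k₂ v) (T.Rh k₂ v) ≤ d * (σ * J) := by
    have h4 := pow_le_pow_left₀ (Real.sqrt_nonneg _) (hR.2 v hv) 2
    rw [mul_pow, Real.sq_sqrt hJ0, Real.sq_sqrt (T.innerS_self_nonneg _)] at h4
    rw [← mul_assoc]
    refine h4.trans (mul_le_mul_of_nonneg_right ?_ hJ0)
    rw [div_le_iff₀ hd'] at hσ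
    linarith
  have h2 : T.innerS (fun E => (v E).div) (fun E => (v E).div)
      ≤ d * ∑ E : T.elements, ∫ x in (E : Set (Pt d)), (v E).gradDot (v E) x := by
    rw [innerS, Finset.mul_sum]
    refine Finset.sum_le_sum fun E _ => ?_
    rw [← integral_const_mul]
    exact integral_mono (T.integrableOn_elem E (by fun_prop)) (T.integrableOn_elem E (by fun_prop))
      fun x => sq_div_le (v E) x
  have h3 := T.innerS_self_nonneg ((fun E => (v E).div) + T.Rh k₂ v)
  have h4 := T.innerS_comm (T.Rh k₂ v) (fun E => (v E).div)
  have h5 : T.dgNormV σ v ^ 2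
      = (∑ E : T.elements, ∫ x in (E : Set (Pt d)), (v E).gradDot (v E) x) + σ * J := by
    rw [T.sq_dgNormV hσ0, hJ, Finset.mul_sum]
    simp only [div_eq_mul_inv, mul_assoc]
  rw [h5]
  simp only [innerS_eq, discDiv, map_sub, map_add, LinearMap.sub_apply,
    LinearMap.add_apply] at h1 h2 h3 h4 ⊢
  nlinarith

end Mesh

namespace Mesh

variable {d : ℕ} {Ω : Set (Pt d)} (T : Mesh Ω)

/-! ### Square integrable functions on the elements -/

/-- Elements are closed and may meet ∂Ω, while the data are given on Ω. Interiors lie in Ω and are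
disjoint, and they miss only null sets, so integrals over elements may be computed on them. -/
theorem interior_elem_subset (hΩ : IsPolyhedralDomain Ω) (E : T.elements) :
    interior (E : Set (Pt d)) ⊆ Ω := by
  have h : (E : Set (Pt d)) ⊆ closure Ω :=
    (subset_biUnion_of_mem (u := id) E.2).trans T.cover.subset
  exact (interior_mono h).trans hΩ.interior_closure.subset

theorem elem_ae_eq_interior (E : T.elements) :
    (E : Set (Pt d)) =ᵐ[volume] interior (E : Set (Pt d)) := by
  have h := (T.polytope E).volume_frontier
  rw [(T.polytope E).isClosed.frontier_eq] at h
  exact (ae_le_set.2 h).antisymm interior_subset.eventuallyLE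

theorem restrict_elem (E : T.elements) :
    volume.restrict (E : Set (Pt d)) = volume.restrict (interior (E : Set (Pt d))) :=
  Measure.restrict_congr_set (T.elem_ae_eq_interior E)

theorem memLp_elem (hΩ : IsPolyhedralDomain Ω) {f : Pt d → Pt d}
    (hf : MemLp f 2 (volume.restrict Ω)) (E : T.elements) :
    MemLp f 2 (volume.restrict (E : Set (Pt d))) := by
  rw [restrict_elem]
  exact hf.mono_measure (Measure.restrict_mono (T.interior_elem_subset hΩ E) le_rfl)

theorem sum_integral_le (hΩ : IsPolyhedralDomain Ω) {g : Pt d → ℝ} (hg0 : ∀ x, 0 ≤ g x)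
    (hg : IntegrableOn g Ω) :
    ∑ E : T.elements, ∫ x in (E : Set (Pt d)), g x ≤ ∫ x in Ω, g x := by
  simp only [restrict_elem]
  rw [← integral_biUnion_finset Finset.univ (s := fun E : T.elements => interior (E : Set (Pt d)))
    (fun _ _ => isOpen_interior.measurableSet)
    (fun E _ E' _ hne => T.disjoint_interior E E.2 E' E'.2 fun h => hne (Subtype.ext h))
    (fun E _ => hg.mono_set (T.interior_elem_subset hΩ E))]
  exact setIntegral_mono_set hg (.of_forall hg0)
    (LE.le.eventuallyLE (iUnion₂_subset fun E _ => T.interior_elem_subset hΩ E))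

theorem integrable_norm_sq {μ : Measure (Pt d)} {f : Pt d → Pt d} (hf : MemLp f 2 μ) :
    Integrable (fun x => ‖f x‖ ^ 2) μ := hf.integrable_norm_pow (by norm_num)

theorem memLp_val (E : T.elements) (v : VPoly d) :
    MemLp v.val 2 (volume.restrict (E : Set (Pt d))) := by
  have hc := (T.polytope E).isCompact
  have : IsFiniteMeasure (volume.restrict (E : Set (Pt d))) := ⟨by simpa using hc.measure_lt_top⟩
  obtain ⟨B, hB⟩ := hc.exists_bound_of_continuousOn v.continuous_val.continuousOn
  refine MemLp.of_bound v.continuous_val.aestronglyMeasurable B ?_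
  filter_upwards [ae_restrict_mem hc.measurableSet] with x hx using hB x hx

theorem integrable_inner {μ : Measure (Pt d)} {f g : Pt d → Pt d} (hf : MemLp f 2 μ)
    (hg : MemLp g 2 μ) : Integrable (fun x => ⟪f x, g x⟫) μ := by
  refine ((integrable_norm_sq hf).add (integrable_norm_sq hg)).mono' (hf.1.inner hg.1)
    (.of_forall fun x => ?_)
  rw [Real.norm_eq_abs, Pi.add_apply]
  nlinarith [abs_real_inner_le_norm (f x) (g x), sq_nonneg (‖f x‖ - ‖g x‖), sq_nonneg ‖f x‖,
    sq_nonneg ‖g x‖]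

/-- Young's inequality for the right-hand side. -/
theorem innerF_le (hΩ : IsPolyhedralDomain Ω) {f : Pt d → Pt d}
    (hf : MemLp f 2 (volume.restrict Ω)) (v : T.BVec) {a : ℝ} (ha : 0 < a) :
    T.innerF f v ≤ a * (∫ x in Ω, ‖f x‖ ^ 2) + (4 * a)⁻¹ * T.innerV v v := by
  have hle := mul_le_mul_of_nonneg_left (T.sum_integral_le hΩ (fun x => sq_nonneg ‖f x‖)
    (integrable_norm_sq hf)) ha.le
  refine le_trans ?_ (add_le_add_left hle _)
  rw [innerF, innerV, Finset.mul_sum, Finset.mul_sum, ← Finset.sum_add_distrib]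
  refine Finset.sum_le_sum fun E _ => ?_
  have hfE := T.memLp_elem hΩ hf E
  have h1 := (integrable_norm_sq hfE).const_mul a
  have h2 := (T.integrableOn_elem E (f := fun x => ⟪(v E).val x, (v E).val x⟫)
    (by fun_prop)).const_mul (4 * a)⁻¹
  rw [← integral_const_mul, ← integral_const_mul, ← integral_add h1 h2]
  refine integral_mono (integrable_inner hfE (T.memLp_val E (v E))) (h1.add h2) fun x => ?_
  simp only [real_inner_self_eq_norm_sq]
  refine (real_inner_le_norm _ _).trans ?_
  have h3 : a * ‖f x‖ ^ 2 + (4 * a)⁻¹ * ‖(v E).val x‖ ^ 2 - ‖f x‖ * ‖(v E).val x‖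
      = a * (‖f x‖ - (2 * a)⁻¹ * ‖(v E).val x‖) ^ 2 := by field_simp; ring
  have h4 : 0 ≤ a * (‖f x‖ - (2 * a)⁻¹ * ‖(v E).val x‖) ^ 2 := by positivity
  linarith

/-- The elementwise `L²` projection does not increase the norm. -/
theorem innerV_proj_le (hΩ : IsPolyhedralDomain Ω) {k : ℕ} {g : Pt d → Pt d}
    (hg : MemLp g 2 (volume.restrict Ω)) {u : T.BVec} (hu : u ∈ T.Xh k)
    (hproj : ∀ (E : T.elements) (θ : VPoly d), (∀ i, (θ i).totalDegree ≤ k) →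
      ∫ x in (E : Set (Pt d)), ⟪(u E).val x - g x, θ.val x⟫ = 0) :
    T.innerV u u ≤ ∫ x in Ω, ‖g x‖ ^ 2 := by
  refine le_trans ?_ (T.sum_integral_le hΩ (fun x => sq_nonneg ‖g x‖) (integrable_norm_sq hg))
  refine Finset.sum_le_sum fun E _ => ?_
  have hgE := T.memLp_elem hΩ hg E
  have huE := T.memLp_val E (u E)
  have h1 := integrable_norm_sq hgE
  have h2 : Integrable (fun x => 2 * ⟪(u E).val x - g x, (u E).val x⟫)
      (volume.restrict (E : Set (Pt d))) := (integrable_inner (huE.sub hgE) huE).const_mul 2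
  -- The integrand equals |u|² + |u - g|² pointwise, and its second part is orthogonality tested
  -- with u itself.
  have h3 : ∫ x in (E : Set (Pt d)), (‖g x‖ ^ 2 + 2 * ⟪(u E).val x - g x, (u E).val x⟫)
      = ∫ x in (E : Set (Pt d)), ‖g x‖ ^ 2 := by
    rw [integral_add h1 h2, integral_const_mul, hproj E (u E) (hu E)]
    ring
  rw [← h3]
  refine integral_mono (T.integrableOn_elem E (by fun_prop)) (h1.add h2) fun x => ?_
  have h4 := norm_sub_sq_real ((u E).val x) (g x)
  have h5 := sq_nonneg ‖(u E).val x - g x‖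
  simp only [inner_sub_left, real_inner_self_eq_norm_sq]
  rw [real_inner_comm] at h4
  linarith

/-! ### Constants -/

theorem _root_.SPoly.grad_one (x : Pt d) : (1 : SPoly d).grad x = 0 := by
  ext i; simp [SPoly.grad]

/-- Constants are in the kernel because only interior faces enter a_ellip. Together with
`bForm_one`, this makes the potential equation compatible with constant test functions. -/
theorem aEllip_one (σt : ℝ) (p : T.BScal) : T.aEllip σt p 1 = 0 := by
  have h2 : ∀ e ∈ T.interiorFaces, ∀ x, T.jumpS e 1 x = 0 := fun e he x => by
    obtain ⟨E, hE⟩ := Option.isSome_iff_exists.1 (Finset.mem_filter.1 he).2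
    simp [jumpS, T.jump_of_some e _ hE]
  have h3 : ∀ e ∈ T.interiorFaces, ∀ x, T.avgGradS e 1 x = 0 := fun e he x => by
    obtain ⟨E, hE⟩ := Option.isSome_iff_exists.1 (Finset.mem_filter.1 he).2
    simp only [avgGradS, T.avg_of_some e _ hE, Pi.one_apply, SPoly.grad_one]
    simp
  rw [aEllip, Finset.sum_eq_zero, Finset.sum_eq_zero, Finset.sum_eq_zero, Finset.sum_eq_zero]
  · simp
  · intro e he; simp [h2 e he, faceInt]
  · intro e he; simp [h3 e he, faceInt]
  · intro e he; simp [h2 e he, faceInt]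
  · intro E _; simp [SPoly.grad_one]

theorem bForm_one (hΩ : IsPolyhedralDomain Ω) (v : T.BVec) : T.bForm v 1 = 0 := by
  have h2 : ∀ e ∈ T.interiorFaces, ∀ x, T.jumpS e 1 x = 0 := fun e he x => by
    obtain ⟨E, hE⟩ := Option.isSome_iff_exists.1 (Finset.mem_filter.1 he).2
    simp [jumpS, T.jump_of_some e _ hE]
  rw [T.bForm_eq_grad hΩ, Finset.sum_eq_zero, Finset.sum_eq_zero]
  · simp
  · intro e he; simp [h2 e he, faceInt]
  · intro E _; simp [SPoly.grad_one]

/-- Subtract the mean value. This serves to extend the potential equation from M_h0 to M_h, since ξ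
need not have mean zero. -/
theorem exists_sub_const_mem_Mh0 (hΩ : IsPolyhedralDomain Ω) {k : ℕ} {q : T.BScal}
    (hq : q ∈ T.Mh k) : ∃ c : ℝ, q - c • (1 : T.BScal) ∈ T.Mh0 k := by
  set V := ∑ E : T.elements, ∫ x in (E : Set (Pt d)), (1 : ℝ) with hV
  have hVpos : 0 < V := by
    obtain ⟨x, hx⟩ := hΩ.isConnected.nonempty
    have hx' := subset_closure hx
    rw [← T.cover] at hx'
    obtain ⟨E, hE, -⟩ := mem_iUnion₂.1 hx'
    refine Finset.sum_pos (fun E _ => ?_) ⟨⟨E, hE⟩, Finset.mem_univ _⟩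
    rw [setIntegral_const, smul_eq_mul, mul_one]
    refine ENNReal.toReal_pos ?_ (T.polytope E).isCompact.measure_lt_top.ne
    exact ((isOpen_interior.measure_pos volume (T.polytope E).2.2).trans_le
      (measure_mono interior_subset)).ne'
  have h1 : (1 : T.BScal) ∈ T.Mh k := fun E => by simp
  refine ⟨(∑ E : T.elements, ∫ x in (E : Set (Pt d)), (q E).val x) / V,
    (T.MhSub k).sub_mem hq (T.Mh_smul _ h1), ?_⟩
  set I := ∑ E : T.elements, ∫ x in (E : Set (Pt d)), (q E).val x with hI
  have h2 : ∀ E : T.elements, ∫ x in (E : Set (Pt d)), ((q - (I / V) • (1 : T.BScal)) E).val x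
      = (∫ x in (E : Set (Pt d)), (q E).val x) - I / V * ∫ x in (E : Set (Pt d)), (1 : ℝ) := by
    intro E
    rw [← integral_const_mul, ← integral_sub (T.integrableOn_elem E (by fun_prop))
      (T.integrableOn_elem E (by fun_prop))]
    simp
  simp only [h2]
  rw [Finset.sum_sub_distrib, ← Finset.mul_sum, ← hI, ← hV]
  field_simp
  ring

end Mesh

namespace Mesh

variable {d : ℕ} {Ω : Set (Pt d)} (T : Mesh Ω)

/-! ### Stability of the pressure correction scheme -/

theorem auxS_zero (k₂ : ℕ) (μ δ : ℝ) (v : ℕ → T.BVec) : T.auxS k₂ μ δ v 0 = 0 := by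
  simp [auxS]

theorem auxS_succ (k₂ : ℕ) (μ δ : ℝ) (v : ℕ → T.BVec) (n : ℕ) :
    T.auxS k₂ μ δ v (n + 1) = T.auxS k₂ μ δ v n + (δ * μ) • T.discDiv k₂ (v (n + 1)) := by
  rw [auxS, Finset.sum_Icc_succ_top (by omega), smul_add]
  rfl

namespace IsPressureCorrection

variable {T} {k₁ k₂ N : ℕ} {ε σ σt μ δ τ : ℝ} {u0 : Pt d → Pt d} {f : ℝ → Pt d → Pt d}
  {u v : ℕ → T.BVec} {φ p : ℕ → T.BScal}

theorem p_mem' (h : T.IsPressureCorrection k₁ k₂ ε σ σt μ δ τ N u0 f u v φ p) {n : ℕ}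
    (hn : n ≤ N) : p n ∈ T.Mh k₂ := by
  cases n with
  | zero => rw [h.p_zero]; exact T.Mh_zero k₂
  | succ n => exact h.p_mem n hn

theorem auxS_mem (h : T.IsPressureCorrection k₁ k₂ ε σ σt μ δ τ N u0 f u v φ p)
    (hk : k₁ ≤ k₂ + 1) {n : ℕ} (hn : n ≤ N) : T.auxS k₂ μ δ v n ∈ T.Mh k₂ := by
  induction n with
  | zero => rw [auxS_zero]; exact T.Mh_zero k₂
  | succ n ih =>
    rw [auxS_succ]
    exact T.Mh_add (ih (by omega)) (T.Mh_smul _ (T.discDiv_mem hk (h.v_mem n hn)))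

theorem auxXi_mem (h : T.IsPressureCorrection k₁ k₂ ε σ σt μ δ τ N u0 f u v φ p)
    (hk : k₁ ≤ k₂ + 1) {n : ℕ} (hn : n ≤ N) : T.auxXi k₂ μ δ v p n ∈ T.Mh k₂ :=
  T.Mh_add (h.p_mem' hn) (h.auxS_mem hk hn)

/-- The sum of pressure and accumulated divergence is updated by the potential. -/
theorem auxXi_succ (h : T.IsPressureCorrection k₁ k₂ ε σ σt μ δ τ N u0 f u v φ p)
    (hk : k₁ ≤ k₂ + 1) {n : ℕ} (hn : n < N) :
    T.auxXi k₂ μ δ v p (n + 1) = T.auxXi k₂ μ δ v p n + φ (n + 1) := by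
  -- The residual of the pressure update lies in M_h and is orthogonal to M_h, hence to itself, so
  -- it vanishes as a function.
  set r : T.BScal := p (n + 1) - p n - φ (n + 1) + (δ * μ) • T.discDiv k₂ (v (n + 1)) with hr
  have hmem : r ∈ T.MhSub k₂ :=
    add_mem (sub_mem (sub_mem (h.p_mem' hn) (h.p_mem' hn.le)) (h.φ_mem n hn).1)
      (T.Mh_smul _ (T.discDiv_mem hk (h.v_mem n hn)))
  have hzero : T.innerS r r = 0 := by
    have h1 := h.p_eq n hn r hmem
    have h2 := T.innerS_discDiv (k := k₂) (v (n + 1)) hmem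
    have h3 : T.innerS r r = T.innerS (p (n + 1)) r - T.innerS (p n) r - T.innerS (φ (n + 1)) r
        + δ * μ * T.innerS (T.discDiv k₂ (v (n + 1))) r := by
      simp only [innerS_eq]
      nth_rewrite 1 [hr]
      simp
    rw [h3, h1, h2]
    ring
  have hr0 := T.innerS_self_eq_zero hzero
  have : p (n + 1) + (δ * μ) • T.discDiv k₂ (v (n + 1)) = p n + φ (n + 1) := by
    rw [← sub_eq_zero, ← hr0, hr]
    abel
  rw [auxXi, auxXi, auxS_succ, add_left_comm, this]
  abel

/-- The equation for the potential holds for all test functions. -/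
theorem aEllip_eq (hΩ : IsPolyhedralDomain Ω)
    (h : T.IsPressureCorrection k₁ k₂ ε σ σt μ δ τ N u0 f u v φ p) {n : ℕ} (hn : n < N)
    {q : T.BScal} (hq : q ∈ T.Mh k₂) :
    T.aEllip σt (φ (n + 1)) q = -(1 / τ) * T.bForm (v (n + 1)) q := by
  obtain ⟨c, hc⟩ := T.exists_sub_const_mem_Mh0 hΩ hq
  have h1 := h.φ_eq n hn _ hc
  have hdec : q = (q - c • (1 : T.BScal)) + c • (1 : T.BScal) := by abel
  have h2 : T.aEllip σt (φ (n + 1)) q = T.aEllip σt (φ (n + 1)) (q - c • (1 : T.BScal)) := by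
    conv_lhs => rw [hdec]
    rw [aEllip_comm, aEllip_add_left, aEllip_smul_left, T.aEllip_comm σt 1, aEllip_one, mul_zero,
      add_zero, aEllip_comm]
  have h3 : T.bForm (v (n + 1)) q = T.bForm (v (n + 1)) (q - c • (1 : T.BScal)) := by
    have h4 := T.bForm_one hΩ (v (n + 1))
    rw [bForm_eq] at h4
    rw [bForm_eq, bForm_eq, map_sub, map_smul, h4, smul_zero, sub_zero]
  rw [h2, h3, h1]

/-- The energy estimate for one time step. -/
theorem energy_step (hd : 0 < d) (hΩ : IsPolyhedralDomain Ω) {κ M Mt C : ℝ}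
    (hk : k₁ ≤ k₂ + 1) (hk' : k₂ ≤ k₁ + 1) (hμ : 0 < μ) (hδ : 0 < δ)
    (hcoer : T.IsCoerciveEps k₁ ε σ κ) (hR : T.IsLiftConstR k₁ k₂ M)
    (hG : T.IsLiftConstG k₁ k₂ Mt) (hC : T.IsPoincareConst k₁ σ C)
    (hM : M ^ 2 / d ≤ σ) (hMt : Mt ^ 2 ≤ σt) (hδκ : δ ≤ κ / (2 * d)) (hτ : 0 < τ)
    (hf : ∀ n ∈ Finset.Icc 1 N, MemLp (f (n * τ)) 2 (volume.restrict Ω))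
    (h : T.IsPressureCorrection k₁ k₂ ε σ σt μ δ τ N u0 f u v φ p) {n : ℕ} (hn : n < N) :
    T.innerV (u (n + 1)) (u (n + 1)) + κ * μ / 2 * τ * T.dgNormV σ (v (n + 1)) ^ 2
        + τ ^ 2 * T.aEllip σt (T.auxXi k₂ μ δ v p (n + 1)) (T.auxXi k₂ μ δ v p (n + 1))
        + 1 / (δ * μ) * τ * T.innerS (T.auxS k₂ μ δ v (n + 1)) (T.auxS k₂ μ δ v (n + 1))
      ≤ T.innerV (u n) (u n)
        + τ ^ 2 * T.aEllip σt (T.auxXi k₂ μ δ v p n) (T.auxXi k₂ μ δ v p n)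
        + 1 / (δ * μ) * τ * T.innerS (T.auxS k₂ μ δ v n) (T.auxS k₂ μ δ v n)
        + 2 * C ^ 2 / (κ * μ) * τ * ∫ x in Ω, ‖f ((n + 1 : ℕ) * τ) x‖ ^ 2 := by
  have hd' : (0 : ℝ) < d := by exact_mod_cast hd
  have hκ := hcoer.1
  have hvX := h.v_mem n hn
  have huX' := h.u_mem n hn
  have hφM := (h.φ_mem n hn).1
  have hξM := h.auxXi_mem hk hn.le
  have hSM := h.auxS_mem hk hn.le
  have hxi := h.auxXi_succ hk hn
  have hS := T.auxS_succ k₂ μ δ v n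
  have hpM := h.p_mem' hn.le
  set vn := v (n + 1)
  set un := u (n + 1)
  set φn := φ (n + 1)
  set ξ := T.auxXi k₂ μ δ v p n with hξ
  set S := T.auxS k₂ μ δ v n with hSdef
  set F := ∫ x in Ω, ‖f ((n + 1 : ℕ) * τ) x‖ ^ 2 with hF
  have hDX := T.discGrad_mem hk' hφM
  have hBM := T.discDiv_mem hk hvX
  set D := T.discGrad k₁ φn
  set B := T.discDiv k₂ vn
  set G := T.dgNormV σ vn ^ 2 with hGdef
  -- the update of the velocity
  have e1 := h.u_eq n hn un huX'
  have e2 := h.u_eq n hn vn hvX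
  have e3 := h.u_eq n hn D hDX
  have e4 : T.innerV un D = -T.bForm un φn := T.innerV_discGrad hΩ φn huX'
  have e5 : T.innerV vn D = -T.bForm vn φn := T.innerV_discGrad hΩ φn hvX
  have e6 : T.innerV D D = -T.bForm D φn := T.innerV_discGrad hΩ φn hDX
  have e7 : T.innerV D D ≤ T.aEllip σt φn φn := T.innerV_discGrad_self_le hk' hG hMt hφM
  have e8 : τ * T.aEllip σt φn φn = -T.bForm vn φn := by
    rw [h.aEllip_eq hΩ hn hφM]; field_simp; rfl
  have e9 : T.innerV vn un = T.innerV un vn := T.innerV_comm _ _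
  -- the momentum equation
  have m1 := h.v_eq n hn vn hvX
  have m2 := T.aConv_nonneg hΩ (u n) vn
  have m3 : κ * G ≤ T.aEps ε σ vn vn := hcoer.2 vn hvX
  -- This is ‖u^n - v^{n+1}‖² ≥ 0; the square is dropped.
  have m4 : 0 ≤ T.innerV (u n) (u n) - 2 * T.innerV (u n) vn + T.innerV vn vn := by
    have := T.innerV_self_nonneg (u n - vn)
    have hc := T.innerV_comm vn (u n)
    simp only [innerV_eq, map_sub, LinearMap.sub_apply] at this hc ⊢
    linarith
  -- The splitting p = ξ - S: the ξ part will telescope through a_ellip, the S part through ‖S‖².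
  have m5 : T.bForm vn (p n) = T.bForm vn ξ - T.bForm vn S := by
    have : p n = ξ - S := by rw [hξ, auxXi, ← hSdef, add_sub_cancel_right]
    rw [this, bForm_eq, map_sub]; rfl
  have m6 : T.innerF (f ((n + 1 : ℕ) * τ)) vn ≤ C ^ 2 / (κ * μ) * F + κ * μ / 4 * G := by
    have hC0 := hC.1
    -- The weight C²/(κμ) is chosen so that, after the Poincaré inequality, the velocity part is
    -- κμ/4 times the squared DG norm.
    have h1 := T.innerF_le hΩ (hf (n + 1) (Finset.mem_Icc.2 ⟨by omega, hn⟩)) vn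
      (a := C ^ 2 / (κ * μ)) (by positivity)
    refine h1.trans (add_le_add_right ?_ _)
    have h2 := pow_le_pow_left₀ (Real.sqrt_nonneg _) (hC.2 vn hvX) 2
    rw [Real.sq_sqrt (T.innerV_self_nonneg _), mul_pow] at h2
    refine (mul_le_mul_of_nonneg_left h2 (by positivity)).trans_eq ?_
    rw [hGdef]
    field_simp
  -- the pressure
  have p1 : τ * T.aEllip σt φn ξ = -T.bForm vn ξ := by
    rw [h.aEllip_eq hΩ hn hξM]; field_simp; rfl
  have p2 : T.aEllip σt (ξ + φn) (ξ + φn)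
      = T.aEllip σt ξ ξ + 2 * T.aEllip σt φn ξ + T.aEllip σt φn φn := by
    rw [aEllip_add_left, T.aEllip_comm σt ξ, T.aEllip_comm σt φn (ξ + φn), aEllip_add_left,
      aEllip_add_left, T.aEllip_comm σt ξ φn]
    ring
  have s1 : T.innerS B S = T.bForm vn S := T.innerS_discDiv vn hSM
  have s2 : T.innerS (S + (δ * μ) • B) (S + (δ * μ) • B)
      = T.innerS S S + 2 * (δ * μ) * T.innerS B S + (δ * μ) ^ 2 * T.innerS B B := by
    have hc := T.innerS_comm S B
    simp only [innerS_eq, map_add, map_smul, LinearMap.add_apply, LinearMap.smul_apply,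
      smul_eq_mul] at hc ⊢
    rw [hc]
    ring
  have s3 : T.innerS B B ≤ 2 * d * G := T.innerS_discDiv_self_le hd hR hM hvX
  -- Here δ ≤ κ/(2d) meets the constant 2d of the discrete divergence.
  have s4 : δ * T.innerS B B ≤ κ * G := by
    have hG0 : 0 ≤ G := sq_nonneg _
    rw [le_div_iff₀ (by positivity)] at hδκ
    calc δ * T.innerS B B ≤ δ * (2 * d * G) := mul_le_mul_of_nonneg_left s3 hδ.le
      _ = (δ * (2 * d)) * G := by ring
      _ ≤ κ * G := mul_le_mul_of_nonneg_right hδκ hG0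
  rw [hxi, p2, hS, s2]
  have s5 : 1 / (δ * μ) * τ * (T.innerS S S + 2 * (δ * μ) * T.innerS B S
        + (δ * μ) ^ 2 * T.innerS B B)
      = 1 / (δ * μ) * τ * T.innerS S S + 2 * τ * T.innerS B S + τ * μ * (δ * T.innerS B B) := by
    field_simp
  have s6 : 2 * C ^ 2 / (κ * μ) * τ * F = 2 * τ * (C ^ 2 / (κ * μ) * F) := by ring
  rw [s5, s6, s1]
  have t1 := mul_le_mul_of_nonneg_left s4 (mul_pos hτ hμ).le
  have t2 := mul_le_mul_of_nonneg_left m3 (mul_pos hτ hμ).le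
  have t3 := mul_le_mul_of_nonneg_left m6 hτ.le
  have t4 := mul_nonneg hτ.le m2
  have t5 := mul_le_mul_of_nonneg_left e7 (sq_nonneg τ)
  -- norms of the velocities
  have r1 : T.innerV un un = T.innerV vn vn - 2 * (τ ^ 2 * T.aEllip σt φn φn)
      + τ ^ 2 * T.innerV D D := by
    have h1 : T.bForm vn φn = -(τ * T.aEllip σt φn φn) := by linarith
    have h2 : T.bForm D φn = - T.innerV D D := by linarith
    have h3 : T.bForm un φn = -(τ * T.aEllip σt φn φn - τ * T.innerV D D) := by
      rw [h2] at e3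
      linarith
    rw [e1, e9, e2, h1, h3]
    ring
  have r2 : τ ^ 2 * T.aEllip σt φn ξ = -(τ * T.bForm vn ξ) := by
    rw [sq, mul_assoc, p1]; ring
  -- Twice `m1` closes the estimate: `m4` removes the mixed velocity product, `t4` the convection,
  -- `r2` turns b(v,ξ) into the mixed term of a_ellip, and `r1` with `t5` supplies τ² a_ellip(φ,φ).
  -- Of the dissipation 2κμτG, `t1` uses one half and `t3` one quarter, leaving κμτG/2.
  rw [m5] at m1
  linarith

end IsPressureCorrection

/-- The energy is telescoped with a_ellip(ξ,ξ) itself, in which the one-step estimate loses nothing.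
Coercivity converts it to ½|ξ|²_DG only at the final time. -/
theorem stability (hd : 0 < d) (hΩ : IsPolyhedralDomain Ω) {k₁ k₂ N : ℕ}
    {ε σ σt μ δ τ κ M Mt C : ℝ} {u0 : Pt d → Pt d} {f : ℝ → Pt d → Pt d}
    {u v : ℕ → T.BVec} {φ p : ℕ → T.BScal}
    (hk : k₁ ≤ k₂ + 1) (hk' : k₂ ≤ k₁ + 1) (hμ : 0 < μ) (hδ : 0 < δ)
    (hcoer : T.IsCoerciveEps k₁ ε σ κ) (hell : T.IsCoerciveEllip k₂ σt)
    (hR : T.IsLiftConstR k₁ k₂ M)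
    (hG : T.IsLiftConstG k₁ k₂ Mt) (hC : T.IsPoincareConst k₁ σ C)
    (hM : M ^ 2 / d ≤ σ) (hMt : Mt ^ 2 ≤ σt) (hδκ : δ ≤ κ / (2 * d)) (hτ : 0 < τ)
    (hu0 : MemLp u0 2 (volume.restrict Ω))
    (hf : ∀ n ∈ Finset.Icc 1 N, MemLp (f (n * τ)) 2 (volume.restrict Ω))
    (h : T.IsPressureCorrection k₁ k₂ ε σ σt μ δ τ N u0 f u v φ p) {m : ℕ} (hm : m ≤ N) :
    T.normV (u m) ^ 2
        + κ * μ / 2 * τ * ∑ n ∈ Finset.Icc 1 m, T.dgNormV σ (v n) ^ 2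
        + 1 / 2 * τ ^ 2 * T.dgNormS σt (T.auxXi k₂ μ δ v p m) ^ 2
        + 1 / (δ * μ) * τ * T.normS (T.auxS k₂ μ δ v m) ^ 2
      ≤ (∫ x in Ω, ‖u0 x‖ ^ 2)
        + 2 * C ^ 2 / (κ * μ) * τ * ∑ n ∈ Finset.Icc 1 m, ∫ x in Ω, ‖f (n * τ) x‖ ^ 2 := by
  have key : ∀ m ≤ N, T.innerV (u m) (u m)
        + κ * μ / 2 * τ * ∑ n ∈ Finset.Icc 1 m, T.dgNormV σ (v n) ^ 2
        + τ ^ 2 * T.aEllip σt (T.auxXi k₂ μ δ v p m) (T.auxXi k₂ μ δ v p m)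
        + 1 / (δ * μ) * τ * T.innerS (T.auxS k₂ μ δ v m) (T.auxS k₂ μ δ v m)
      ≤ (∫ x in Ω, ‖u0 x‖ ^ 2)
        + 2 * C ^ 2 / (κ * μ) * τ * ∑ n ∈ Finset.Icc 1 m, ∫ x in Ω, ‖f (n * τ) x‖ ^ 2 := by
    intro m
    induction m with
    | zero =>
      intro _
      have h1 := T.innerV_proj_le hΩ hu0 h.u_zero_mem h.u_zero_proj
      -- Zero is written as a multiple so that homogeneity in the first argument makes the form
      -- vanish.
      have h2 : T.auxXi k₂ μ δ v p 0 = (0 : ℝ) • (0 : T.BScal) := by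
        rw [auxXi, auxS_zero, h.p_zero]; simp
      have h3 : T.innerS (T.auxS k₂ μ δ v 0) (T.auxS k₂ μ δ v 0) = 0 := by
        rw [auxS_zero, innerS_eq, map_zero]
      rw [h3, h2, aEllip_smul_left]
      simpa using h1
    | succ m ih =>
      intro hm
      have h1 := ih (by omega)
      have h2 := h.energy_step hd hΩ hk hk' hμ hδ hcoer hR hG hC hM hMt hδκ hτ hf
        (n := m) (by omega)
      rw [Finset.sum_Icc_succ_top (by omega), Finset.sum_Icc_succ_top (by omega), mul_add, mul_add]
      linarith
  have h1 := hell _ (h.auxXi_mem hk hm)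
  have h2 := mul_le_mul_of_nonneg_left h1 (sq_nonneg τ)
  rw [normV_sq, normS_sq]
  have := key m hm
  linarith

end Mesh

/-! ### Norm equivalence for polynomials -/

section PolyNorm

variable {d : ℕ}

theorem integrableOn_closedBall {f : Pt d → ℝ} (hf : Continuous f) (x : Pt d) (r : ℝ) :
    IntegrableOn f (Metric.closedBall x r) :=
  hf.continuousOn.integrableOn_compact (isCompact_closedBall x r)

/-- A linear map on a finite-dimensional space is bounded for every inner product. -/
theorem exists_norm_sq_le_core {V W : Type*} [AddCommGroup V] [Module ℝ V] [FiniteDimensional ℝ V]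
    [NormedAddCommGroup W] [NormedSpace ℝ W] (core : InnerProductSpace.Core ℝ V) (L : V →ₗ[ℝ] W) :
    ∃ C : ℝ, 0 < C ∧ ∀ v, ‖L v‖ ^ 2 ≤ C * core.inner v v := by
  let _ : NormedAddCommGroup V := core.toNormedAddCommGroup
  let _ : InnerProductSpace ℝ V := InnerProductSpace.ofCore core.toCore
  refine ⟨‖LinearMap.toContinuousLinearMap L‖ ^ 2 + 1, by positivity, fun v => ?_⟩
  have h1 : ‖L v‖ ≤ ‖LinearMap.toContinuousLinearMap L‖ * ‖v‖ :=
    (LinearMap.toContinuousLinearMap L).le_opNorm v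
  have h2 : ‖v‖ ^ 2 = core.inner v v := (real_inner_self_eq_norm_sq v).symm
  rw [← h2]
  refine (pow_le_pow_left₀ (norm_nonneg _) h1 2).trans ?_
  nlinarith [sq_nonneg ‖v‖]

/-- On polynomials of bounded degree, the sup norm on a ball is controlled by the `L²` norm on the
unit ball. -/
theorem exists_sup_le_unitBall (d k : ℕ) (R : ℝ) : ∃ C : ℝ, 0 < C ∧ ∀ q : SPoly d,
    q.totalDegree ≤ k → ∀ x ∈ Metric.closedBall (0 : Pt d) R,
      q.val x ^ 2 ≤ C * ∫ y in Metric.closedBall (0 : Pt d) 1, q.val y ^ 2 := by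
  let V := MvPolynomial.restrictTotalDegree (Fin d) ℝ k
  -- The L² product on the unit ball, definite because a polynomial vanishing on an open set is
  -- zero.
  let core : InnerProductSpace.Core ℝ V :=
    { inner := fun p q => ∫ y in Metric.closedBall (0 : Pt d) 1,
        SPoly.val p.1 y * SPoly.val q.1 y
      conj_inner_symm := fun p q => by simp only [mul_comm]; rfl
      re_inner_nonneg := fun p => integral_nonneg fun y => mul_self_nonneg _
      add_left := fun p q r => by
        rw [← integral_add (integrableOn_closedBall (by fun_prop) _ _)
          (integrableOn_closedBall (by fun_prop) _ _)]
        simp [add_mul]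
      smul_left := fun p q a => by
        rw [← integral_const_mul]
        simp [mul_assoc]
      definite := fun p hp => Subtype.ext (SPoly.eq_zero_of_setIntegral_sq
        (isCompact_closedBall _ _) ⟨0, by
          rw [mem_interior_iff_mem_nhds]; exact Metric.closedBall_mem_nhds _ one_pos⟩ hp) }
  have : CompactSpace (Metric.closedBall (0 : Pt d) R) :=
    isCompact_iff_compactSpace.1 (isCompact_closedBall _ _)
  -- Restriction to the larger ball in the sup norm; as a linear map on a finite-dimensional space
  -- it is bounded.
  let L : V →ₗ[ℝ] C(Metric.closedBall (0 : Pt d) R, ℝ) :=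
    { toFun := fun p => ⟨fun x => SPoly.val p.1 x, by fun_prop⟩
      map_add' := fun p q => by ext x; simp
      map_smul' := fun a q => by ext x; simp }
  obtain ⟨C, hC, h⟩ := exists_norm_sq_le_core core L
  refine ⟨C, hC, fun q hq x hx => ?_⟩
  let p : V := ⟨q, (MvPolynomial.mem_restrictTotalDegree _ _ _).2 hq⟩
  have h1 : |q.val x| ≤ ‖L p‖ := (L p).norm_coe_le_norm ⟨x, hx⟩
  have h2 : core.inner p p = ∫ y in Metric.closedBall (0 : Pt d) 1, q.val y ^ 2 := by
    simp only [sq]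
    rfl
  rw [← h2, ← sq_abs]
  exact (pow_le_pow_left₀ (abs_nonneg _) h1 2).trans (h p)

/-- The polynomial `y ↦ q (x₀ + r y)`. -/
noncomputable def SPoly.rescale (q : SPoly d) (x₀ : Pt d) (r : ℝ) : SPoly d :=
  MvPolynomial.aeval (fun i => MvPolynomial.C (x₀ i) + MvPolynomial.C r * MvPolynomial.X i) q

theorem SPoly.val_rescale (q : SPoly d) (x₀ : Pt d) (r : ℝ) (y : Pt d) :
    (q.rescale x₀ r).val y = q.val (x₀ + r • y) := by
  unfold rescale
  induction q using MvPolynomial.induction_on with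
  | C a => simp [val]
  | add p q hp hq => rw [map_add, val_add, val_add, hp, hq]
  | mul_X p i hp => rw [map_mul, val_mul, val_mul, hp]; simp

theorem SPoly.totalDegree_rescale_le (q : SPoly d) (x₀ : Pt d) (r : ℝ) :
    (q.rescale x₀ r).totalDegree ≤ q.totalDegree := by
  have hlin : ∀ i : Fin d, (MvPolynomial.C (x₀ i) + MvPolynomial.C r * MvPolynomial.X i
      : MvPolynomial (Fin d) ℝ).totalDegree ≤ 1 := fun i => by
    refine (MvPolynomial.totalDegree_add _ _).trans (max_le (by simp) ?_)
    refine (MvPolynomial.totalDegree_mul _ _).trans ?_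
    simp
  unfold rescale
  conv_lhs => rw [q.as_sum, map_sum]
  refine MvPolynomial.totalDegree_finsetSum_le fun s hs => ?_
  rw [MvPolynomial.aeval_monomial]
  refine (MvPolynomial.totalDegree_mul _ _).trans ?_
  rw [MvPolynomial.algebraMap_eq, MvPolynomial.totalDegree_C, zero_add]
  refine (MvPolynomial.totalDegree_finsetProd _ _).trans ?_
  refine le_trans (Finset.sum_le_sum fun i _ => ?_) (MvPolynomial.le_totalDegree hs)
  refine (MvPolynomial.totalDegree_pow _ _).trans ?_
  simpa using Nat.mul_le_mul_left (s i) (hlin i)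

/-- The change of variables y ↦ x₀ + ry preserves the degree bound and reduces everything to the
unit ball. The factor r⁻¹ ^ d is its Jacobian, so C does not depend on the centre or the radius. -/
theorem exists_sup_le_ball (d k : ℕ) (R : ℝ) : ∃ C : ℝ, 0 < C ∧ ∀ q : SPoly d,
    q.totalDegree ≤ k → ∀ (x₀ : Pt d) (r : ℝ), 0 < r → ∀ x ∈ Metric.closedBall x₀ (R * r),
      q.val x ^ 2 ≤ C * (r⁻¹ ^ d * ∫ y in Metric.closedBall x₀ r, q.val y ^ 2) := by
  obtain ⟨C, hC, h⟩ := exists_sup_le_unitBall d k R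
  refine ⟨C, hC, fun q hq x₀ r hr x hx => ?_⟩
  have h1 := h (q.rescale x₀ r) ((q.totalDegree_rescale_le x₀ r).trans hq) (r⁻¹ • (x - x₀)) (by
    rw [mem_closedBall_zero_iff, norm_smul, norm_inv, Real.norm_eq_abs, abs_of_pos hr,
      inv_mul_le_iff₀ hr, mul_comm, ← dist_eq_norm]
    exact hx)
  simp only [SPoly.val_rescale] at h1
  rw [smul_inv_smul₀ hr.ne', add_sub_cancel] at h1
  refine h1.trans_eq ?_
  congr 1
  have h2 := Measure.setIntegral_comp_smul_of_pos volume (fun z => q.val (x₀ + z) ^ 2)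
    (Metric.closedBall (0 : Pt d) 1) hr
  rw [h2, smul_closedBall' hr.ne', finrank_euclideanSpace_fin, smul_zero, Real.norm_eq_abs,
    abs_of_pos hr, mul_one, smul_eq_mul, inv_pow]
  congr 1
  have h3 := (measurePreserving_add_left volume x₀).setIntegral_preimage_emb
    (measurableEmbedding_addLeft x₀) (fun z => q.val z ^ 2) (Metric.closedBall x₀ r)
  rw [← h3]
  congr 2
  ext z
  simp

end PolyNorm

/-! ### Shape regular elements -/

section Regular

variable {d : ℕ}

/-- `inscribedDiam` is a supremum, so a ball of diameter 2r greater than half of it is used instead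
of an optimal one. This gives diam K ≤ ρ · 4r. -/
theorem exists_closedBall_of_regular (hd : 0 < d) {K : Set (Pt d)} (hK : IsConvexPolytope K)
    {ρ : ℝ} (hρ : 0 < ρ) (h : Metric.diam K / inscribedDiam K ≤ ρ) :
    ∃ (x₀ : Pt d) (r : ℝ), 0 < r ∧ Metric.closedBall x₀ r ⊆ K ∧ Metric.diam K ≤ 4 * ρ * r := by
  set A := {t : ℝ | ∃ (x : Pt d) (r : ℝ), 0 ≤ r ∧ Metric.closedBall x r ⊆ K ∧ t = 2 * r} with hA
  -- Two antipodal points of a ball in K bound its diameter by that of K. Without boundedness `sSup`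
  -- would have the default value 0.
  have hbdd : BddAbove A := by
    refine ⟨Metric.diam K, ?_⟩
    rintro t ⟨x, r, hr, hsub, rfl⟩
    let w : Pt d := EuclideanSpace.single ⟨0, hd⟩ r
    have hw : ‖w‖ = r := by simp [w, abs_of_nonneg hr]
    have h1 : x + w ∈ K := hsub (by simp [hw])
    have h2 : x - w ∈ K := hsub (by simp [hw])
    have h3 := Metric.dist_le_diam_of_mem hK.2.1 h1 h2
    rw [dist_eq_norm, show x + w - (x - w) = (2 : ℝ) • w by module, norm_smul, hw] at h3
    simpa using h3
  obtain ⟨z, hz⟩ := hK.2.2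
  obtain ⟨ε, hε, hball⟩ := Metric.isOpen_iff.1 isOpen_interior z hz
  have hmem : 2 * (ε / 2) ∈ A := ⟨z, ε / 2, by positivity,
    (Metric.closedBall_subset_ball (by linarith)).trans (hball.trans interior_subset), rfl⟩
  have hpos : 0 < inscribedDiam K := lt_of_lt_of_le (by positivity) (le_csSup hbdd hmem)
  obtain ⟨t, ⟨x, r, hr, hsub, rfl⟩, ht⟩ := exists_lt_of_lt_csSup ⟨_, hmem⟩
    (show inscribedDiam K / 2 < sSup A from half_lt_self hpos)
  refine ⟨x, r, by linarith, hsub, ?_⟩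
  rw [div_le_iff₀ hpos] at h
  nlinarith

end Regular

/-! ### Radial fields, areas and face sizes -/

namespace VPoly

variable {d : ℕ}

/-- The field `x ↦ g(x) (x - c)`. -/
noncomputable def radial (c : Pt d) (g : SPoly d) : VPoly d :=
  fun i => (MvPolynomial.X i - MvPolynomial.C (c i)) * g

theorem val_radial (c : Pt d) (g : SPoly d) (x : Pt d) :
    (radial c g).val x = g.val x • (x - c) := by
  ext i
  simp [radial, val, mul_comm]

theorem val_div_radial (c : Pt d) (g : SPoly d) (x : Pt d) :
    (radial c g).div.val x = d * g.val x + ⟪g.grad x, x - c⟫ := by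
  have h : ((d : SPoly d)).val x = d := by simp [SPoly.val]
  simp [radial, div, SPoly.val_sum, Finset.sum_add_distrib, PiLp.inner_apply, SPoly.grad, add_comm, h]

theorem norm_gradMul_sq_le (v : VPoly d) (x w : Pt d) :
    ‖v.gradMul x w‖ ^ 2 ≤ ‖w‖ ^ 2 * v.gradDot v x := by
  rw [EuclideanSpace.norm_sq_eq, gradDot, Finset.mul_sum]
  refine Finset.sum_le_sum fun i _ => ?_
  rw [real_inner_self_eq_norm_sq, mul_comm, ← mul_pow, Real.norm_eq_abs]
  exact pow_le_pow_left₀ (abs_nonneg _) (abs_real_inner_le_norm _ _) 2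

end VPoly

namespace Mesh

variable {d : ℕ} {Ω : Set (Pt d)} (T : Mesh Ω)

/-- The ball contains x₀ + r n, which still satisfies the constraint ⟪n, ·⟫ ≤ c that is active on
the facet. -/
theorem inner_sub_outNormal_ge {E : T.elements} {e : T.faces} (he : e ∈ T.facesOf E) {x₀ : Pt d}
    {r : ℝ} (hr : 0 ≤ r) (hball : Metric.closedBall x₀ r ⊆ (E : Set (Pt d))) {x : Pt d}
    (hx : x ∈ (e : Set (Pt d))) : r ≤ ⟪x - x₀, T.outNormal E e⟫ := by
  have hf := T.isFacet_outNormal he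
  obtain ⟨c, hc, hec⟩ := hf.exists_eq
  rw [hec] at hx
  have h1 : ⟪T.outNormal E e, x⟫ = c := hx.2
  have h2 := hc (x₀ + r • T.outNormal E e) (hball (by simp [norm_smul, hf.1, abs_of_nonneg hr]))
  simp only [inner_add_right, inner_smul_right, real_inner_self_eq_norm_sq, hf.1] at h2
  rw [real_inner_comm, inner_sub_right, h1]
  linarith

/-- The basic trace inequality, for a nonnegative polynomial. -/
theorem sum_faceInt_le (hΩ : IsPolyhedralDomain Ω) (E : T.elements) {x₀ : Pt d} {r : ℝ}
    (hr : 0 ≤ r) (hball : Metric.closedBall x₀ r ⊆ (E : Set (Pt d))) {g : SPoly d}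
    (hg : ∀ x, 0 ≤ g.val x) :
    r * ∑ e ∈ T.facesOf E, T.faceInt e g.val
      ≤ ∫ x in (E : Set (Pt d)), (d * g.val x + ⟪g.grad x, x - x₀⟫) := by
  have h := T.integral_div hΩ E (VPoly.radial x₀ g)
  simp only [VPoly.val_div_radial, VPoly.val_radial, real_inner_smul_left] at h
  rw [h, Finset.mul_sum]
  refine Finset.sum_le_sum fun e he => ?_
  rw [← T.faceInt_mul]
  refine T.faceInt_mono e (by fun_prop) (by fun_prop) fun x hx => ?_
  rw [mul_comm]
  exact mul_le_mul_of_nonneg_left (T.inner_sub_outNormal_ge he hr hball hx) (hg x)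

theorem elem_subset_closedBall (E : T.elements) {x₀ : Pt d} {r : ℝ} (hr : 0 ≤ r)
    (hball : Metric.closedBall x₀ r ⊆ (E : Set (Pt d))) :
    (E : Set (Pt d)) ⊆ Metric.closedBall x₀ (Metric.diam (E : Set (Pt d))) := fun _ hx =>
  Metric.dist_le_diam_of_mem (T.polytope E).2.1 hx (hball (Metric.mem_closedBall_self hr))

/-- The trace inequality for g = 1, with the volume of E bounded by that of a ball whose radius is
diam E. -/
theorem sum_area_le (hΩ : IsPolyhedralDomain Ω) (E : T.elements) {x₀ : Pt d} {r : ℝ}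
    (hr : 0 < r) (hball : Metric.closedBall x₀ r ⊆ (E : Set (Pt d))) :
    ∑ e ∈ T.facesOf E, (μHE[d - 1] : Measure (Pt d)).real (e : Set (Pt d))
      ≤ d * volume.real (Metric.ball (0 : Pt d) 1) * Metric.diam (E : Set (Pt d)) ^ d / r := by
  have h := T.sum_faceInt_le hΩ E hr.le hball (g := 1) (fun x => by simp)
  have h1 : ∀ e : T.faces, T.faceInt e (1 : SPoly d).val
      = (μHE[d - 1] : Measure (Pt d)).real (e : Set (Pt d)) := fun e => by
    simp [faceInt]
  have h2 : ∫ x in (E : Set (Pt d)), (d * (1 : SPoly d).val x + ⟪(1 : SPoly d).grad x, x - x₀⟫)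
      = d * volume.real (E : Set (Pt d)) := by
    simp [SPoly.grad_one, mul_comm]
  simp only [h1, h2] at h
  rw [le_div_iff₀ hr, mul_comm]
  refine h.trans ?_
  rw [mul_assoc]
  refine mul_le_mul_of_nonneg_left ?_ (by positivity)
  refine (measureReal_mono (T.elem_subset_closedBall E hr.le hball)
    (isCompact_closedBall _ _).measure_lt_top.ne).trans_eq ?_
  rw [Measure.addHaar_real_closedBall _ _ Metric.diam_nonneg, finrank_euclideanSpace_fin, mul_comm]

/-- The face size is bounded by the diameter of a shape regular element. -/
theorem faceSize_le (hd : 1 < d) (hΩ : IsPolyhedralDomain Ω) {E : T.elements} {e : T.faces}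
    (he : e ∈ T.facesOf E) {x₀ : Pt d} {r c : ℝ} (hr : 0 < r)
    (hball : Metric.closedBall x₀ r ⊆ (E : Set (Pt d)))
    (hc : Metric.diam (E : Set (Pt d)) ≤ c * r) :
    T.faceSize e ≤ (d * volume.real (Metric.ball (0 : Pt d) 1) * c) ^ (1 / ((d : ℝ) - 1))
      * Metric.diam (E : Set (Pt d)) := by
  set h := Metric.diam (E : Set (Pt d)) with hh
  set ω := volume.real (Metric.ball (0 : Pt d) 1) with hω
  have hh0 : 0 ≤ h := Metric.diam_nonneg
  have hc0 : 0 ≤ c := by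
    by_contra hneg
    nlinarith
  have h1 : (μHE[d - 1] : Measure (Pt d)).real (e : Set (Pt d)) ≤ d * ω * c * h ^ (d - 1) := by
    refine (Finset.single_le_sum (f := fun e : T.faces =>
      (μHE[d - 1] : Measure (Pt d)).real (e : Set (Pt d))) (fun _ _ => measureReal_nonneg)
      he).trans ((T.sum_area_le hΩ E hr hball).trans ?_)
    rw [div_le_iff₀ hr, ← hh, ← hω]
    calc (d : ℝ) * ω * h ^ d = d * ω * h ^ (d - 1) * h := by
          rw [mul_assoc _ _ h, ← pow_succ, Nat.sub_add_cancel hd.le]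
      _ ≤ d * ω * h ^ (d - 1) * (c * r) :=
          mul_le_mul_of_nonneg_left hc (by positivity)
      _ = d * ω * c * h ^ (d - 1) * r := by ring
  have hd1 : (d : ℝ) - 1 = ((d - 1 : ℕ) : ℝ) := by
    rw [Nat.cast_sub hd.le, Nat.cast_one]
  unfold faceSize
  refine (Real.rpow_le_rpow measureReal_nonneg h1 ?_).trans_eq ?_
  · rw [hd1]; positivity
  · rw [Real.mul_rpow (by positivity) (by positivity)]
    congr 1
    rw [hd1, one_div]
    exact Real.pow_rpow_inv_natCast hh0 (by omega)

end Mesh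

namespace Mesh

variable {d : ℕ} {Ω : Set (Pt d)} (T : Mesh Ω)

/-! ### Trace inequalities on shape regular elements -/

/-- The discrete trace inequality, with weights given by the sizes of the faces. -/
theorem exists_discrete_trace (hd : 1 < d) (hΩ : IsPolyhedralDomain Ω) {ρ : ℝ} (hρ : 0 < ρ)
    (k : ℕ) : ∃ K : ℝ, 0 < K ∧ ∀ T : Mesh Ω, T.IsRegular ρ → ∀ (E : T.elements) (q : SPoly d),
      q.totalDegree ≤ k →
        ∑ e ∈ T.facesOf E, T.faceSize e * T.faceInt e (fun x => q.val x ^ 2)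
          ≤ K * ∫ x in (E : Set (Pt d)), q.val x ^ 2 := by
  obtain ⟨C, hC, hsup⟩ := exists_sup_le_ball d k (4 * ρ)
  set ω := volume.real (Metric.ball (0 : Pt d) 1) with hω
  have hω0 : 0 < ω := ENNReal.toReal_pos (Metric.measure_ball_pos _ _ one_pos).ne'
    measure_ball_lt_top.ne
  have hd0 : (0 : ℝ) < d := by exact_mod_cast (by omega : 0 < d)
  set c₁ := (d * ω * (4 * ρ)) ^ (1 / ((d : ℝ) - 1)) with hc₁
  have hc₁0 : 0 < c₁ := Real.rpow_pos_of_pos (by positivity) _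
  -- Here c₁ comes from the face sizes, dω from the total area and C from the sup bound on E, which
  -- lies in the ball of radius 4ρr. All lengths combine to (h/r)^(d+1) ≤ (4ρ)^(d+1).
  refine ⟨c₁ * (d * ω) * C * (4 * ρ) ^ (d + 1), by positivity, fun T hT E q hq => ?_⟩
  obtain ⟨x₀, r, hr, hball, hh⟩ := exists_closedBall_of_regular (by omega) (T.polytope E) hρ
    (hT E E.2)
  set h := Metric.diam (E : Set (Pt d)) with hhdef
  have hh0 : 0 ≤ h := Metric.diam_nonneg
  set I := ∫ x in (E : Set (Pt d)), q.val x ^ 2 with hI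
  have hI0 : 0 ≤ I := integral_nonneg fun x => sq_nonneg _
  set s := C * (r⁻¹ ^ d * I) with hs
  have hs0 : 0 ≤ s := by positivity
  have hsupE : ∀ x ∈ (E : Set (Pt d)), q.val x ^ 2 ≤ s := fun x hx => by
    refine (hsup q hq x₀ r hr x (Metric.closedBall_subset_closedBall hh
      (T.elem_subset_closedBall E hr.le hball hx))).trans ?_
    refine mul_le_mul_of_nonneg_left (mul_le_mul_of_nonneg_left ?_ (by positivity)) hC.le
    exact setIntegral_mono_set (T.integrableOn_elem E (by fun_prop))
      (.of_forall fun x => sq_nonneg _) (LE.le.eventuallyLE hball)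
  have hface : ∀ e ∈ T.facesOf E, T.faceSize e * T.faceInt e (fun x => q.val x ^ 2)
      ≤ c₁ * h * s * (μHE[d - 1] : Measure (Pt d)).real (e : Set (Pt d)) := by
    intro e he
    have hsub : (e : Set (Pt d)) ⊆ E := by
      obtain ⟨c, -, hec⟩ := (T.isFacet_outNormal he).exists_eq
      exact hec ▸ inter_subset_left
    have h1 : T.faceInt e (fun x => q.val x ^ 2)
        ≤ s * (μHE[d - 1] : Measure (Pt d)).real (e : Set (Pt d)) := by
      refine (T.faceInt_mono e (g := fun _ => s) (by fun_prop) continuous_const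
        fun x hx => hsupE x (hsub hx)).trans_eq ?_
      simp [faceInt, mul_comm]
    calc T.faceSize e * T.faceInt e (fun x => q.val x ^ 2)
        ≤ (c₁ * h) * (s * (μHE[d - 1] : Measure (Pt d)).real (e : Set (Pt d))) :=
          mul_le_mul (T.faceSize_le hd hΩ he hr hball hh) h1
            (T.faceInt_nonneg e fun x => sq_nonneg _) (by positivity)
      _ = _ := by ring
  refine (Finset.sum_le_sum hface).trans ?_
  rw [← Finset.mul_sum]
  refine (mul_le_mul_of_nonneg_left (T.sum_area_le hΩ E hr hball) (by positivity)).trans ?_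
  rw [← hω, ← hhdef, hs]
  have h2 : c₁ * h * (C * (r⁻¹ ^ d * I)) * (d * ω * h ^ d / r)
      = c₁ * (d * ω) * C * (h / r) ^ (d + 1) * I := by
    rw [div_pow, pow_succ, pow_succ, inv_pow]
    field_simp
  rw [h2]
  have h3 : h / r ≤ 4 * ρ := (div_le_iff₀ hr).2 hh
  gcongr

/-- The trace inequality for vector fields, with a constant that does not depend on the degree. -/
theorem exists_continuous_trace (hd : 1 < d) (hΩ : IsPolyhedralDomain Ω) {ρ : ℝ} (hρ : 0 < ρ)
    {H : ℝ} (hH : ∀ (T : Mesh Ω) (E : T.elements), Metric.diam (E : Set (Pt d)) ≤ H) :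
    ∃ K : ℝ, 0 < K ∧ ∀ T : Mesh Ω, T.IsRegular ρ → ∀ (E : T.elements) (v : VPoly d),
        ∑ e ∈ T.facesOf E, T.faceSize e * T.faceInt e (fun x => ‖v.val x‖ ^ 2)
          ≤ K * ∫ x in (E : Set (Pt d)), (‖v.val x‖ ^ 2 + v.gradDot v x) := by
  set ω := volume.real (Metric.ball (0 : Pt d) 1) with hω
  have hω0 : 0 < ω := ENNReal.toReal_pos (Metric.measure_ball_pos _ _ one_pos).ne'
    measure_ball_lt_top.ne
  have hd0 : (0 : ℝ) < d := by exact_mod_cast (by omega : 0 < d)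
  set c₁ := (d * ω * (4 * ρ)) ^ (1 / ((d : ℝ) - 1)) with hc₁
  have hc₁0 : 0 < c₁ := Real.rpow_pos_of_pos (by positivity) _
  -- The radial field is applied to |v|², whose gradient term is at most |v|² + H²|∇v|². No norm
  -- equivalence is used, hence the independence of the degree.
  refine ⟨c₁ * (4 * ρ) * (d + 1 + H ^ 2), by positivity, fun T hT E v => ?_⟩
  obtain ⟨x₀, r, hr, hball, hh⟩ := exists_closedBall_of_regular (by omega) (T.polytope E) hρ
    (hT E E.2)
  have hhH := hH T E
  set h := Metric.diam (E : Set (Pt d)) with hhdef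
  have hh0 : 0 ≤ h := Metric.diam_nonneg
  have hg0 : ∀ x, 0 ≤ v.gradDot v x := fun x => Finset.sum_nonneg fun i _ => real_inner_self_nonneg
  have hval : ∀ x, v.sq.val x = ‖v.val x‖ ^ 2 := fun x => by
    rw [VPoly.val_sq, real_inner_self_eq_norm_sq]
  have htr := T.sum_faceInt_le hΩ E hr.le hball (g := v.sq) fun x => by rw [hval]; positivity
  have h1 : ∑ e ∈ T.facesOf E, T.faceSize e * T.faceInt e (fun x => ‖v.val x‖ ^ 2)
      ≤ c₁ * h * ∑ e ∈ T.facesOf E, T.faceInt e v.sq.val := by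
    rw [Finset.mul_sum]
    refine Finset.sum_le_sum fun e he => ?_
    rw [show v.sq.val = fun x => ‖v.val x‖ ^ 2 from funext hval]
    exact mul_le_mul_of_nonneg_right (T.faceSize_le hd hΩ he hr hball hh)
      (T.faceInt_nonneg e fun x => sq_nonneg _)
  have hcont : Continuous fun x => ‖v.val x‖ ^ 2 + v.gradDot v x := by fun_prop
  have h2 : ∫ x in (E : Set (Pt d)), (d * v.sq.val x + ⟪v.sq.grad x, x - x₀⟫)
      ≤ (d + 1 + H ^ 2) * ∫ x in (E : Set (Pt d)), (‖v.val x‖ ^ 2 + v.gradDot v x) := by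
    rw [← integral_const_mul]
    refine setIntegral_mono_on (T.integrableOn_elem E (by fun_prop))
      (T.integrableOn_elem E (by fun_prop)) (T.polytope E).measurableSet fun x hx => ?_
    rw [hval, VPoly.inner_grad_sq]
    have h3 : ‖x - x₀‖ ≤ H := by
      rw [← dist_eq_norm]
      exact (T.elem_subset_closedBall E hr.le hball hx).trans hhH
    have h4 := VPoly.norm_gradMul_sq_le v x (x - x₀)
    have h5 : ‖x - x₀‖ ^ 2 * v.gradDot v x ≤ H ^ 2 * v.gradDot v x :=
      mul_le_mul_of_nonneg_right (pow_le_pow_left₀ (norm_nonneg _) h3 2) (hg0 x)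
    have h6 := real_inner_le_norm (v.gradMul x (x - x₀)) (v.val x)
    nlinarith [sq_nonneg (‖v.gradMul x (x - x₀)‖ - ‖v.val x‖), hg0 x, sq_nonneg H,
      mul_nonneg (sq_nonneg H) (sq_nonneg ‖v.val x‖), mul_nonneg hd0.le (hg0 x)]
  set I := ∫ x in (E : Set (Pt d)), (‖v.val x‖ ^ 2 + v.gradDot v x) with hI
  have hI0 : 0 ≤ I := integral_nonneg fun x => add_nonneg (sq_nonneg _) (hg0 x)
  set A₀ := ∑ e ∈ T.facesOf E, T.faceInt e v.sq.val with hA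
  have hA0 : 0 ≤ A₀ := Finset.sum_nonneg fun e _ =>
    T.faceInt_nonneg e fun x => by rw [hval]; positivity
  refine h1.trans ?_
  calc c₁ * h * A₀ ≤ c₁ * (4 * ρ * r) * A₀ := by gcongr
    _ = c₁ * (4 * ρ) * (r * A₀) := by ring
    _ ≤ c₁ * (4 * ρ) * ((d + 1 + H ^ 2) * I) := by
        have := htr.trans h2
        gcongr
    _ = _ := by ring

/-- Collecting face contributions element by element. -/
theorem sum_faces_le (A : T.faces → Pt d → ℝ) (F : T.elements → Pt d → ℝ)
    (hA : ∀ e, Continuous (A e)) (hF : ∀ E, Continuous (F E))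
    (h : ∀ e x, A e x ≤ F (T.elt₁ e) x + (T.elt₂ e).elim 0 fun E => F E x) :
    ∑ e : T.faces, T.faceSize e * T.faceInt e (A e)
      ≤ ∑ E : T.elements, ∑ e ∈ T.facesOf E, T.faceSize e * T.faceInt e (F E) := by
  rw [T.sum_facesOf fun E e => T.faceSize e * T.faceInt e (F E)]
  refine Finset.sum_le_sum fun e _ => ?_
  have he := h e
  have hpos := (T.faceSize_pos e).le
  rcases hE : T.elt₂ e with _ | E
  · simp only [hE, Option.elim, add_zero] at he ⊢
    exact mul_le_mul_of_nonneg_left (T.faceInt_mono e (hA e) (hF _) fun x _ => he x) hpos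
  · simp only [hE, Option.elim] at he ⊢
    rw [← mul_add, ← T.faceInt_add e (hF _) (hF _)]
    exact mul_le_mul_of_nonneg_left
      (T.faceInt_mono e (hA e) ((hF _).add (hF _)) fun x _ => he x) hpos

theorem avgS_sq_le (q : T.BScal) (e : T.faces) (x : Pt d) :
    T.avgS e q x ^ 2
      ≤ (q (T.elt₁ e)).val x ^ 2 + (T.elt₂ e).elim 0 fun E => (q E).val x ^ 2 := by
  rcases hE : T.elt₂ e with _ | E
  · simp [avgS, T.avg_of_none e _ hE]
  · simp only [avgS, T.avg_of_some e _ hE, Option.elim, smul_eq_mul]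
    nlinarith [sq_nonneg ((q (T.elt₁ e)).val x - (q E).val x), sq_nonneg ((q (T.elt₁ e)).val x),
      sq_nonneg ((q E).val x)]

theorem norm_avgV_sq_le (v : T.BVec) (e : T.faces) (x : Pt d) :
    ‖T.avgV e v x‖ ^ 2
      ≤ ‖(v (T.elt₁ e)).val x‖ ^ 2 + (T.elt₂ e).elim 0 fun E => ‖(v E).val x‖ ^ 2 := by
  rcases hE : T.elt₂ e with _ | E
  · simp [avgV, T.avg_of_none e _ hE]
  · simp only [avgV, T.avg_of_some e _ hE, Option.elim, norm_smul, mul_pow]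
    have h1 := parallelogram_law_with_norm ℝ ((v (T.elt₁ e)).val x) ((v E).val x)
    have h2 : ‖(1 / 2 : ℝ)‖ ^ 2 = 1 / 4 := by norm_num
    rw [h2]
    nlinarith [mul_self_nonneg ‖(v (T.elt₁ e)).val x - (v E).val x‖,
      sq_nonneg ‖(v (T.elt₁ e)).val x‖, sq_nonneg ‖(v E).val x‖]

/-! ### Uniform constants for the lifts -/

/-- Young's inequality on a face. -/
theorem faceInt_young (e : T.faces) {f g : Pt d → ℝ} (hf : Continuous f) (hg : Continuous g)
    {a : ℝ} (ha : 0 < a) :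
    T.faceInt e (fun x => f x * g x) ≤ a / 2 * (T.faceSize e * T.faceInt e fun x => f x ^ 2)
      + 1 / (2 * a) * ((T.faceSize e)⁻¹ * T.faceInt e fun x => g x ^ 2) := by
  have hh := T.faceSize_pos e
  rw [← mul_assoc, ← mul_assoc, ← T.faceInt_mul, ← T.faceInt_mul,
    ← T.faceInt_add e (by fun_prop) (by fun_prop)]
  refine T.faceInt_mono e (by fun_prop) (by fun_prop) fun x _ => ?_
  have h1 : a / 2 * T.faceSize e * f x ^ 2 + 1 / (2 * a) * (T.faceSize e)⁻¹ * g x ^ 2 - f x * g x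
      = a / 2 * T.faceSize e * (f x - (a * T.faceSize e)⁻¹ * g x) ^ 2 := by
    field_simp
    ring
  have h2 : 0 ≤ a / 2 * T.faceSize e * (f x - (a * T.faceSize e)⁻¹ * g x) ^ 2 := by positivity
  linarith

/-- Test the lift with itself and apply Young's inequality with weight K⁻¹, K being the discrete
trace constant: half of ‖R‖² is absorbed, leaving ‖R‖² ≤ KJ. The degree k₁ plays no role, since only
the lift, of degree k₂, meets the trace inequality. -/
theorem exists_isLiftConstR (hd : 1 < d) (hΩ : IsPolyhedralDomain Ω) {ρ : ℝ} (hρ : 0 < ρ)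
    (k₂ : ℕ) : ∃ M : ℝ, ∀ T : Mesh Ω, T.IsRegular ρ → ∀ k₁, T.IsLiftConstR k₁ k₂ M := by
  obtain ⟨K, hK, htr⟩ := exists_discrete_trace hd hΩ hρ k₂
  refine ⟨√K, fun T hT k₁ => ⟨Real.sqrt_pos.2 hK, fun θ _ => ?_⟩⟩
  rw [← Real.sqrt_mul hK.le, normS]
  refine Real.sqrt_le_sqrt ?_
  set R := T.Rh k₂ θ with hR
  have hmem := T.Rh_mem k₂ θ
  have h1 := T.innerS_Rh k₂ θ hmem
  rw [← hR] at h1 hmem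
  set J := ∑ e : T.faces, (T.faceSize e)⁻¹ * T.faceInt e fun x => ‖T.jumpV e θ x‖ ^ 2 with hJ
  have h2 : ∑ e : T.faces, T.faceSize e * T.faceInt e (fun x => T.avgS e R x ^ 2)
      ≤ K * T.innerS R R := by
    refine (T.sum_faces_le _ (fun E x => (R E).val x ^ 2) (fun e => by fun_prop)
      (fun E => by fun_prop) fun e x => T.avgS_sq_le R e x).trans ?_
    rw [innerS, Finset.mul_sum]
    refine Finset.sum_le_sum fun E _ => (htr T hT E (R E) (hmem E)).trans_eq ?_
    simp only [sq]
  have h3 : T.innerS R R ≤ K⁻¹ / 2 * ∑ e : T.faces, T.faceSize e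
      * T.faceInt e (fun x => T.avgS e R x ^ 2) + 1 / (2 * K⁻¹) * J := by
    rw [h1, hJ, Finset.mul_sum, Finset.mul_sum, ← Finset.sum_add_distrib]
    refine Finset.sum_le_sum fun e _ => ?_
    refine (T.faceInt_young e (f := T.avgS e R) (g := fun x => ⟪T.jumpV e θ x, T.normal e⟫)
      (by fun_prop) (by fun_prop) (inv_pos.2 hK)).trans ?_
    have hh := T.faceSize_pos e
    gcongr
    refine T.faceInt_mono e (by fun_prop) (by fun_prop) fun x _ => ?_
    have h4 := abs_real_inner_le_norm (T.jumpV e θ x) (T.normal e)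
    rw [(T.facet₁ e).1, mul_one] at h4
    rw [← sq_abs]
    exact pow_le_pow_left₀ (abs_nonneg _) h4 2
  have h4 := mul_le_mul_of_nonneg_left h2 (show 0 ≤ K⁻¹ / 2 by positivity)
  have h5 : K⁻¹ / 2 * (K * T.innerS R R) = T.innerS R R / 2 := by field_simp
  have h6 : 1 / (2 * K⁻¹) * J = K * J / 2 := by field_simp
  linarith

theorem sum_interiorFaces_le {F : T.faces → ℝ} (hF : ∀ e, 0 ≤ F e) :
    ∑ e ∈ T.interiorFaces, F e ≤ ∑ e, F e :=
  Finset.sum_le_sum_of_subset_of_nonneg (Finset.subset_univ _) fun e _ _ => hF e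

theorem exists_isLiftConstG (hd : 1 < d) (hΩ : IsPolyhedralDomain Ω) {ρ : ℝ} (hρ : 0 < ρ)
    (k₁ : ℕ) : ∃ M : ℝ, ∀ T : Mesh Ω, T.IsRegular ρ → ∀ k₂, T.IsLiftConstG k₁ k₂ M := by
  obtain ⟨K, hK, htr⟩ := exists_discrete_trace hd hΩ hρ k₁
  refine ⟨√K, fun T hT k₂ => ⟨Real.sqrt_pos.2 hK, fun q _ => ?_⟩⟩
  rw [← Real.sqrt_mul hK.le, normV]
  refine Real.sqrt_le_sqrt ?_
  set G := T.Gh k₁ q with hG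
  have hmem := T.Gh_mem k₁ q
  have h1 := T.innerV_Gh k₁ q hmem
  rw [← hG] at h1 hmem
  set J := ∑ e ∈ T.interiorFaces, (T.faceSize e)⁻¹ * T.faceInt e fun x => (T.jumpS e q x) ^ 2
    with hJ
  -- The scalar trace inequality, component by component.
  have helem : ∀ E : T.elements,
      ∑ e ∈ T.facesOf E, T.faceSize e * T.faceInt e (fun x => ‖(G E).val x‖ ^ 2)
        ≤ K * ∫ x in (E : Set (Pt d)), ⟪(G E).val x, (G E).val x⟫ := fun E => by
    have hl : ∀ e : T.faces, T.faceSize e * T.faceInt e (fun x => ‖(G E).val x‖ ^ 2)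
        = ∑ i, T.faceSize e * T.faceInt e (fun x => SPoly.val (G E i) x ^ 2) := fun e => by
      rw [← Finset.mul_sum]
      congr 1
      simp only [faceInt]
      rw [← integral_finsetSum _ fun i _ => T.integrableOn_face e (by fun_prop)]
      simp [EuclideanSpace.norm_sq_eq, VPoly.val]
    have hr : ∫ x in (E : Set (Pt d)), ⟪(G E).val x, (G E).val x⟫
        = ∑ i, ∫ x in (E : Set (Pt d)), SPoly.val (G E i) x ^ 2 := by
      rw [← integral_finsetSum _ fun i _ => T.integrableOn_elem E (by fun_prop)]
      simp [EuclideanSpace.norm_sq_eq, VPoly.val]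
    rw [hr, Finset.sum_congr rfl fun e _ => hl e, Finset.sum_comm, Finset.mul_sum]
    exact Finset.sum_le_sum fun i _ => htr T hT E (G E i) (hmem E i)
  have h2 : ∑ e : T.faces, T.faceSize e * T.faceInt e (fun x => ‖T.avgV e G x‖ ^ 2)
      ≤ K * T.innerV G G := by
    refine (T.sum_faces_le _ (fun E x => ‖(G E).val x‖ ^ 2) (fun e => by fun_prop)
      (fun E => by fun_prop) fun e x => T.norm_avgV_sq_le G e x).trans ?_
    rw [innerV, Finset.mul_sum]
    exact Finset.sum_le_sum fun E _ => helem E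
  have h3 : T.innerV G G ≤ K⁻¹ / 2 * ∑ e : T.faces, T.faceSize e
      * T.faceInt e (fun x => ‖T.avgV e G x‖ ^ 2) + 1 / (2 * K⁻¹) * J := by
    have h4 : T.innerV G G ≤ K⁻¹ / 2 * ∑ e ∈ T.interiorFaces, T.faceSize e
        * T.faceInt e (fun x => ‖T.avgV e G x‖ ^ 2) + 1 / (2 * K⁻¹) * J := by
      rw [h1, hJ, Finset.mul_sum, Finset.mul_sum, ← Finset.sum_add_distrib]
      refine Finset.sum_le_sum fun e _ => ?_
      refine (T.faceInt_young e (f := fun x => ⟪T.avgV e G x, T.normal e⟫) (g := T.jumpS e q)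
        (by fun_prop) (by fun_prop) (inv_pos.2 hK)).trans ?_
      have hh := T.faceSize_pos e
      gcongr
      refine T.faceInt_mono e (by fun_prop) (by fun_prop) fun x _ => ?_
      have h4 := abs_real_inner_le_norm (T.avgV e G x) (T.normal e)
      rw [(T.facet₁ e).1, mul_one] at h4
      rw [← sq_abs]
      exact pow_le_pow_left₀ (abs_nonneg _) h4 2
    -- The sum of averages may be enlarged to all faces, while J keeps only interior ones.
    refine h4.trans (add_le_add_left (mul_le_mul_of_nonneg_left ?_ (by positivity)) _)
    exact T.sum_interiorFaces_le fun e => mul_nonneg (T.faceSize_pos e).le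
      (T.faceInt_nonneg e fun x => sq_nonneg _)
  have h4 := mul_le_mul_of_nonneg_left h2 (show 0 ≤ K⁻¹ / 2 by positivity)
  have h5 : K⁻¹ / 2 * (K * T.innerV G G) = T.innerV G G / 2 := by field_simp
  have h6 : 1 / (2 * K⁻¹) * J = K * J / 2 := by field_simp
  linarith

/-! ### The discrete Poincaré inequality -/

/-- |a|² - |b|² = (a + b)·(a - b) is twice average times jump. On a boundary face the factor 2 is
not needed. -/
theorem abs_jump_sq_le (v : T.BVec) (e : T.faces) (x : Pt d) :
    |T.jump e fun E => (v E).sq.val x| ≤ 2 * (‖T.avgV e v x‖ * ‖T.jumpV e v x‖) := by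
  have hval : ∀ E, (v E).sq.val x = ⟪(v E).val x, (v E).val x⟫ := fun E => VPoly.val_sq _ _
  rcases hE : T.elt₂ e with _ | E
  · simp only [avgV, jumpV, T.jump_of_none e _ hE, T.avg_of_none e _ hE, hval,
      real_inner_self_eq_norm_sq]
    rw [abs_of_nonneg (sq_nonneg _)]
    nlinarith [sq_nonneg ‖(v (T.elt₁ e)).val x‖]
  · simp only [avgV, jumpV, T.jump_of_some e _ hE, T.avg_of_some e _ hE, hval]
    set a := (v (T.elt₁ e)).val x
    set b := (v E).val x
    have h1 : ⟪a, a⟫ - ⟪b, b⟫ = 2 * ⟪(1 / 2 : ℝ) • (a + b), a - b⟫ := by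
      rw [inner_smul_left, inner_add_left, inner_sub_right, inner_sub_right, real_inner_comm a b]
      simp
    rw [h1, abs_mul, abs_two]
    exact mul_le_mul_of_nonneg_left (abs_real_inner_le_norm _ _) zero_le_two

/-- The divergence of |θ|² x is d|θ|² plus a term controlled by |θ||∇θ|, since x is bounded on Ω.
Its total flux involves only [|θ|²], bounded by 2|{θ}||[θ]|, and the average is absorbed through the
trace inequality. -/
theorem exists_isPoincareConst (hd : 1 < d) (hΩ : IsPolyhedralDomain Ω) {ρ : ℝ} (hρ : 0 < ρ)
    {σ : ℝ} (hσ : 0 < σ) :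
    ∃ C : ℝ, ∀ T : Mesh Ω, T.IsRegular ρ → ∀ k, T.IsPoincareConst k σ C := by
  obtain ⟨D, hD, hΩD⟩ := hΩ.isBounded.closure.subset_closedBall_lt 0 (0 : Pt d)
  have hsubD : ∀ (T : Mesh Ω) (E : T.elements), (E : Set (Pt d)) ⊆ Metric.closedBall 0 D :=
    fun T E => ((subset_biUnion_of_mem (u := id) E.2).trans T.cover.subset).trans hΩD
  obtain ⟨K, hK, htr⟩ := exists_continuous_trace hd hΩ hρ (H := 2 * D) fun T E =>
    Metric.diam_le_of_subset_closedBall hD.le (hsubD T E)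
  have hd0 : (1 : ℝ) ≤ d := by exact_mod_cast hd.le
  -- The estimates below combine to ¾X - 4D²Y ≤ ¼(X + Y) + 4KD²J, that is X ≤ (8D² + ½)Y + 8KD²J. B
  -- exceeds the coefficient of Y as well as that of σJ.
  set B := 8 * D ^ 2 + 1 / 2 + 8 * K * D ^ 2 / σ with hB
  have hB0 : 0 < B := by positivity
  refine ⟨√B, fun T hT k => ⟨Real.sqrt_pos.2 hB0, fun θ _ => ?_⟩⟩
  rw [normV, dgNormV, ← Real.sqrt_mul hB0.le]
  refine Real.sqrt_le_sqrt ?_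
  have hval : ∀ (E : T.elements) x, (θ E).sq.val x = ⟪(θ E).val x, (θ E).val x⟫ :=
    fun E x => VPoly.val_sq _ _
  have hg0 : ∀ (E : T.elements) x, 0 ≤ (θ E).gradDot (θ E) x := fun E x =>
    Finset.sum_nonneg fun i _ => real_inner_self_nonneg
  set X := T.innerV θ θ with hX
  set Y := ∑ E : T.elements, ∫ x in (E : Set (Pt d)), (θ E).gradDot (θ E) x with hY
  set J := ∑ e : T.faces, (T.faceSize e)⁻¹ * T.faceInt e fun x => ‖T.jumpV e θ x‖ ^ 2 with hJ
  have hX0 : 0 ≤ X := T.innerV_self_nonneg θ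
  have hY0 : 0 ≤ Y := Finset.sum_nonneg fun E _ => integral_nonneg (hg0 E)
  have hJ0 : 0 ≤ J := Finset.sum_nonneg fun e _ =>
    mul_nonneg (inv_nonneg.2 (T.faceSize_pos e).le) (T.faceInt_nonneg e fun x => sq_nonneg _)
  have hJσ : ∑ e : T.faces, σ / T.faceSize e * T.faceInt e (fun x => ‖T.jumpV e θ x‖ ^ 2)
      = σ * J := by
    rw [hJ, Finset.mul_sum]
    simp only [div_eq_mul_inv, mul_assoc]
  rw [hJσ]
  -- the divergence theorem for `|θ|² x`
  have hdiv := T.sum_integral_div hΩ fun E => VPoly.radial 0 (θ E).sq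
  have hvol : 3 / 4 * X - 4 * D ^ 2 * Y ≤ ∑ E : T.elements,
      ∫ x in (E : Set (Pt d)), (VPoly.radial 0 (θ E).sq).div.val x := by
    rw [hX, hY, innerV, Finset.mul_sum, Finset.mul_sum, ← Finset.sum_sub_distrib]
    refine Finset.sum_le_sum fun E _ => ?_
    rw [← integral_const_mul, ← integral_const_mul,
      ← integral_sub (T.integrableOn_elem E (by fun_prop)) (T.integrableOn_elem E (by fun_prop))]
    refine setIntegral_mono_on (T.integrableOn_elem E (by fun_prop))
      (T.integrableOn_elem E (by fun_prop)) (T.polytope E).measurableSet fun x hx => ?_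
    rw [VPoly.val_div_radial, VPoly.inner_grad_sq, hval, sub_zero, real_inner_self_eq_norm_sq]
    have h3 : ‖x‖ ≤ D := mem_closedBall_zero_iff.1 (hsubD T E hx)
    have h4 := VPoly.norm_gradMul_sq_le (θ E) x x
    have h5 : ‖x‖ ^ 2 * (θ E).gradDot (θ E) x ≤ D ^ 2 * (θ E).gradDot (θ E) x :=
      mul_le_mul_of_nonneg_right (pow_le_pow_left₀ (norm_nonneg _) h3 2) (hg0 E x)
    have h6 := (abs_le.1 (abs_real_inner_le_norm ((θ E).gradMul x x) ((θ E).val x))).1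
    have h7 : 2 * (‖(θ E).gradMul x x‖ * ‖(θ E).val x‖)
        ≤ 4 * ‖(θ E).gradMul x x‖ ^ 2 + 1 / 4 * ‖(θ E).val x‖ ^ 2 := by
      nlinarith [sq_nonneg (2 * ‖(θ E).gradMul x x‖ - 1 / 2 * ‖(θ E).val x‖)]
    have h8 : 1 * ‖(θ E).val x‖ ^ 2 ≤ d * ‖(θ E).val x‖ ^ 2 :=
      mul_le_mul_of_nonneg_right hd0 (sq_nonneg _)
    linarith
  have hface : ∑ e : T.faces, T.faceInt e (fun x =>
        ⟪T.jumpV e (fun E => VPoly.radial 0 (θ E).sq) x, T.normal e⟫)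
      ≤ 1 / (4 * K) * ∑ e : T.faces, T.faceSize e * T.faceInt e (fun x => ‖T.avgV e θ x‖ ^ 2)
        + 4 * K * D ^ 2 * J := by
    rw [hJ, Finset.mul_sum, Finset.mul_sum, ← Finset.sum_add_distrib]
    refine Finset.sum_le_sum fun e _ => ?_
    -- The weight 1/(2K) makes the average term cost exactly ¼(X + Y) after the trace inequality.
    have hy := T.faceInt_young e (f := fun x => ‖T.avgV e θ x‖)
      (g := fun x => 2 * D * ‖T.jumpV e θ x‖) (by fun_prop) (by fun_prop)
      (a := 1 / (2 * K)) (by positivity)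
    refine (T.faceInt_mono e (by fun_prop) (by fun_prop) fun x hx => ?_).trans (hy.trans_eq ?_)
    · have hjump : T.jumpV e (fun E => VPoly.radial 0 (θ E).sq) x
          = (T.jump e fun E => (θ E).sq.val x) • x := by
        simp only [jumpV, VPoly.val_radial, sub_zero]
        rcases hE : T.elt₂ e with _ | E
        · simp only [T.jump_of_none e _ hE]
        · simp only [T.jump_of_some e _ hE, sub_smul]
      rw [hjump, real_inner_smul_left]
      have hxD : ‖x‖ ≤ D := by
        obtain ⟨c, -, hec⟩ := (T.facet₁ e).exists_eq
        rw [hec] at hx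
        exact mem_closedBall_zero_iff.1 (hsubD T _ hx.1)
      have h1 : |⟪x, T.normal e⟫| ≤ D := by
        refine (abs_real_inner_le_norm _ _).trans ?_
        rwa [(T.facet₁ e).1, mul_one]
      refine (le_abs_self _).trans ?_
      rw [abs_mul]
      refine (mul_le_mul (T.abs_jump_sq_le θ e x) h1 (abs_nonneg _) (by positivity)).trans_eq ?_
      ring
    · simp only [mul_pow]
      rw [T.faceInt_mul]
      field_simp
      ring
  have hsum : ∑ e : T.faces, T.faceSize e * T.faceInt e (fun x => ‖T.avgV e θ x‖ ^ 2)
      ≤ K * (X + Y) := by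
    refine (T.sum_faces_le _ (fun E x => ‖(θ E).val x‖ ^ 2) (fun e => by fun_prop)
      (fun E => by fun_prop) fun e x => T.norm_avgV_sq_le θ e x).trans ?_
    rw [hX, hY, innerV, ← Finset.sum_add_distrib, Finset.mul_sum]
    refine Finset.sum_le_sum fun E _ => (htr T hT E (θ E)).trans_eq ?_
    rw [← T.elemInt_add E (by fun_prop) (by fun_prop)]
    simp only [real_inner_self_eq_norm_sq]
  have h4 := mul_le_mul_of_nonneg_left hsum (show 0 ≤ 1 / (4 * K) by positivity)
  have h5 : 1 / (4 * K) * (K * (X + Y)) = (X + Y) / 4 := by field_simp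
  rw [← hdiv] at hface
  have h6 : B * (Y + σ * J) = (8 * D ^ 2 + 1 / 2) * Y + 8 * K * D ^ 2 * J
      + ((8 * D ^ 2 + 1 / 2) * (σ * J) + 8 * K * D ^ 2 / σ * Y) := by
    rw [hB]
    field_simp
    ring
  have h7 : 0 ≤ (8 * D ^ 2 + 1 / 2) * (σ * J) + 8 * K * D ^ 2 / σ * Y := by positivity
  rw [h6]
  linarith

theorem IsRegular.mono {T : Mesh Ω} {ρ ρ' : ℝ} (h : T.IsRegular ρ) (hρ : ρ ≤ ρ') :
    T.IsRegular ρ' := fun E hE => (h E hE).trans hρ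

end Mesh

/-! ### The theorem -/

theorem theorem5p1 {d : ℕ} (hd : d = 2 ∨ d = 3) {Ω : Set (Pt d)} (hΩ : IsPolyhedralDomain Ω) :
    -- the constants exist, uniformly for all meshes of a regular family
    (∀ ρ : ℝ,
      (∃ M Mt : ℕ → ℝ, ∀ T : Mesh Ω, T.IsRegular ρ → ∀ k₁ k₂ : ℕ,
        T.IsLiftConstR k₁ k₂ (M k₂) ∧ T.IsLiftConstG k₁ k₂ (Mt k₁)) ∧
      (∀ σ : ℝ, 0 < σ → ∃ C : ℝ, ∀ T : Mesh Ω, T.IsRegular ρ → ∀ k : ℕ,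
        T.IsPoincareConst k σ C)) ∧
    -- stability with any such constants
    (∀ (T : Mesh Ω) (k₁ k₂ : ℕ), 1 ≤ k₁ → k₁ ≤ k₂ + 1 → k₂ ≤ k₁ + 1 →
      ∀ ε σ σt μ δ κ M Mt C : ℝ, ε = -1 ∨ ε = 0 ∨ ε = 1 → 0 < μ → 0 < δ →
        T.IsCoerciveEps k₁ ε σ κ → T.IsCoerciveEllip k₂ σt →
        T.IsLiftConstR k₁ k₂ M → T.IsLiftConstG k₁ k₂ Mt → T.IsPoincareConst k₁ σ C →
        M ^ 2 / d ≤ σ → Mt ^ 2 ≤ σt → δ ≤ κ / (2 * d) →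
      ∀ (τ : ℝ) (N : ℕ), 0 < τ →
      ∀ (u0 : Pt d → Pt d) (f : ℝ → Pt d → Pt d), MemLp u0 2 (volume.restrict Ω) →
        (∀ n ∈ Finset.Icc 1 N, MemLp (f (n * τ)) 2 (volume.restrict Ω)) →
      ∀ (u v : ℕ → T.BVec) (φ p : ℕ → T.BScal),
        T.IsPressureCorrection k₁ k₂ ε σ σt μ δ τ N u0 f u v φ p →
      ∀ m : ℕ, 1 ≤ m → m ≤ N →
        T.normV (u m) ^ 2
            + κ * μ / 2 * τ * ∑ n ∈ Finset.Icc 1 m, T.dgNormV σ (v n) ^ 2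
            + 1 / 2 * τ ^ 2 * T.dgNormS σt (T.auxXi k₂ μ δ v p m) ^ 2
            + 1 / (δ * μ) * τ * T.normS (T.auxS k₂ μ δ v m) ^ 2
          ≤ (∫ x in Ω, ‖u0 x‖ ^ 2)
            + 2 * C ^ 2 / (κ * μ) * τ *
              ∑ n ∈ Finset.Icc 1 m, ∫ x in Ω, ‖f (n * τ) x‖ ^ 2) := by
  have hd1 : 1 < d := by omega
  refine ⟨fun ρ => ?_, ?_⟩
  -- The constants are constructed for a positive bound; regularity is monotone in ρ, so an
  -- arbitrary real ρ is covered.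
  · have hρ : 0 < max ρ 1 := lt_max_of_lt_right one_pos
    refine ⟨?_, fun σ hσ => ?_⟩
    · choose M hM using Mesh.exists_isLiftConstR hd1 hΩ hρ
      choose Mt hMt using Mesh.exists_isLiftConstG hd1 hΩ hρ
      exact ⟨M, Mt, fun T hT k₁ k₂ => ⟨hM k₂ T (hT.mono (le_max_left _ _)) k₁,
        hMt k₁ T (hT.mono (le_max_left _ _)) k₂⟩⟩
    · obtain ⟨C, hC⟩ := Mesh.exists_isPoincareConst hd1 hΩ hρ hσ
      exact ⟨C, fun T hT k => hC T (hT.mono (le_max_left _ _)) k⟩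
  · intro T k₁ k₂ _ hk hk' ε σ σt μ δ κ M Mt C _ hμ hδ hcoer hell hR hG hC hM hMt hδκ τ N hτ u0 f hu0
      hf u v φ p h m _ hm
    exact T.stability (by omega) hΩ hk hk' hμ hδ hcoer hell hR hG hC hM hMt hδκ hτ hu0 hf h hm
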